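/- Let $\mathbf N=\{1,2,\dots\}$, let $c_{00}$ be the space of finitely supported real sequences indexed by $\mathbf N$ with unit vectors $(e_i)$, and let $Ex$ denote the restriction of $x\in c_{00}$ to $E\subseteq\mathbf N$. The Schreier families are $S_0=\{\{n\}:n\in\mathbf N\}\cup\{\emptyset\}$ and $S_{n+1}=\{\bigcup_{i=1}^kF_i: k\in\mathbf N,\ k\le F_1<\dots<F_k,\ F_i\in S_n\}$ (empty sets $F_i$ are allowed and impose no restriction). A finite family $(E_i)$ of non-empty finite subsets of $\mathbf N$ is $S_n$-admissible if $E_1<E_2<\cdots$ and $\{\min E_i\}\in S_n$, and $S_n$-allowable if the $E_i$ are pairwise disjoint and $\{\min E_i\}\in S_n$. Let $(\theta_n)_{n\in\mathbf N}\subset(0,1)$ with $\lim_n\theta_n=0$, let $s\in\mathbf N$, and let $(\alpha_n)_{n\in\mathbf N}\subset(0,1)$ with $\sum_n\alpha_n=1$ and $\ell\le\alpha_{n+1}/\alpha_n\le u$ for all $n$, for some $\ell,u\in(0,1)$. Put $\|x\|_{V,0}=\|x\|_{W,0}=\|x\|_\infty$ and, for $m\ge0$, $$\|x\|_{V,m+1}=\|x\|_\infty\vee\sup_n\sup\Big\{\theta_n\sum_i\|E_ix\|_{V,m}:(E_i)\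 S_n\text{-allowable}\Big\},$$ $$\|x\|_{W,m+1}=\|x\|_\infty\vee\sup_{n\le s}\sup\Big\{\theta_n\sum_i\|E_ix\|_{W,m}:(E_i)\ S_n\text{-allowable}\Big\}\vee\sup_{n\ge s+1}\sup\Big\{\theta_n\sum_i\|E_ix\|_{W,m}:(E_i)\ S_n\text{-admissible}\Big\}.$$ Let $V$, $W$, $V'$, $W'$ be the completions of $c_{00}$ under the norms $\|x\|_V=\lim_m\|x\|_{V,m}$, $\|x\|_W=\lim_m\|x\|_{W,m}$, $\|x\|_{V'}=\sum_{n\ge1}\alpha_n\|x\|_{V,n}$ and $\|x\|_{W'}=\sum_{n\ge1}\alpha_n\|x\|_{W,n}$. For a real Banach space $X$ with a 1-unconditional basis (i.e. the norm is monotone in the absolute values of the coordinates), identified with a space of sequences through the coordinates, the 2-convexification is the Banach space $X^{(2)}=\{x:\ x^2\in X\}$ (coordinatewise square) with norm $\|x\|_{(2)}=\|x^2\|^{1/2}$. A Banach space $X$ is a weak Hilbert space if there are $\delta>0$, $C\ge1$ such that every finite dimensional subspace $E\subseteq X$ contains a subspace $F$ with $\dim F\ge\delta\dim E$, Banach–Mazur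 distance from $F$ to $\ell_2^{\dim F}$ at most $C$, and a projection $P:X\to F$ with $\|P\|\le C$. It is $\ell_2$-saturated if every infinite dimensional closed subspace contains a further subspace isomorphic to $\ell_2$. Then: 1. a Banach space $X$ with a 1-unconditional basis contains an isomorph of $\ell_1$ if and only if $X^{(2)}$ contains an isomorph of $\ell_2$; 2. $V^{(2)}$ and $W^{(2)}$ are weak Hilbert spaces that contain no isomorph of $\ell_2$; 3. $V'^{(2)}$ and $W'^{(2)}$ are $\ell_2$-saturated weak Hilbert spaces that are not isomorphic to $\ell_2$. -/

import Mathlib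

open Filter Topology Set

/-!
Conventions: `ℕ+` is the set of positive integers, `c₀₀` is `ℕ+ →₀ ℝ`, all spaces are real.
-/

/-! ### Schreier families, admissible and allowable families -/

/-- The Schreier families: `schreier 0` consists of the singletons and `∅`; a set belongs to
`schreier (n + 1)` if it is `F₁ ∪ ⋯ ∪ F_k` for some `k ≥ 1`, with
`k ≤ F₁ < F₂ < ⋯ < F_k` and every `F_i` in `schreier n`. -/
def schreier : ℕ → Set (Finset ℕ+)
  | 0 => {F | F = ∅ ∨ ∃ n, F = {n}}
  | n + 1 => {F | ∃ (k : ℕ+) (G : Fin k → Finset ℕ+),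
      (∀ i, G i ∈ schreier n) ∧
      (∀ i, ∀ a ∈ G i, k ≤ a) ∧
      (∀ i j, i < j → ∀ a ∈ G i, ∀ b ∈ G j, a < b) ∧
      F = Finset.univ.biUnion G}

/-- `(E_i)` is a family of non-empty finite sets with `(min E_i) ∈ S_n`. -/
def MinsInSchreier (n : ℕ) {k : ℕ} (E : Fin k → Finset ℕ+) : Prop :=
  ∃ h : ∀ i, (E i).Nonempty, Finset.univ.image (fun i => (E i).min' (h i)) ∈ schreier n

/-- `S_n`-admissible families: `E_1 < E_2 < ⋯` and `(min E_i) ∈ S_n`. -/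
def IsAdmissible (n : ℕ) {k : ℕ} (E : Fin k → Finset ℕ+) : Prop :=
  (∀ i j, i < j → ∀ a ∈ E i, ∀ b ∈ E j, a < b) ∧ MinsInSchreier n E

/-- `S_n`-allowable families: the `E_i` are pairwise disjoint and `(min E_i) ∈ S_n`. -/
def IsAllowable (n : ℕ) {k : ℕ} (E : Fin k → Finset ℕ+) : Prop :=
  (∀ i j, i ≠ j → Disjoint (E i) (E j)) ∧ MinsInSchreier n E

theorem IsAdmissible.isAllowable {n k : ℕ} {E : Fin k → Finset ℕ+} (h : IsAdmissible n E) :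
    IsAllowable n E := by
  refine ⟨fun i j hij => ?_, h.2⟩
  rw [Finset.disjoint_left]
  intro a hai haj
  rcases lt_or_gt_of_ne hij with h' | h'
  · exact lt_irrefl _ (h.1 i j h' a hai a haj)
  · exact lt_irrefl _ (h.1 j i h' a haj a hai)

/-- A rule saying which finite families `(E_i)` are permitted at level `n`. -/
abbrev FamilyRule := ℕ+ → (k : ℕ) → (Fin k → Finset ℕ+) → Prop

/-- The rule for `V`: all `S_n`-allowable families. -/
def ruleV : FamilyRule := fun n _ E => IsAllowable n E

/-- The rule for `W`: `S_n`-allowable families for `n ≤ s`, `S_n`-admissible for `n ≥ s + 1`. -/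
def ruleW (s : ℕ+) : FamilyRule := fun n _ E =>
  (n ≤ s ∧ IsAllowable n E) ∨ (s + 1 ≤ n ∧ IsAdmissible n E)

/-- All families permitted by the rule consist of pairwise disjoint sets. -/
def FamilyRule.Disj (A : FamilyRule) : Prop :=
  ∀ n k (E : Fin k → Finset ℕ+), A n k E → ∀ i j, i ≠ j → Disjoint (E i) (E j)

theorem ruleV_disj : ruleV.Disj := fun _ _ _ h => h.1

theorem ruleW_disj (s : ℕ+) : (ruleW s).Disj := by
  rintro n k E (⟨_, h⟩ | ⟨_, h⟩)
  · exact h.1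
  · exact h.isAllowable.1

/-! ### Norms on `c₀₀` -/

/-- A norm on `c₀₀` for which the unit vector basis is normalized and 1-unconditional. -/
structure UncNorm where
  /-- the norm -/
  toFun : (ℕ+ →₀ ℝ) → ℝ
  add_le : ∀ x y, toFun (x + y) ≤ toFun x + toFun y
  smul_eq : ∀ (c : ℝ) x, toFun (c • x) = |c| * toFun x
  mono : ∀ x y, (∀ i, |x i| ≤ |y i|) → toFun x ≤ toFun y
  single_one : ∀ i, toFun (Finsupp.single i 1) = 1

/-- The restriction `E x` of a vector to a set of coordinates. -/
noncomputable def restr (E : Finset ℕ+) (x : ℕ+ →₀ ℝ) : ℕ+ →₀ ℝ := x.filter (· ∈ E)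

/-- The `ℓ₁` norm on `c₀₀` (an auxiliary upper bound). -/
noncomputable def l1Norm (x : ℕ+ →₀ ℝ) : ℝ := ∑ i ∈ x.support, |x i|

/-- The sup norm on `c₀₀`. -/
noncomputable def supNorm (x : ℕ+ →₀ ℝ) : ℝ := ⨆ i, |x i|

theorem restr_apply (E : Finset ℕ+) (x : ℕ+ →₀ ℝ) (i : ℕ+) :
    restr E x i = if i ∈ E then x i else 0 := by
  classical
  simp [restr, Finsupp.filter_apply]

theorem restr_add (E : Finset ℕ+) (x y : ℕ+ →₀ ℝ) : restr E (x + y) = restr E x + restr E y :=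
  Finsupp.filter_add

theorem restr_smul (E : Finset ℕ+) (c : ℝ) (x : ℕ+ →₀ ℝ) : restr E (c • x) = c • restr E x :=
  Finsupp.filter_smul

namespace UncNorm

theorem zero (N : UncNorm) : N.toFun 0 = 0 := by
  have := N.smul_eq 0 0
  simpa using this

theorem nonneg (N : UncNorm) (x) : 0 ≤ N.toFun x := by
  have h := N.mono 0 x (fun i => by simp)
  rwa [N.zero] at h

theorem coord_le (N : UncNorm) (x) (i : ℕ+) : |x i| ≤ N.toFun x := by
  classical
  have h := N.mono (x i • Finsupp.single i 1) x (fun j => by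
    by_cases hj : i = j
    · subst hj; simp
    · simp [hj])
  rwa [N.smul_eq, N.single_one, mul_one] at h

theorem le_l1 (N : UncNorm) (x) : N.toFun x ≤ l1Norm x := by
  classical
  have key : ∀ s : Finset ℕ+, N.toFun (∑ i ∈ s, Finsupp.single i (x i)) ≤ ∑ i ∈ s, |x i| := by
    intro s
    induction s using Finset.induction_on with
    | empty => simp [N.zero]
    | insert a s ha ih =>
      rw [Finset.sum_insert ha, Finset.sum_insert ha]
      refine (N.add_le _ _).trans (add_le_add ?_ ih)
      have : Finsupp.single a (x a) = x a • Finsupp.single a (1 : ℝ) := by simp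
      rw [this, N.smul_eq, N.single_one, mul_one]
  have h := key x.support
  have hx : ∑ i ∈ x.support, Finsupp.single i (x i) = x := Finsupp.sum_single x
  rwa [hx] at h

theorem eq_zero (N : UncNorm) {x} (h : N.toFun x = 0) : x = 0 := by
  ext i
  have := N.coord_le x i
  rw [h] at this
  simpa using this

end UncNorm

theorem l1Norm_nonneg (x) : 0 ≤ l1Norm x := Finset.sum_nonneg fun _ _ => abs_nonneg _

theorem sum_l1_restr_le (x : ℕ+ →₀ ℝ) {k : ℕ} (E : Fin k → Finset ℕ+)
    (hE : ∀ i j, i ≠ j → Disjoint (E i) (E j)) : ∑ i, l1Norm (restr (E i) x) ≤ l1Norm x := by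
  classical
  have h1 : ∀ i, l1Norm (restr (E i) x) = ∑ j ∈ x.support, if j ∈ E i then |x j| else 0 := by
    intro i
    unfold l1Norm
    rw [← Finset.sum_filter]
    have hs : (restr (E i) x).support = x.support.filter (· ∈ E i) := by
      simp [restr]
    rw [hs]
    refine Finset.sum_congr rfl fun j hj => ?_
    rw [restr_apply, if_pos (Finset.mem_filter.1 hj).2]
  simp_rw [h1]
  rw [Finset.sum_comm]
  refine Finset.sum_le_sum fun j _ => ?_
  by_cases hj : ∃ i, j ∈ E i
  · obtain ⟨i, hi⟩ := hj
    rw [Finset.sum_eq_single i]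
    · rw [if_pos hi]
    · intro i' _ hne
      rw [if_neg]
      exact fun h' => (Finset.disjoint_left.1 (hE i' i hne) h') hi
    · simp
  · push Not at hj
    simp [hj]

theorem bddAbove_abs (x : ℕ+ →₀ ℝ) : BddAbove (range fun i => |x i|) := by
  refine ⟨l1Norm x, ?_⟩
  rintro _ ⟨i, rfl⟩
  by_cases hi : i ∈ x.support
  · exact Finset.single_le_sum (f := fun i => |x i|) (fun _ _ => abs_nonneg _) hi
  · have : x i = 0 := by simpa using hi
    simp only [this, abs_zero]
    exact l1Norm_nonneg x

theorem supNorm_nonneg (x) : 0 ≤ supNorm x := Real.iSup_nonneg fun _ => abs_nonneg _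

theorem supNorm_le_l1 (x) : supNorm x ≤ l1Norm x := by
  refine ciSup_le fun i => ?_
  by_cases hi : i ∈ x.support
  · exact Finset.single_le_sum (f := fun i => |x i|) (fun _ _ => abs_nonneg _) hi
  · have : x i = 0 := by simpa using hi
    simp only [this, abs_zero]
    exact l1Norm_nonneg x

theorem l1Norm_single (i : ℕ+) : l1Norm (Finsupp.single i 1) = 1 := by
  unfold l1Norm
  rw [Finsupp.support_single i one_ne_zero]
  simp

theorem supNorm_single (i : ℕ+) : supNorm (Finsupp.single i 1) = 1 := by
  refine le_antisymm ((supNorm_le_l1 _).trans (l1Norm_single i).le) ?_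
  have := le_ciSup (bddAbove_abs (Finsupp.single i 1)) i
  simp only [Finsupp.single_eq_same, abs_one] at this
  exact this

theorem supNorm_add_le (x y) : supNorm (x + y) ≤ supNorm x + supNorm y := by
  refine ciSup_le fun i => ?_
  refine (abs_add_le (x i) (y i)).trans (add_le_add ?_ ?_)
  · exact le_ciSup (bddAbove_abs x) i
  · exact le_ciSup (bddAbove_abs y) i

theorem supNorm_smul (c : ℝ) (x) : supNorm (c • x) = |c| * supNorm x := by
  unfold supNorm
  rw [Real.mul_iSup_of_nonneg (abs_nonneg c)]
  simp [abs_mul]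

theorem supNorm_mono (x y : ℕ+ →₀ ℝ) (h : ∀ i, |x i| ≤ |y i|) : supNorm x ≤ supNorm y :=
  ciSup_le fun i => (h i).trans (le_ciSup (bddAbove_abs y) i)

/-- The sup norm as an `UncNorm`. -/
noncomputable def UncNorm.sup : UncNorm where
  toFun := supNorm
  add_le := supNorm_add_le
  smul_eq := supNorm_smul
  mono := supNorm_mono
  single_one := supNorm_single

/-! ### The implicit (Tsirelson type) step -/

/-- `sup_n sup { θ_n ∑ᵢ N (E_i x) : (E_i) permitted at level n }`. -/
noncomputable def famSup (θ : ℕ+ → ℝ) (A : FamilyRule) (N : (ℕ+ →₀ ℝ) → ℝ)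
    (x : ℕ+ →₀ ℝ) : ℝ :=
  ⨆ p : {p : ℕ+ × (Σ k : ℕ, (Fin k → Finset ℕ+)) // A p.1 p.2.1 p.2.2},
    θ p.1.1 * ∑ i, N (restr (p.1.2.2 i) x)

/-- `‖x‖_∞ ∨ sup_n sup { θ_n ∑ᵢ N (E_i x) : (E_i) permitted at level n }`. -/
noncomputable def stepFun (θ : ℕ+ → ℝ) (A : FamilyRule) (N : (ℕ+ →₀ ℝ) → ℝ)
    (x : ℕ+ →₀ ℝ) : ℝ :=
  max (supNorm x) (famSup θ A N x)

theorem fam_le_l1 {θ : ℕ+ → ℝ} (hθ : ∀ n, θ n ∈ Ioo (0 : ℝ) 1) {A : FamilyRule}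
    (hA : A.Disj) (N : UncNorm) (x : ℕ+ →₀ ℝ) {n : ℕ+} {k : ℕ} {E : Fin k → Finset ℕ+}
    (hE : A n k E) : θ n * ∑ i, N.toFun (restr (E i) x) ≤ l1Norm x := by
  have h1 : ∑ i, N.toFun (restr (E i) x) ≤ l1Norm x :=
    (Finset.sum_le_sum fun i _ => N.le_l1 _).trans (sum_l1_restr_le x E (hA n k E hE))
  have h0 : 0 ≤ ∑ i, N.toFun (restr (E i) x) := Finset.sum_nonneg fun i _ => N.nonneg _
  calc _ ≤ 1 * ∑ i, N.toFun (restr (E i) x) := mul_le_mul_of_nonneg_right (hθ n).2.le h0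
    _ ≤ _ := by rwa [one_mul]

theorem fam_bdd {θ : ℕ+ → ℝ} (hθ : ∀ n, θ n ∈ Ioo (0 : ℝ) 1) {A : FamilyRule}
    (hA : A.Disj) (N : UncNorm) (x : ℕ+ →₀ ℝ) :
    BddAbove (range fun p : {p : ℕ+ × (Σ k : ℕ, (Fin k → Finset ℕ+)) // A p.1 p.2.1 p.2.2} =>
      θ p.1.1 * ∑ i, N.toFun (restr (p.1.2.2 i) x)) := by
  refine ⟨l1Norm x, ?_⟩
  rintro _ ⟨p, rfl⟩
  exact fam_le_l1 hθ hA N x p.2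

theorem fam_nonneg {θ : ℕ+ → ℝ} (hθ : ∀ n, θ n ∈ Ioo (0 : ℝ) 1) {A : FamilyRule}
    (N : UncNorm) (x : ℕ+ →₀ ℝ) : 0 ≤ famSup θ A N.toFun x :=
  Real.iSup_nonneg fun p => mul_nonneg (hθ p.1.1).1.le (Finset.sum_nonneg fun _ _ => N.nonneg _)

/-- The step norm built from a norm `N`. -/
noncomputable def stepNorm {θ : ℕ+ → ℝ} (hθ : ∀ n, θ n ∈ Ioo (0 : ℝ) 1) {A : FamilyRule}
    (hA : A.Disj) (N : UncNorm) : UncNorm where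
  toFun := stepFun θ A N.toFun
  add_le x y := by
    have hx0 := fam_nonneg hθ (A := A) N x
    have hy0 := fam_nonneg hθ (A := A) N y
    have hfam : famSup θ A N.toFun (x + y) ≤ famSup θ A N.toFun x + famSup θ A N.toFun y := by
      refine Real.iSup_le (fun p => ?_) (add_nonneg hx0 hy0)
      have h1 := le_ciSup (fam_bdd hθ hA N x) p
      have h2 := le_ciSup (fam_bdd hθ hA N y) p
      refine le_trans ?_ (add_le_add h1 h2)
      show θ p.1.1 * _ ≤ θ p.1.1 * _ + θ p.1.1 * _
      rw [← mul_add, ← Finset.sum_add_distrib]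
      refine mul_le_mul_of_nonneg_left (Finset.sum_le_sum fun i _ => ?_) (hθ _).1.le
      rw [restr_add]
      exact N.add_le _ _
    refine max_le ((supNorm_add_le x y).trans ?_) (hfam.trans ?_)
    · exact add_le_add (le_max_left _ _) (le_max_left _ _)
    · exact add_le_add (le_max_right _ _) (le_max_right _ _)
  smul_eq c x := by
    have hfam : famSup θ A N.toFun (c • x) = |c| * famSup θ A N.toFun x := by
      unfold famSup
      rw [Real.mul_iSup_of_nonneg (abs_nonneg c)]
      refine iSup_congr fun p => ?_
      simp_rw [restr_smul, N.smul_eq]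
      rw [← Finset.mul_sum]
      ring
    unfold stepFun
    rw [hfam, supNorm_smul, mul_max_of_nonneg _ _ (abs_nonneg c)]
  mono x y h := by
    refine max_le_max (supNorm_mono x y h) ?_
    refine Real.iSup_le (fun p => ?_) (fam_nonneg hθ (A := A) N y)
    refine le_trans ?_ (le_ciSup (fam_bdd hθ hA N y) p)
    refine mul_le_mul_of_nonneg_left (Finset.sum_le_sum fun i _ => ?_) (hθ _).1.le
    refine N.mono _ _ fun j => ?_
    rw [restr_apply, restr_apply]
    split_ifs
    · exact h j
    · exact le_rfl
  single_one i := by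
    refine le_antisymm (max_le (supNorm_single i).le ?_) ?_
    · refine Real.iSup_le (fun p => ?_) zero_le_one
      exact (fam_le_l1 hθ hA N _ p.2).trans (l1Norm_single i).le
    · exact (supNorm_single i).ge.trans (le_max_left _ _)

/-- The sequence `‖·‖_0 = ‖·‖_∞`,
`‖x‖_{m+1} = ‖x‖_∞ ∨ sup_n sup { θ_n ∑ᵢ ‖E_i x‖_m : (E_i) permitted at level n }`. -/
noncomputable def iterNorm {θ : ℕ+ → ℝ} (hθ : ∀ n, θ n ∈ Ioo (0 : ℝ) 1) {A : FamilyRule}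
    (hA : A.Disj) : ℕ → UncNorm
  | 0 => UncNorm.sup
  | m + 1 => stepNorm hθ hA (iterNorm hθ hA m)

theorem stepNorm_mono {θ : ℕ+ → ℝ} (hθ : ∀ n, θ n ∈ Ioo (0 : ℝ) 1) {A : FamilyRule}
    (hA : A.Disj) (N M : UncNorm) (h : ∀ x, N.toFun x ≤ M.toFun x) (x) :
    (stepNorm hθ hA N).toFun x ≤ (stepNorm hθ hA M).toFun x := by
  refine max_le_max le_rfl ?_
  refine Real.iSup_le (fun p => ?_) (fam_nonneg hθ (A := A) M x)
  refine le_trans ?_ (le_ciSup (fam_bdd hθ hA M x) p)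
  exact mul_le_mul_of_nonneg_left (Finset.sum_le_sum fun i _ => h _) (hθ _).1.le

theorem iterNorm_le_succ {θ : ℕ+ → ℝ} (hθ : ∀ n, θ n ∈ Ioo (0 : ℝ) 1) {A : FamilyRule}
    (hA : A.Disj) (m : ℕ) : ∀ x,
    (iterNorm hθ hA m).toFun x ≤ (iterNorm hθ hA (m + 1)).toFun x := by
  induction m with
  | zero => exact fun x => le_max_left _ _
  | succ m ih => exact stepNorm_mono hθ hA _ _ ih

theorem iterNorm_bdd {θ : ℕ+ → ℝ} (hθ : ∀ n, θ n ∈ Ioo (0 : ℝ) 1) {A : FamilyRule}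
    (hA : A.Disj) (x) : BddAbove (range fun m => (iterNorm hθ hA m).toFun x) := by
  refine ⟨l1Norm x, ?_⟩
  rintro _ ⟨m, rfl⟩
  exact UncNorm.le_l1 _ x

/-- The limit norm `‖x‖ = lim_m ‖x‖_m` (the sequence is nondecreasing, so the limit is the
supremum, see `tendsto_iterNorm`). It satisfies the implicit equation, see `limNorm_eq_step`. -/
noncomputable def limNorm {θ : ℕ+ → ℝ} (hθ : ∀ n, θ n ∈ Ioo (0 : ℝ) 1) {A : FamilyRule}
    (hA : A.Disj) : UncNorm where
  toFun x := ⨆ m, (iterNorm hθ hA m).toFun x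
  add_le x y := ciSup_le fun m => ((iterNorm hθ hA m).add_le x y).trans
    (add_le_add (le_ciSup (iterNorm_bdd hθ hA x) m) (le_ciSup (iterNorm_bdd hθ hA y) m))
  smul_eq c x := by
    simp_rw [UncNorm.smul_eq]
    rw [Real.mul_iSup_of_nonneg (abs_nonneg c)]
  mono x y h := ciSup_le fun m => ((iterNorm hθ hA m).mono x y h).trans
    (le_ciSup (iterNorm_bdd hθ hA y) m)
  single_one i := by simp [UncNorm.single_one]

theorem tendsto_iterNorm {θ : ℕ+ → ℝ} (hθ : ∀ n, θ n ∈ Ioo (0 : ℝ) 1) {A : FamilyRule}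
    (hA : A.Disj) (x) :
    Tendsto (fun m => (iterNorm hθ hA m).toFun x) atTop (𝓝 ((limNorm hθ hA).toFun x)) :=
  tendsto_atTop_ciSup (monotone_nat_of_le_succ fun m => iterNorm_le_succ hθ hA m x)
    (iterNorm_bdd hθ hA x)

/-- The implicit equation
`‖x‖ = ‖x‖_∞ ∨ sup_n sup { θ_n ∑ᵢ ‖E_i x‖ : (E_i) permitted at level n }`. -/
theorem limNorm_eq_step {θ : ℕ+ → ℝ} (hθ : ∀ n, θ n ∈ Ioo (0 : ℝ) 1) {A : FamilyRule}
    (hA : A.Disj) (x) :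
    (limNorm hθ hA).toFun x = stepFun θ A (limNorm hθ hA).toFun x := by
  refine le_antisymm (ciSup_le fun m => ?_) (max_le ?_ ?_)
  · refine (iterNorm_le_succ hθ hA m x).trans ?_
    exact stepNorm_mono hθ hA (iterNorm hθ hA m) (limNorm hθ hA)
      (fun y => le_ciSup (iterNorm_bdd hθ hA y) m) x
  · exact le_ciSup (iterNorm_bdd hθ hA x) 0
  · refine Real.iSup_le (fun p => ?_) (UncNorm.nonneg _ x)
    have h1 : Tendsto (fun m => θ p.1.1 * ∑ i, (iterNorm hθ hA m).toFun (restr (p.1.2.2 i) x))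
        atTop (𝓝 (θ p.1.1 * ∑ i, (limNorm hθ hA).toFun (restr (p.1.2.2 i) x))) :=
      (tendsto_finsetSum _ fun i _ => tendsto_iterNorm hθ hA _).const_mul _
    refine le_of_tendsto' h1 fun m => ?_
    refine le_trans ?_ (le_ciSup (iterNorm_bdd hθ hA x) (m + 1))
    exact (le_ciSup (fam_bdd hθ hA (iterNorm hθ hA m) x) p).trans (le_max_right _ _)

/-- `Σ(α_n ‖·‖_n)`: the norm `x ↦ ∑_{n ≥ 1} α_n ‖x‖_n`. -/
noncomputable def sumNorm {α : ℕ+ → ℝ} (hα : ∀ n, α n ∈ Ioo (0 : ℝ) 1) (hsum : HasSum α 1)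
    (N : ℕ+ → UncNorm) : UncNorm :=
  have hs : ∀ x, Summable fun n => α n * (N n).toFun x := fun x =>
    Summable.of_nonneg_of_le (fun n => mul_nonneg (hα n).1.le ((N n).nonneg x))
      (fun n => mul_le_mul_of_nonneg_left ((N n).le_l1 x) (hα n).1.le)
      (hsum.summable.mul_right (l1Norm x))
  { toFun := fun x => ∑' n, α n * (N n).toFun x
    add_le := fun x y => by
      rw [← (hs x).tsum_add (hs y)]
      refine (hs (x + y)).tsum_le_tsum (fun n => ?_) ((hs x).add (hs y))
      rw [← mul_add]
      exact mul_le_mul_of_nonneg_left ((N n).add_le x y) (hα n).1.le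
    smul_eq := fun c x => by
      rw [← tsum_mul_left]
      refine tsum_congr fun n => ?_
      rw [(N n).smul_eq]
      ring
    mono := fun x y h => (hs x).tsum_le_tsum
      (fun n => mul_le_mul_of_nonneg_left ((N n).mono x y h) (hα n).1.le) (hs y)
    single_one := fun i => by
      simp_rw [UncNorm.single_one, mul_one]
      exact hsum.tsum_eq }

/-! ### Completions of `c₀₀` and their unit vector basis -/

/-- `c₀₀` equipped with the norm `N`. -/
def C00 (_ : UncNorm) : Type := ℕ+ →₀ ℝ

namespace C00

variable (N : UncNorm)

noncomputable instance : AddCommGroup (C00 N) := inferInstanceAs (AddCommGroup (ℕ+ →₀ ℝ))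
noncomputable instance : Module ℝ (C00 N) := inferInstanceAs (Module ℝ (ℕ+ →₀ ℝ))
noncomputable instance : Norm (C00 N) := ⟨N.toFun⟩

theorem core : NormedSpace.Core ℝ (C00 N) where
  norm_nonneg := N.nonneg
  norm_smul c x := N.smul_eq c x
  norm_triangle := N.add_le
  norm_eq_zero_iff x := ⟨fun h => N.eq_zero h, fun h => by rw [h]; exact N.zero⟩

noncomputable instance : NormedAddCommGroup (C00 N) := NormedAddCommGroup.ofCore (core N)
noncomputable instance : NormedSpace ℝ (C00 N) := NormedSpace.ofCore (core N)

end C00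

/-- The completion of `(c₀₀, N)`. -/
abbrev C00Completion (N : UncNorm) : Type := UniformSpace.Completion (C00 N)

/-! ### 1-unconditional bases and the 2-convexification -/

/-- The basis is 1-unconditional: the norm is monotone in the absolute values of the
coordinates. -/
def OneUnconditional {X : Type*} [NormedAddCommGroup X] [NormedSpace ℝ X]
    (b : UnconditionalSchauderBasis ℕ+ ℝ X) : Prop :=
  ∀ x y, (∀ i, |b.coord i y| ≤ |b.coord i x|) → ‖y‖ ≤ ‖x‖

section CompletionBasis

open UniformSpace.Completion

/-- The `i`-th coordinate functional on `(c₀₀, N)`. -/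
noncomputable def C00.coord (N : UncNorm) (i : ℕ+) : C00 N →L[ℝ] ℝ :=
  LinearMap.mkContinuous (Finsupp.lapply i : (ℕ+ →₀ ℝ) →ₗ[ℝ] ℝ) 1 (fun x => by
    rw [one_mul]
    exact N.coord_le x i)

/-- The unit vector `e_i` in `(c₀₀, N)`. -/
noncomputable def C00.unit (N : UncNorm) (i : ℕ+) : C00 N := (Finsupp.single i 1 : ℕ+ →₀ ℝ)

/-- A finitely supported sequence as an element of `(c₀₀, N)`. -/
def C00.mk (N : UncNorm) (x : ℕ+ →₀ ℝ) : C00 N := x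

namespace C00Completion

/-- The continuous extension of the `i`-th coordinate functional to the completion. -/
noncomputable def coord (N : UncNorm) (i : ℕ+) : C00Completion N →L[ℝ] ℝ :=
  (C00.coord N i).extend (toComplL (𝕜 := ℝ) (E := C00 N))

theorem coord_coe (N : UncNorm) (i : ℕ+) (x : C00 N) :
    coord N i (x : C00Completion N) = (show ℕ+ →₀ ℝ from x) i :=
  ContinuousLinearMap.extend_eq (C00.coord N i) (e := toComplL (𝕜 := ℝ) (E := C00 N))
    denseRange_coe (isUniformInducing_coe _) x

theorem sum_coe (N : UncNorm) (F : Finset ℕ+) (x : C00 N) :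
    ∑ i ∈ F, coord N i (x : C00Completion N) • (C00.unit N i : C00Completion N)
      = ((C00.mk N (restr F x)) : C00Completion N) := by
  classical
  simp_rw [coord_coe]
  have h : ∀ i, ((show ℕ+ →₀ ℝ from x) i) • (C00.unit N i : C00Completion N)
      = toComplL (𝕜 := ℝ) (E := C00 N) (((show ℕ+ →₀ ℝ from x) i) • C00.unit N i) := by
    intro i
    rw [map_smul]
    rfl
  simp_rw [h]
  rw [← map_sum]
  show ((_ : C00 N) : C00Completion N) = _
  congr 1
  refine Finsupp.ext fun j => ?_
  have h2 : ∀ (G : Finset ℕ+), (show ℕ+ →₀ ℝ from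
      (∑ i ∈ G, ((show ℕ+ →₀ ℝ from x) i) • C00.unit N i : C00 N)) j
      = ∑ i ∈ G, (show ℕ+ →₀ ℝ from x) i * (Finsupp.single i (1 : ℝ) : ℕ+ →₀ ℝ) j := by
    intro G
    induction G using Finset.induction_on with
    | empty => rfl
    | insert a s ha ih =>
      rw [Finset.sum_insert ha, Finset.sum_insert ha, ← ih]
      rfl
  refine (h2 F).trans ?_
  refine Eq.trans ?_ (restr_apply F x j).symm
  simp [Finsupp.single_apply]

theorem norm_sum_le (N : UncNorm) (F : Finset ℕ+) (z : C00Completion N) :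
    ‖∑ i ∈ F, coord N i z • (C00.unit N i : C00Completion N)‖ ≤ ‖z‖ := by
  induction z using UniformSpace.Completion.induction_on with
  | hp => exact isClosed_le (by fun_prop) continuous_norm
  | ih x =>
    rw [sum_coe, norm_coe, norm_coe]
    refine N.mono _ _ fun j => ?_
    refine le_trans (le_of_eq (congrArg abs (restr_apply F x j))) ?_
    split_ifs
    · exact le_rfl
    · simp

theorem hasSum_coord (N : UncNorm) (z : C00Completion N) :
    HasSum (fun i => coord N i z • (C00.unit N i : C00Completion N)) z := by
  unfold HasSum
  rw [SummationFilter.unconditional_filter, Metric.tendsto_atTop]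
  intro ε hε
  obtain ⟨x, hx⟩ := denseRange_coe.exists_dist_lt z (half_pos hε)
  rw [dist_eq_norm] at hx
  refine ⟨(show ℕ+ →₀ ℝ from x).support, fun F hF => ?_⟩
  have h1 : ∑ i ∈ F, coord N i (x : C00Completion N) • (C00.unit N i : C00Completion N) = x := by
    rw [sum_coe]
    congr 1
    refine Finsupp.ext fun j => (restr_apply F x j).trans ?_
    split_ifs with h
    · rfl
    · exact (Finsupp.notMem_support_iff.1 fun h' => h (hF h')).symm
  have h2 := norm_sum_le N F (z - x)
  have h3 : ∑ i ∈ F, coord N i z • (C00.unit N i : C00Completion N) - z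
      = ∑ i ∈ F, coord N i (z - x) • (C00.unit N i : C00Completion N) - (z - x) := by
    simp_rw [map_sub, sub_smul, Finset.sum_sub_distrib, h1]
    abel
  rw [dist_eq_norm, h3]
  calc _ ≤ _ := norm_sub_le _ _
    _ < ε := by linarith

/-- The unit vectors form an unconditional basis of the completion of `(c₀₀, N)`. -/
noncomputable def basis (N : UncNorm) : UnconditionalSchauderBasis ℕ+ ℝ (C00Completion N) where
  basis i := (C00.unit N i : C00Completion N)
  coord i := coord N i
  ortho i j := by
    classical
    rw [coord_coe]
    show (Finsupp.single j (1 : ℝ) : ℕ+ →₀ ℝ) i = _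
    simp [Finsupp.single_apply, Pi.single_apply, eq_comm]
  expansion z := hasSum_coord N z

theorem basis_oneUnconditional (N : UncNorm) : OneUnconditional (basis N) := by
  intro x y h
  have key : ∀ F : Finset ℕ+, ‖∑ i ∈ F, coord N i y • (C00.unit N i : C00Completion N)‖
      ≤ ‖∑ i ∈ F, coord N i x • (C00.unit N i : C00Completion N)‖ := by
    classical
    intro F
    have e : ∀ w : C00Completion N, ∃ v : ℕ+ →₀ ℝ, (∀ i, v i = if i ∈ F then coord N i w else 0) ∧
        ∑ i ∈ F, coord N i w • (C00.unit N i : C00Completion N) = (C00.mk N v : C00Completion N) := by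
      intro w
      refine ⟨Finsupp.indicator F (fun i _ => coord N i w), fun i => ?_, ?_⟩
      · simp [Finsupp.indicator_apply]
      · have h0 := sum_coe N F (C00.mk N (Finsupp.indicator F (fun i _ => coord N i w)))
        refine Eq.trans (Finset.sum_congr rfl fun i hi => ?_) (h0.trans ?_)
        · rw [coord_coe]
          show _ = (Finsupp.indicator F (fun i _ => coord N i w)) i • _
          rw [Finsupp.indicator_of_mem hi]
        · congr 1
          refine Finsupp.ext fun j => (restr_apply F _ j).trans ?_
          show (if j ∈ F then (Finsupp.indicator F (fun i _ => coord N i w)) j else 0)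
            = (Finsupp.indicator F (fun i _ => coord N i w)) j
          by_cases hj : j ∈ F
          · rw [if_pos hj]
          · rw [if_neg hj, Finsupp.indicator_of_notMem hj]
    obtain ⟨v, hv, hv'⟩ := e x
    obtain ⟨w, hw, hw'⟩ := e y
    rw [hv', hw', norm_coe, norm_coe]
    refine N.mono w v fun i => ?_
    rw [hv, hw]
    split_ifs
    · exact h i
    · exact le_rfl
  exact le_of_tendsto_of_tendsto' (hasSum_coord N y).norm (hasSum_coord N x).norm key

end C00Completion

end CompletionBasis

section Convexification

variable {X : Type*} [NormedAddCommGroup X] [NormedSpace ℝ X]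
  {b : UnconditionalSchauderBasis ℕ+ ℝ X}

theorem basis_coord_ext (b : UnconditionalSchauderBasis ℕ+ ℝ X) {x y : X}
    (h : ∀ i, b.coord i x = b.coord i y) : x = y := by
  have hx := b.expansion x
  simp_rw [h] at hx
  exact hx.unique (b.expansion y)

theorem basis_coord_sum (b : UnconditionalSchauderBasis ℕ+ ℝ X) (t : Finset ℕ+) (a : ℕ+ → ℝ)
    (j : ℕ+) [Decidable (j ∈ t)] :
    b.coord j (∑ i ∈ t, a i • b.basis i) = if j ∈ t then a j else 0 := by
  classical
  rw [map_sum]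
  simp_rw [map_smul, b.ortho, Pi.single_apply]
  simp

/-- A sequence dominated by the coordinates of a vector is itself the coordinate sequence of a
vector. -/
theorem OneUnconditional.exists_of_le [CompleteSpace X] (hb : OneUnconditional b) (z : X)
    (y : ℕ+ → ℝ) (h : ∀ i, |y i| ≤ |b.coord i z|) : ∃ w : X, ∀ i, b.coord i w = y i := by
  classical
  have hs : Summable fun i => y i • b.basis i := by
    rw [summable_iff_vanishing_norm]
    intro ε hε
    obtain ⟨s, hs⟩ := summable_iff_vanishing_norm.1 (b.expansion z).summable ε hε
    refine ⟨s, fun t ht => (hb _ _ fun j => ?_).trans_lt (hs t ht)⟩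
    rw [basis_coord_sum b t (fun i => b.coord i z), basis_coord_sum b t y]
    split_ifs
    · exact h j
    · exact le_rfl
  refine ⟨∑' i, y i • b.basis i, fun j => ?_⟩
  rw [(b.coord j).map_tsum hs, tsum_eq_single j]
  · rw [map_smul, b.ortho]
    simp
  · intro i hi
    rw [map_smul, b.ortho]
    simp [hi.symm]

/-- The sequences `x` with `x² ∈ X`. -/
def conv2Submodule [CompleteSpace X] (b : UnconditionalSchauderBasis ℕ+ ℝ X)
    (hb : OneUnconditional b) : Submodule ℝ (ℕ+ → ℝ) where
  carrier := {x | ∃ z : X, ∀ i, b.coord i z = x i ^ 2}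
  zero_mem' := ⟨0, fun i => by simp⟩
  add_mem' := by
    rintro x y ⟨z, hz⟩ ⟨w, hw⟩
    refine hb.exists_of_le ((2 : ℝ) • (z + w)) _ fun i => ?_
    rw [map_smul, map_add, hz, hw, Pi.add_apply, smul_eq_mul]
    rw [abs_of_nonneg (sq_nonneg _), abs_of_nonneg (by positivity)]
    nlinarith [sq_nonneg (x i - y i)]
  smul_mem' := by
    rintro c x ⟨z, hz⟩
    refine ⟨c ^ 2 • z, fun i => ?_⟩
    rw [map_smul, hz, Pi.smul_apply, smul_eq_mul, smul_eq_mul]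
    ring

/-- The 2-convexification `X^(2) = {x : x² ∈ X}` of a Banach space `X` with a 1-unconditional
basis, with the norm `‖x‖ = ‖x²‖^{1/2}`. -/
def Conv2 [CompleteSpace X] (b : UnconditionalSchauderBasis ℕ+ ℝ X) (hb : OneUnconditional b) :
    Type := conv2Submodule b hb

namespace Conv2

variable [CompleteSpace X] {hb : OneUnconditional b}

instance : AddCommGroup (Conv2 b hb) := inferInstanceAs (AddCommGroup (conv2Submodule b hb))
instance : Module ℝ (Conv2 b hb) := inferInstanceAs (Module ℝ (conv2Submodule b hb))

/-- The underlying sequence of an element of `X^(2)`. -/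
def seq (x : Conv2 b hb) : ℕ+ → ℝ := (show conv2Submodule b hb from x).1

/-- The vector `x² ∈ X`. -/
noncomputable def sq (x : Conv2 b hb) : X := (show conv2Submodule b hb from x).2.choose

theorem coord_sq (x : Conv2 b hb) (i : ℕ+) : b.coord i x.sq = x.seq i ^ 2 :=
  (show conv2Submodule b hb from x).2.choose_spec i

noncomputable instance : Norm (Conv2 b hb) := ⟨fun x => ‖x.sq‖ ^ (1 / 2 : ℝ)⟩

theorem norm_def (x : Conv2 b hb) : ‖x‖ = ‖x.sq‖ ^ (1 / 2 : ℝ) := rfl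

theorem norm_nonneg_aux (x : Conv2 b hb) : 0 ≤ ‖x‖ := Real.rpow_nonneg (norm_nonneg _) _

theorem norm_sq_eq (x : Conv2 b hb) : ‖x‖ ^ 2 = ‖x.sq‖ := by
  rw [norm_def, ← Real.sqrt_eq_rpow, Real.sq_sqrt (norm_nonneg _)]

theorem seq_add (x y : Conv2 b hb) (i) : (x + y).seq i = x.seq i + y.seq i := rfl
theorem seq_sub (x y : Conv2 b hb) (i) : (x - y).seq i = x.seq i - y.seq i := rfl
theorem seq_smul (c : ℝ) (x : Conv2 b hb) (i) : (c • x).seq i = c * x.seq i := rfl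
theorem seq_zero (i) : (0 : Conv2 b hb).seq i = 0 := rfl

theorem ext_seq {x y : Conv2 b hb} (h : ∀ i, x.seq i = y.seq i) : x = y :=
  Subtype.ext (funext h)

theorem eq_zero_of_norm {x : Conv2 b hb} (h : ‖x‖ = 0) : x = 0 := by
  have h1 : x.sq = 0 := by rw [← norm_eq_zero, ← norm_sq_eq, h]; simp
  refine ext_seq fun i => ?_
  have h2 := x.coord_sq i
  rw [h1, map_zero] at h2
  rw [seq_zero]
  exact pow_eq_zero_iff two_ne_zero |>.1 h2.symm

theorem sq_zero : (0 : Conv2 b hb).sq = 0 :=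
  basis_coord_ext b fun i => by rw [coord_sq, seq_zero]; simp

theorem norm_zero_aux : ‖(0 : Conv2 b hb)‖ = 0 := by
  rw [norm_def, sq_zero]
  simp

theorem norm_add_le_aux (x y : Conv2 b hb) : ‖x + y‖ ≤ ‖x‖ + ‖y‖ := by
  rcases (norm_nonneg_aux x).eq_or_lt with hx | hx
  · rw [eq_zero_of_norm hx.symm, zero_add, norm_zero_aux, zero_add]
  rcases (norm_nonneg_aux y).eq_or_lt with hy | hy
  · rw [eq_zero_of_norm hy.symm, add_zero, norm_zero_aux, add_zero]
  refine le_of_sq_le_sq ?_ (by positivity)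
  rw [norm_sq_eq]
  set p := ‖x‖ with hp
  set q := ‖y‖ with hq
  have h1 : ‖(x + y).sq‖ ≤ ‖(1 + q / p) • x.sq + (1 + p / q) • y.sq‖ := by
    refine hb _ _ fun i => ?_
    rw [map_add, map_smul, map_smul, coord_sq, coord_sq, coord_sq, seq_add, smul_eq_mul,
      smul_eq_mul, abs_of_nonneg (sq_nonneg _), abs_of_nonneg (by positivity)]
    have h : (1 + q / p) * x.seq i ^ 2 + (1 + p / q) * y.seq i ^ 2 - (x.seq i + y.seq i) ^ 2
        = (q * x.seq i - p * y.seq i) ^ 2 / (p * q) := by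
      field_simp
      ring
    have : 0 ≤ (q * x.seq i - p * y.seq i) ^ 2 / (p * q) := by positivity
    linarith
  refine h1.trans ((norm_add_le _ _).trans ?_)
  rw [norm_smul, norm_smul, ← norm_sq_eq, ← norm_sq_eq, ← hp, ← hq,
    Real.norm_of_nonneg (by positivity), Real.norm_of_nonneg (by positivity)]
  apply le_of_eq
  field_simp
  ring

theorem norm_smul_aux (c : ℝ) (x : Conv2 b hb) : ‖c • x‖ = ‖c‖ * ‖x‖ := by
  have h : (c • x).sq = c ^ 2 • x.sq := basis_coord_ext b fun i => by
    rw [coord_sq, map_smul, coord_sq, seq_smul, smul_eq_mul]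
    ring
  rw [← sq_eq_sq₀ (norm_nonneg_aux _) (mul_nonneg (norm_nonneg _) (norm_nonneg_aux _)), mul_pow,
    norm_sq_eq, norm_sq_eq, h, norm_smul, norm_pow]

theorem core : NormedSpace.Core ℝ (Conv2 b hb) where
  norm_nonneg := norm_nonneg_aux
  norm_smul := norm_smul_aux
  norm_triangle := norm_add_le_aux
  norm_eq_zero_iff x := ⟨eq_zero_of_norm, fun h => by rw [h, norm_zero_aux]⟩

noncomputable instance : NormedAddCommGroup (Conv2 b hb) := NormedAddCommGroup.ofCore core
noncomputable instance : NormedSpace ℝ (Conv2 b hb) := NormedSpace.ofCore core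

theorem norm_sq_sub_le (x y : Conv2 b hb) : ‖x.sq - y.sq‖ ≤ ‖x - y‖ * ‖x + y‖ := by
  have gen : ∀ u v : Conv2 b hb, ∀ w : X, (∀ i, b.coord i w = u.seq i * v.seq i) →
      ‖w‖ ≤ ‖u‖ * ‖v‖ := by
    intro u v w hw
    have triv : (∀ i, u.seq i * v.seq i = 0) → ‖w‖ ≤ ‖u‖ * ‖v‖ := by
      intro h
      have : w = 0 := basis_coord_ext b fun i => by rw [hw, h, map_zero]
      rw [this, norm_zero]
      positivity
    rcases (norm_nonneg u).eq_or_lt with hu | hu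
    · refine triv fun i => ?_
      rw [eq_zero_of_norm hu.symm, seq_zero, zero_mul]
    rcases (norm_nonneg v).eq_or_lt with hv | hv
    · refine triv fun i => ?_
      rw [eq_zero_of_norm hv.symm, seq_zero, mul_zero]
    set p := ‖u‖ with hp
    set q := ‖v‖ with hq
    have h1 : ‖w‖ ≤ ‖(q / p / 2) • u.sq + (p / q / 2) • v.sq‖ := by
      refine hb _ _ fun i => ?_
      rw [map_add, map_smul, map_smul, coord_sq, coord_sq, hw, smul_eq_mul, smul_eq_mul,
        abs_of_nonneg (a := _ + _) (by positivity)]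
      have e1 : q / p / 2 * u.seq i ^ 2 + p / q / 2 * v.seq i ^ 2 - u.seq i * v.seq i
          = (q * u.seq i - p * v.seq i) ^ 2 / (2 * p * q) := by
        field_simp
        ring
      have e2 : q / p / 2 * u.seq i ^ 2 + p / q / 2 * v.seq i ^ 2 + u.seq i * v.seq i
          = (q * u.seq i + p * v.seq i) ^ 2 / (2 * p * q) := by
        field_simp
        ring
      have p1 : 0 ≤ (q * u.seq i - p * v.seq i) ^ 2 / (2 * p * q) := by positivity
      have p2 : 0 ≤ (q * u.seq i + p * v.seq i) ^ 2 / (2 * p * q) := by positivity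
      rw [abs_le]
      constructor <;> linarith
    refine h1.trans ((norm_add_le _ _).trans ?_)
    rw [norm_smul, norm_smul, ← norm_sq_eq, ← norm_sq_eq, ← hp, ← hq,
      Real.norm_of_nonneg (by positivity), Real.norm_of_nonneg (by positivity)]
    apply le_of_eq
    field_simp
    ring
  refine gen _ _ _ fun i => ?_
  rw [map_sub, coord_sq, coord_sq, seq_sub, seq_add]
  ring

/-- If `v` is Cauchy in `X^(2)` and converges coordinatewise to `y`, then `y ∈ X^(2)` and the
norms converge. -/
theorem cauchy_aux (v : ℕ → Conv2 b hb) (hv : CauchySeq v) (y : ℕ+ → ℝ)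
    (hy : ∀ i, Tendsto (fun m => (v m).seq i) atTop (𝓝 (y i))) :
    ∃ x : Conv2 b hb, x.seq = y ∧ Tendsto (fun m => ‖v m‖) atTop (𝓝 ‖x‖) := by
  obtain ⟨R, hR⟩ := hv.norm_bddAbove
  have hR' : ∀ m, ‖v m‖ ≤ R := fun m => hR ⟨m, rfl⟩
  have hR0 : 0 ≤ R := (norm_nonneg _).trans (hR' 0)
  have hc : CauchySeq fun m => (v m).sq := by
    rw [Metric.cauchySeq_iff] at hv ⊢
    intro ε hε
    obtain ⟨n0, h0⟩ := hv (ε / (2 * R + 1)) (by positivity)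
    refine ⟨n0, fun m hm n hn => ?_⟩
    have h := h0 m hm n hn
    rw [dist_eq_norm] at h ⊢
    rw [lt_div_iff₀ (by positivity)] at h
    refine (norm_sq_sub_le _ _).trans_lt (lt_of_le_of_lt ?_ h)
    refine mul_le_mul_of_nonneg_left ?_ (norm_nonneg _)
    linarith [norm_add_le (v m) (v n), hR' m, hR' n]
  obtain ⟨z, hz⟩ := cauchySeq_tendsto_of_complete hc
  have hzc : ∀ i, b.coord i z = y i ^ 2 := by
    intro i
    have h1 : Tendsto (fun m => b.coord i (v m).sq) atTop (𝓝 (b.coord i z)) :=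
      ((b.coord i).continuous.tendsto z).comp hz
    simp_rw [coord_sq] at h1
    exact tendsto_nhds_unique h1 ((hy i).pow 2)
  let x : Conv2 b hb := (⟨y, z, hzc⟩ : conv2Submodule b hb)
  have hx : x.sq = z := basis_coord_ext b fun i => by rw [coord_sq, hzc]; rfl
  refine ⟨x, rfl, ?_⟩
  simp_rw [norm_def, hx]
  exact hz.norm.rpow_const (Or.inr (by norm_num))

theorem seq_abs_le (x : Conv2 b hb) (i : ℕ+) :
    |x.seq i| ≤ ‖b.coord i‖ ^ (1 / 2 : ℝ) * ‖x‖ := by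
  refine abs_le_of_sq_le_sq (a := x.seq i) ?_ (by positivity)
  rw [mul_pow, ← Real.sqrt_eq_rpow, Real.sq_sqrt (norm_nonneg _), norm_sq_eq, ← coord_sq]
  exact (le_abs_self _).trans ((b.coord i).le_opNorm _)

instance : CompleteSpace (Conv2 b hb) := by
  refine Metric.complete_of_cauchySeq_tendsto fun u hu => ?_
  have hc : ∀ i, ∃ a, Tendsto (fun m => (u m).seq i) atTop (𝓝 a) := by
    intro i
    refine cauchySeq_tendsto_of_complete ?_
    rw [Metric.cauchySeq_iff] at hu ⊢
    intro ε hε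
    set K := ‖b.coord i‖ ^ (1 / 2 : ℝ)
    have hK : 0 ≤ K := by positivity
    obtain ⟨n0, h0⟩ := hu (ε / (K + 1)) (by positivity)
    refine ⟨n0, fun m hm n hn => ?_⟩
    have h := h0 m hm n hn
    rw [dist_eq_norm, lt_div_iff₀ (by positivity)] at h
    rw [Real.dist_eq, ← seq_sub]
    refine (seq_abs_le _ i).trans_lt (lt_of_le_of_lt ?_ h)
    rw [mul_comm]
    exact mul_le_mul_of_nonneg_left (by linarith) (norm_nonneg _)
  choose y hy using hc
  obtain ⟨x, hx, -⟩ := cauchy_aux u hu y hy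
  refine ⟨x, ?_⟩
  rw [Metric.tendsto_atTop]
  intro ε hε
  obtain ⟨n0, h0⟩ := Metric.cauchySeq_iff.1 hu (ε / 2) (by positivity)
  refine ⟨n0, fun n hn => ?_⟩
  have hcs : CauchySeq fun m => u n - u m := by
    rw [Metric.cauchySeq_iff] at hu ⊢
    intro η hη
    obtain ⟨n1, h1⟩ := hu η hη
    refine ⟨n1, fun m hm k hk => ?_⟩
    rw [dist_sub_left]
    exact h1 m hm k hk
  obtain ⟨x', hx', hlim⟩ := cauchy_aux (fun m => u n - u m) hcs (fun i => (u n).seq i - y i)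
    (fun i => (tendsto_const_nhds.sub (hy i)))
  have e : x' = u n - x := ext_seq fun i => by rw [hx', seq_sub, hx]
  rw [dist_eq_norm, ← e]
  refine lt_of_le_of_lt (le_of_tendsto hlim ?_) (half_lt_self hε)
  filter_upwards [eventually_ge_atTop n0] with m hm
  have := h0 n hn m hm
  rw [dist_eq_norm] at this
  exact this.le

end Conv2

end Convexification

/-! ### The spaces `V`, `W`, `V'`, `W'` and their 2-convexifications -/

/-- The 2-convexification of the completion of `(c₀₀, N)`. -/
abbrev Convexified (N : UncNorm) : Type :=
  Conv2 (C00Completion.basis N) (C00Completion.basis_oneUnconditional N)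

/-- The norm of `V = T_M(θ_n, S_n)_n`. -/
noncomputable def normV {θ : ℕ+ → ℝ} (hθ : ∀ n, θ n ∈ Ioo (0 : ℝ) 1) : UncNorm :=
  limNorm hθ ruleV_disj

/-- The norm of `W = T_{M(s)}(θ_n, S_n)_n`. -/
noncomputable def normW {θ : ℕ+ → ℝ} (hθ : ∀ n, θ n ∈ Ioo (0 : ℝ) 1) (s : ℕ+) : UncNorm :=
  limNorm hθ (ruleW_disj s)

/-- The norm `∑_{n ≥ 1} α_n ‖·‖_{V,n}` of `V'`. -/
noncomputable def normVPrime {θ : ℕ+ → ℝ} (hθ : ∀ n, θ n ∈ Ioo (0 : ℝ) 1)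
    {α : ℕ+ → ℝ} (hα : ∀ n, α n ∈ Ioo (0 : ℝ) 1) (hsum : HasSum α 1) : UncNorm :=
  sumNorm hα hsum fun n => iterNorm hθ ruleV_disj n

/-- The norm `∑_{n ≥ 1} α_n ‖·‖_{W,n}` of `W'`. -/
noncomputable def normWPrime {θ : ℕ+ → ℝ} (hθ : ∀ n, θ n ∈ Ioo (0 : ℝ) 1) (s : ℕ+)
    {α : ℕ+ → ℝ} (hα : ∀ n, α n ∈ Ioo (0 : ℝ) 1) (hsum : HasSum α 1) : UncNorm :=
  sumNorm hα hsum fun n => iterNorm hθ (ruleW_disj s) n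

/-! ### Banach space properties -/

/-- The real sequence space `ℓ₁`. -/
abbrev Ell1 : Type := lp (fun _ : ℕ => ℝ) 1

/-- The real sequence space `ℓ₂`. -/
abbrev Ell2 : Type := lp (fun _ : ℕ => ℝ) 2

/-- `X` contains an isomorph of `Y`. -/
def ContainsIsomorph (X Y : Type*) [NormedAddCommGroup X] [NormedSpace ℝ X]
    [NormedAddCommGroup Y] [NormedSpace ℝ Y] : Prop :=
  ∃ Z : Submodule ℝ X, Nonempty (Z ≃L[ℝ] Y)

/-- `X` is `Y`-saturated: every infinite dimensional closed subspace of `X` has a further subspace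
isomorphic to `Y`. -/
def IsSaturated (X Y : Type*) [NormedAddCommGroup X] [NormedSpace ℝ X]
    [NormedAddCommGroup Y] [NormedSpace ℝ Y] : Prop :=
  ∀ Z : Submodule ℝ X, IsClosed (Z : Set X) → ¬ FiniteDimensional ℝ Z →
    ∃ Z' : Submodule ℝ X, Z' ≤ Z ∧ Nonempty (Z' ≃L[ℝ] Y)

/-- The Banach–Mazur distance `d(F)` of a finite dimensional space `F` to `ℓ₂^{dim F}`. -/
noncomputable def euclideanDist (F : Type*) [NormedAddCommGroup F] [NormedSpace ℝ F] : ℝ :=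
  sInf {r | ∃ T : F ≃L[ℝ] EuclideanSpace ℝ (Fin (Module.finrank ℝ F)),
    r = ‖(T : F →L[ℝ] EuclideanSpace ℝ (Fin (Module.finrank ℝ F)))‖ *
      ‖(T.symm : EuclideanSpace ℝ (Fin (Module.finrank ℝ F)) →L[ℝ] F)‖}

/-- Weak Hilbert spaces. -/
def IsWeakHilbert (X : Type*) [NormedAddCommGroup X] [NormedSpace ℝ X] [CompleteSpace X] : Prop :=
  ∃ δ : ℝ, 0 < δ ∧ ∃ C : ℝ, 1 ≤ C ∧ ∀ E : Submodule ℝ X, FiniteDimensional ℝ E →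
    ∃ F : Submodule ℝ X, F ≤ E ∧ ∃ P : X →L[ℝ] F, (∀ x : F, P x = x) ∧
      δ * Module.finrank ℝ E ≤ Module.finrank ℝ F ∧ euclideanDist F ≤ C ∧ ‖P‖ ≤ C

/-! ### Schreier families -/

/-! The two rules are treated together through `FamilyRule.Good`.

Copies of `ℓ₁` and `ℓ₂`. Squaring coordinates sends disjoint blocks of `X^(2)` to disjoint blocks of
`X` and turns `ℓ₂` estimates into `ℓ₁` estimates; signs are irrelevant by unconditionality. It is
therefore enough to replace an arbitrary copy by a block copy. The unit vectors of `ℓ₂` are weakly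
null, so a gliding hump does this. For `ℓ₁` one takes differences along a coordinatewise convergent
subsequence (`containsIsomorph_ell1_iff`).

Weak Hilbert property. Only a lower `ℓ₁` estimate for `S_1`-allowable families is needed
(`isWeakHilbert_convexified`). Applied repeatedly, it yields the estimate for doubly exponentially
many disjoint sets beyond `m`. Given `E` of dimension `n`, choose a subspace of about half the
dimension vanishing on the first `n / 2` coordinates. Rounding a spanning set relative to the sum
`e` of its moduli divides the relevant coordinates into few enough cells on each of which every
vector of the subspace is nearly a multiple of `e`. Functionals norming `e²` on the cells combine
into weights whose weighted `ℓ₂` norm is bounded on the whole space and equivalent to the norm on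
the subspace; an orthogonal projection in the weighted space finishes.

No `ℓ₂` in `V^(2)`, `W^(2)`. Blocks equivalent to `ℓ₁` would give convex sets, moving to infinity,
on which the norm is bounded and bounded away from zero. Let `τ` be the asymptotic cost of cutting
such vectors into finitely many pieces and adding the norms. Averages that are small on Schreier
sets, averaged once more over increasing Schreier levels, have cutting cost at most about `Θ τ` with
`Θ = sup θ < 1`: an almost optimal family either has few minima near the blocks, which gains `θ_n ≤
Θ`, or has so high a level that `θ_n` is negligible, or is one of boundedly many exceptions. This
contradicts the choice of `τ` (`limNorm_not_bounded_below`).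

Saturation of `V'^(2)`, `W'^(2)`. Every block cone contains normalized vectors on which a prescribed
iterate is small (`smallOn_iterNorm`), because sums of normalized blocks grow linearly in norm while
the iterate can be kept bounded. So blocks can be chosen whose norms `∑ α_n ‖·‖_n` live on disjoint
ranges of `n`, and these span `ℓ₁` (`exists_ellOne_blocks`). Taking the cones of squares of blocks
close to a given subspace yields `ℓ₂` inside that subspace (`isSaturated_convexified`). An
isomorphism with `ℓ₂` would make the norm equivalent to the `ℓ₁` norm; as it is dominated by the
limit norm, the limit space would then contain `ℓ₁` blocks. -/

theorem schreier_subset_succ (n : ℕ) : schreier n ⊆ schreier (n + 1) := by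
  intro F hF
  refine ⟨1, fun _ => F, fun _ => hF, fun _ a _ => one_le, fun i j hij => ?_, ?_⟩
  · have h1 := i.2
    have h2 := j.2
    simp only [PNat.one_coe] at h1 h2
    have : (i : ℕ) < j := hij
    omega
  · ext a
    simp only [Finset.mem_biUnion, Finset.mem_univ, true_and]
    exact ⟨fun h => ⟨⟨0, by simp⟩, h⟩, fun ⟨_, h⟩ => h⟩

theorem schreier_mono : Monotone schreier := monotone_nat_of_le_succ schreier_subset_succ

theorem mem_schreier_one {F : Finset ℕ+} (h : ∀ a ∈ F, F.card ≤ (a : ℕ)) : F ∈ schreier 1 := by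
  rcases F.eq_empty_or_nonempty with rfl | hF
  · exact ⟨1, fun _ => ∅, fun _ => Or.inl rfl, by simp, by simp, by ext; simp⟩
  · refine ⟨⟨F.card, hF.card_pos⟩, fun i => {F.orderEmbOfFin rfl i}, fun i => Or.inr ⟨_, rfl⟩,
      ?_, ?_, ?_⟩
    · intro i a ha
      rw [Finset.mem_singleton] at ha
      have := h a (ha ▸ Finset.orderEmbOfFin_mem F rfl i)
      exact this
    · intro i j hij a ha b hb
      rw [Finset.mem_singleton] at ha hb
      rw [ha, hb]
      exact (F.orderEmbOfFin rfl).strictMono hij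
    · ext a
      simp only [Finset.mem_biUnion, Finset.mem_univ, true_and, Finset.mem_singleton]
      constructor
      · intro ha
        have : a ∈ Set.range (F.orderEmbOfFin rfl) := by
          rw [Finset.range_orderEmbOfFin]; exact ha
        obtain ⟨i, hi⟩ := this
        exact ⟨i, hi.symm⟩
      · rintro ⟨i, rfl⟩
        exact Finset.orderEmbOfFin_mem F rfl i

/-! ### Allowable families indexed by arbitrary finite sets -/

theorem min'_injective_of_disjoint {k : ℕ} {E : Fin k → Finset ℕ+}
    (hd : ∀ i j, i ≠ j → Disjoint (E i) (E j)) (h : ∀ i, (E i).Nonempty) :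
    Function.Injective fun i => (E i).min' (h i) := by
  intro i j hij
  by_contra hne
  refine Finset.disjoint_left.1 (hd i j hne) ((E i).min'_mem (h i)) ?_
  have : (E i).min' (h i) = (E j).min' (h j) := hij
  rw [this]
  exact (E j).min'_mem (h j)

theorem restr_restr (E F : Finset ℕ+) (x : ℕ+ →₀ ℝ) : restr E (restr F x) = restr (E ∩ F) x := by
  ext i
  simp only [restr_apply, Finset.mem_inter]
  split_ifs <;> simp_all

theorem restr_eq_self {E : Finset ℕ+} {x : ℕ+ →₀ ℝ} (h : x.support ⊆ E) : restr E x = x := by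
  ext i
  rw [restr_apply]
  split_ifs with hi
  · rfl
  · exact (Finsupp.notMem_support_iff.1 fun h' => hi (h h')).symm

theorem restr_eq_zero {E : Finset ℕ+} {x : ℕ+ →₀ ℝ} (h : Disjoint E x.support) :
    restr E x = 0 := by
  ext i
  rw [restr_apply]
  split_ifs with hi
  · exact Finsupp.notMem_support_iff.1 (Finset.disjoint_left.1 h hi)
  · rfl

theorem UncNorm.restr_le (N : UncNorm) (E : Finset ℕ+) (x) : N.toFun (restr E x) ≤ N.toFun x := by
  refine N.mono _ _ fun i => ?_
  rw [restr_apply]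
  split_ifs <;> simp

theorem UncNorm.sum_le (N : UncNorm) {ι : Type*} (s : Finset ι) (x : ι → ℕ+ →₀ ℝ) :
    N.toFun (∑ i ∈ s, x i) ≤ ∑ i ∈ s, N.toFun (x i) := by
  classical
  induction s using Finset.induction_on with
  | empty => simp [N.zero]
  | insert a s ha ih =>
    rw [Finset.sum_insert ha, Finset.sum_insert ha]
    exact (N.add_le _ _).trans (by gcongr)

/-- `x` restricted to pairwise disjoint sets `E_i`, as many of them as the smallest element of
their union, satisfies a lower `ℓ₁` estimate with constant `c`. -/
def UncNorm.LowerEllOne (N : UncNorm) (c : ℝ) : Prop :=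
  ∀ ⦃ι : Type⦄ (s : Finset ι) (E : ι → Finset ℕ+), (s : Set ι).PairwiseDisjoint E →
    (∀ i ∈ s, ∀ a ∈ E i, s.card ≤ (a : ℕ)) → ∀ x, c * ∑ i ∈ s, N.toFun (restr (E i) x) ≤ N.toFun x

/-- Non-empty disjoint sets, no more than the smallest element of the union, can be enumerated as
an `S_1`-allowable family. -/
theorem isAllowable_one_equivFin {ι : Type} (s : Finset ι) (E : ι → Finset ℕ+)
    (hd : (s : Set ι).PairwiseDisjoint E) (hne : ∀ i ∈ s, (E i).Nonempty)
    (hc : ∀ i ∈ s, ∀ a ∈ E i, s.card ≤ (a : ℕ)) :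
    IsAllowable 1 fun j : Fin s.card => E (s.equivFin.symm j) := by
  refine ⟨fun i j hij => hd (s.equivFin.symm i).2 (s.equivFin.symm j).2 fun h => hij ?_,
    fun i => hne _ (s.equivFin.symm i).2, mem_schreier_one fun a ha => ?_⟩
  · exact s.equivFin.symm.injective (Subtype.ext h)
  · obtain ⟨i, -, rfl⟩ := Finset.mem_image.1 ha
    refine (Finset.card_image_le.trans (by simp)).trans
      (hc _ (s.equivFin.symm i).2 _ (Finset.min'_mem _ _))

/-- Two norms occur so that the lemma serves both the limit norm (`N = M`) and the passage from one
iterate to the next. Empty sets, which allowable families exclude, contribute zero and are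
discarded. -/
theorem lowerEllOne_of_allowable {N M : UncNorm} {c : ℝ}
    (h : ∀ (k : ℕ) (E : Fin k → Finset ℕ+), IsAllowable 1 E →
      ∀ x, c * ∑ i, N.toFun (restr (E i) x) ≤ M.toFun x) {ι : Type} (s : Finset ι)
    (E : ι → Finset ℕ+) (hd : (s : Set ι).PairwiseDisjoint E)
    (hs : ∀ i ∈ s, ∀ a ∈ E i, s.card ≤ (a : ℕ)) (x) :
    c * ∑ i ∈ s, N.toFun (restr (E i) x) ≤ M.toFun x := by
  classical
  set s' := s.filter fun i => (E i).Nonempty with hs'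
  have hsub : s' ⊆ s := Finset.filter_subset _ _
  have e1 : ∑ i ∈ s, N.toFun (restr (E i) x) = ∑ i ∈ s', N.toFun (restr (E i) x) := by
    refine (Finset.sum_subset hsub fun i hi hi' => ?_).symm
    have : E i = ∅ := by
      by_contra hne
      exact hi' (Finset.mem_filter.2 ⟨hi, Finset.nonempty_iff_ne_empty.2 hne⟩)
    rw [this, restr_eq_zero (Finset.disjoint_empty_left _), N.zero]
  have e2 : ∑ i ∈ s', N.toFun (restr (E i) x)
      = ∑ j : Fin s'.card, N.toFun (restr (E (s'.equivFin.symm j)) x) := by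
    rw [← Finset.sum_coe_sort s', ← Equiv.sum_comp s'.equivFin.symm]
  rw [e1, e2]
  refine h _ (fun j : Fin s'.card => E (s'.equivFin.symm j)) ?_ x
  refine isAllowable_one_equivFin s' E (hd.subset (Finset.coe_subset.2 hsub))
    (fun i hi => (Finset.mem_filter.1 hi).2) fun i hi a ha => ?_
  exact (Finset.card_le_card hsub).trans (hs i (hsub hi) a ha)

/-! ### Permitted families and the implicit norm -/

section Rules

variable {θ : ℕ+ → ℝ} (hθ : ∀ n, θ n ∈ Ioo (0 : ℝ) 1) {A : FamilyRule} (hA : A.Disj)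

theorem le_iterNorm_succ (m : ℕ) {n : ℕ+} {k : ℕ} {E : Fin k → Finset ℕ+} (hE : A n k E) (x) :
    θ n * ∑ i, (iterNorm hθ hA m).toFun (restr (E i) x) ≤ (iterNorm hθ hA (m + 1)).toFun x :=
  (le_ciSup (fam_bdd hθ hA (iterNorm hθ hA m) x) ⟨(n, ⟨k, E⟩), hE⟩).trans (le_max_right _ _)

theorem le_limNorm {n : ℕ+} {k : ℕ} {E : Fin k → Finset ℕ+} (hE : A n k E) (x) :
    θ n * ∑ i, (limNorm hθ hA).toFun (restr (E i) x) ≤ (limNorm hθ hA).toFun x := by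
  rw [limNorm_eq_step hθ hA x]
  exact (le_ciSup (fam_bdd hθ hA (limNorm hθ hA) x) ⟨(n, ⟨k, E⟩), hE⟩).trans (le_max_right _ _)

/-- The maximum in the implicit equation is relaxed to a sum. Nothing is lost, since this is applied
to averages of small sup norm. -/
theorem exists_family_of_limNorm (h0 : ∃ p : ℕ+ × (Σ k : ℕ, (Fin k → Finset ℕ+)), A p.1 p.2.1 p.2.2)
    (x) {ε : ℝ} (hε : 0 < ε) : ∃ p : ℕ+ × (Σ k : ℕ, (Fin k → Finset ℕ+)), A p.1 p.2.1 p.2.2 ∧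
      (limNorm hθ hA).toFun x ≤ supNorm x + ε +
        θ p.1 * ∑ i, (limNorm hθ hA).toFun (restr (p.2.2 i) x) := by
  have hne : Nonempty {p : ℕ+ × (Σ k : ℕ, (Fin k → Finset ℕ+)) // A p.1 p.2.1 p.2.2} := by
    obtain ⟨p, hp⟩ := h0
    exact ⟨p, hp⟩
  obtain ⟨p, hp⟩ := exists_lt_of_lt_ciSup (sub_lt_self (famSup θ A (limNorm hθ hA).toFun x) hε)
  refine ⟨p.1, p.2, ?_⟩
  rw [limNorm_eq_step hθ hA x]
  have h1 := fam_nonneg hθ (A := A) (limNorm hθ hA) x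
  have h2 := supNorm_nonneg x
  have h3 : 0 ≤ θ p.1.1 * ∑ i, (limNorm hθ hA).toFun (restr (p.1.2.2 i) x) :=
    mul_nonneg (hθ _).1.le (Finset.sum_nonneg fun i _ => UncNorm.nonneg _ _)
  exact max_le (by linarith) (by linarith)

end Rules

/-- The properties of a rule used below: permitted families are allowable, `S_1`-allowable families
are permitted, and subfamilies of a permitted `S_{n+1}`-family whose minima form an `S_n`-set are
permitted. -/
structure FamilyRule.Good (A : FamilyRule) : Prop where
  allowable : ∀ {n : ℕ+} {k : ℕ} {E : Fin k → Finset ℕ+}, A n k E → IsAllowable n E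
  of_allowable_one : ∀ {k : ℕ} {E : Fin k → Finset ℕ+}, IsAllowable 1 E → A 1 k E
  subfamily : ∀ {n : ℕ+} {k : ℕ} {E : Fin k → Finset ℕ+}, A (n + 1) k E → ∀ s : Finset (Fin k),
    MinsInSchreier n (fun j => E (s.orderEmbOfFin rfl j)) →
    A n s.card fun j => E (s.orderEmbOfFin rfl j)

theorem ruleV_good : ruleV.Good where
  allowable h := h
  of_allowable_one h := h
  subfamily h s hs := ⟨fun _ _ hij => h.1 _ _ fun e => hij ((s.orderEmbOfFin rfl).injective e), hs⟩

theorem ruleW_good (s : ℕ+) : (ruleW s).Good where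
  allowable := by
    rintro n k E (h | h)
    · exact h.2
    · exact h.2.isAllowable
  of_allowable_one h := Or.inl ⟨one_le, h⟩
  subfamily := by
    rintro n k E (h | h) t ht
    · exact Or.inl ⟨(PNat.lt_add_right n 1).le.trans h.1,
        fun _ _ hij => h.2.1 _ _ fun e => hij ((t.orderEmbOfFin rfl).injective e), ht⟩
    · have had : IsAdmissible n fun j => E (t.orderEmbOfFin rfl j) :=
        ⟨fun _ _ hij => h.2.1 _ _ ((t.orderEmbOfFin rfl).strictMono hij), ht⟩
      -- At `n = s` the rule changes from admissible to allowable families, which is harmless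
      -- because admissible families are allowable.
      rcases lt_or_ge s n with hn | hn
      · exact Or.inr ⟨PNat.add_one_le_iff.2 hn, had⟩
      · exact Or.inl ⟨hn, had.isAllowable⟩

theorem FamilyRule.Good.nonempty {A : FamilyRule} (hG : A.Good) :
    ∃ p : ℕ+ × (Σ k : ℕ, (Fin k → Finset ℕ+)), A p.1 p.2.1 p.2.2 := by
  refine ⟨(1, ⟨0, Fin.elim0⟩), hG.of_allowable_one ⟨fun i => i.elim0, fun i => i.elim0, ?_⟩⟩
  exact mem_schreier_one (by simp)

theorem limNorm_lowerEllOne {θ : ℕ+ → ℝ} (hθ : ∀ n, θ n ∈ Ioo (0 : ℝ) 1) {A : FamilyRule}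
    (hA : A.Disj) (hG : A.Good) : (limNorm hθ hA).LowerEllOne (θ 1) := fun _ s E hd hs x =>
  lowerEllOne_of_allowable (fun _ _ h => le_limNorm hθ hA (hG.of_allowable_one h)) s E hd hs x

theorem iterNorm_lowerEllOne {θ : ℕ+ → ℝ} (hθ : ∀ n, θ n ∈ Ioo (0 : ℝ) 1) {A : FamilyRule}
    (hA : A.Disj) (hG : A.Good) (m : ℕ) {ι : Type} (s : Finset ι) (E : ι → Finset ℕ+)
    (hd : (s : Set ι).PairwiseDisjoint E) (hs : ∀ i ∈ s, ∀ a ∈ E i, s.card ≤ (a : ℕ)) (x) :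
    θ 1 * ∑ i ∈ s, (iterNorm hθ hA m).toFun (restr (E i) x)
      ≤ (iterNorm hθ hA (m + 1)).toFun x :=
  lowerEllOne_of_allowable (fun _ _ h => le_iterNorm_succ hθ hA m (hG.of_allowable_one h)) s E hd hs x

/-! ### Averages that are small on Schreier sets -/

/-- The set `G` meets the interval `(r s, r (s + 1)]`. -/
def MeetsInterval (r : ℕ → ℕ) (G : Finset ℕ+) (s : ℕ) : Prop :=
  ∃ g ∈ G, r s < (g : ℕ) ∧ (g : ℕ) ≤ r (s + 1)

open Classical in
/-- The total weight `b` gives to the intervals `(r s, r (s + 1)]` meeting `G`. -/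
noncomputable def hitMass (r : ℕ → ℕ) (G : Finset ℕ+) : (ℕ →₀ ℝ) →ₗ[ℝ] ℝ :=
  Finsupp.linearCombination ℝ fun s => if MeetsInterval r G s then (1 : ℝ) else 0

/-- The sum of the coefficients. -/
noncomputable def totalMass : (ℕ →₀ ℝ) →ₗ[ℝ] ℝ :=
  Finsupp.linearCombination ℝ fun _ => (1 : ℝ)

open Classical in
theorem hitMass_apply (r : ℕ → ℕ) (G : Finset ℕ+) (b : ℕ →₀ ℝ) :
    hitMass r G b = ∑ s ∈ b.support, if MeetsInterval r G s then b s else 0 := by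
  simp [hitMass, Finsupp.linearCombination_apply, Finsupp.sum]

theorem totalMass_apply (b : ℕ →₀ ℝ) : totalMass b = ∑ s ∈ b.support, b s := by
  simp [totalMass, Finsupp.linearCombination_apply, Finsupp.sum]

theorem hitMass_le_totalMass (r : ℕ → ℕ) (G : Finset ℕ+) {b : ℕ →₀ ℝ} (hb : ∀ s, 0 ≤ b s) :
    hitMass r G b ≤ totalMass b := by
  classical
  rw [hitMass_apply, totalMass_apply]
  refine Finset.sum_le_sum fun s _ => ?_
  split_ifs
  · exact le_rfl
  · exact hb s

theorem hitMass_eq_zero {r : ℕ → ℕ} {G : Finset ℕ+} {b : ℕ →₀ ℝ}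
    (h : ∀ s ∈ b.support, ¬ MeetsInterval r G s) : hitMass r G b = 0 := by
  classical
  rw [hitMass_apply]
  exact Finset.sum_eq_zero fun s hs => if_neg (h s hs)

open Classical in
theorem sum_ite_exists_le {ι : Type*} (I : Finset ι) (P : ι → ℕ → Prop) (b : ℕ →₀ ℝ)
    (hb : ∀ s, 0 ≤ b s) : ∑ s ∈ b.support, (if ∃ i ∈ I, P i s then b s else 0)
      ≤ ∑ i ∈ I, ∑ s ∈ b.support, if P i s then b s else 0 := by
  rw [Finset.sum_comm]
  refine Finset.sum_le_sum fun s _ => ?_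
  have h0 : ∀ i ∈ I, 0 ≤ if P i s then b s else 0 := fun i _ => by
    split_ifs
    exacts [hb s, le_rfl]
  split_ifs with h
  · obtain ⟨i, hi, hP⟩ := h
    refine le_trans ?_ (Finset.single_le_sum h0 hi)
    rw [if_pos hP]
  · exact Finset.sum_nonneg h0

theorem hitMass_biUnion_le (r : ℕ → ℕ) {k : ℕ} (G : Fin k → Finset ℕ+) {b : ℕ →₀ ℝ}
    (hb : ∀ s, 0 ≤ b s) :
    hitMass r (Finset.univ.biUnion G) b ≤ ∑ i, hitMass r (G i) b := by
  classical
  have e : ∀ s, MeetsInterval r (Finset.univ.biUnion G) s ↔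
      ∃ i ∈ (Finset.univ : Finset (Fin k)), MeetsInterval r (G i) s := by
    intro s
    simp only [MeetsInterval, Finset.mem_biUnion, Finset.mem_univ, true_and]
    constructor
    · rintro ⟨g, ⟨i, hi⟩, h⟩
      exact ⟨i, g, hi, h⟩
    · rintro ⟨i, g, hi, h⟩
      exact ⟨g, ⟨i, hi⟩, h⟩
  simp only [hitMass_apply, e]
  convert sum_ite_exists_le Finset.univ (fun i s => MeetsInterval r (G i) s) b hb

/-- For every `n` and `ε` there are convex weights on the intervals `(r s, r (s + 1)]`, `s ≥ s₀`,
for which those intervals that meet a given `S_n`-set have mass at most `ε`. -/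
theorem exists_average_hitMass_le {r : ℕ → ℕ} (hr : StrictMono r) (n : ℕ) :
    ∀ (ε : ℝ), 0 < ε → ∀ s₀ : ℕ, ∃ b : ℕ →₀ ℝ, (∀ s, 0 ≤ b s) ∧ totalMass b = 1 ∧
      (∀ s ∈ b.support, s₀ ≤ s) ∧ ∀ G ∈ schreier n, hitMass r G b ≤ ε := by
  classical
  induction n with
  | zero =>
    intro ε hε s₀
    obtain ⟨K, hK⟩ := exists_nat_gt (1 / ε)
    have hK0 : (0 : ℝ) < K := (by positivity : (0 : ℝ) < 1 / ε).trans hK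
    -- A single point lies in at most one of the disjoint intervals, so the uniform average over `K
    -- > 1 / ε` of them works.
    refine ⟨(K : ℝ)⁻¹ • ∑ t ∈ Finset.range K, Finsupp.single (s₀ + t) (1 : ℝ), fun s => ?_, ?_,
      fun s hs => ?_, ?_⟩
    · rw [Finsupp.smul_apply, Finsupp.finsetSum_apply]
      refine smul_nonneg (by positivity) (Finset.sum_nonneg fun t _ => ?_)
      rw [Finsupp.single_apply]
      split_ifs <;> simp
    · rw [map_smul, map_sum]
      simp [totalMass, hK0.ne']
    · by_contra hlt
      refine Finsupp.mem_support_iff.1 hs ?_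
      rw [Finsupp.smul_apply, Finsupp.finsetSum_apply, Finset.sum_eq_zero, smul_zero]
      intro t _
      rw [Finsupp.single_apply, if_neg]
      omega
    · rintro G hG
      have hG' : ∀ a ∈ G, ∀ b ∈ G, a = b := by
        rcases hG with rfl | ⟨n, rfl⟩
        · simp
        · simp
      rw [map_smul, map_sum]
      have : ∑ t ∈ Finset.range K, hitMass r G (Finsupp.single (s₀ + t) 1) ≤ 1 := by
        simp only [hitMass, Finsupp.linearCombination_single, one_smul, Finset.sum_boole]
        have : ((Finset.range K).filter fun t => MeetsInterval r G (s₀ + t)).card ≤ 1 := by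
          rw [Finset.card_le_one]
          intro t ht t' ht'
          obtain ⟨g, hg, h1, h2⟩ := (Finset.mem_filter.1 ht).2
          obtain ⟨g', hg', h1', h2'⟩ := (Finset.mem_filter.1 ht').2
          rw [hG' g' hg' g hg] at h1' h2'
          have a1 := hr.lt_iff_lt.1 (h1.trans_le h2')
          have a2 := hr.lt_iff_lt.1 (h1'.trans_le h2)
          omega
        exact_mod_cast this
      rw [smul_eq_mul, inv_mul_le_iff₀ hK0]
      refine this.trans ?_
      rw [div_lt_iff₀ hε] at hK
      exact hK.le
  | succ n ih =>
    intro ε hε s₀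
    -- The tolerance is divided by `r s + 1` because a union of `k` sets of `S_n` that already meets
    -- an interval before `s` satisfies `k ≤ r s`.
    have pick : ∀ s : ℕ, ∃ (b : ℕ →₀ ℝ) (s' : ℕ), (∀ s, 0 ≤ b s) ∧ totalMass b = 1 ∧ s < s' ∧
        (∀ j ∈ b.support, s ≤ j ∧ j < s') ∧
        ∀ G ∈ schreier n, hitMass r G b ≤ ε / (2 * (r s + 1)) := by
      intro s
      obtain ⟨b, h1, h2, h3, h4⟩ := ih (ε / (2 * (r s + 1))) (by positivity) s
      refine ⟨b, max (s + 1) (b.support.sup id + 1), h1, h2, by omega, fun j hj => ⟨h3 j hj, ?_⟩, h4⟩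
      have : j ≤ b.support.sup id := Finset.le_sup (f := id) hj
      omega
    choose β nx hβ0 hβ1 hnx hβs hβm using pick
    set S : ℕ → ℕ := fun t => nx^[t] s₀ with hS
    have hS1 : ∀ t, S (t + 1) = nx (S t) := fun t => Function.iterate_succ_apply' nx t s₀
    have hSm : StrictMono S := strictMono_nat_of_lt_succ fun t => by rw [hS1]; exact hnx _
    obtain ⟨K, hK⟩ := exists_nat_gt (2 / ε)
    have hK0 : (0 : ℝ) < K := (by positivity : (0 : ℝ) < 2 / ε).trans hK
    refine ⟨(K : ℝ)⁻¹ • ∑ t ∈ Finset.range K, β (S t), fun s => ?_, ?_, fun s hs => ?_, ?_⟩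
    · rw [Finsupp.smul_apply, Finsupp.finsetSum_apply]
      exact smul_nonneg (by positivity) (Finset.sum_nonneg fun t _ => hβ0 _ _)
    · rw [map_smul, map_sum]
      simp [hβ1, hK0.ne']
    · by_contra hlt
      refine Finsupp.mem_support_iff.1 hs ?_
      rw [Finsupp.smul_apply, Finsupp.finsetSum_apply, Finset.sum_eq_zero, smul_zero]
      intro t _
      by_contra hne
      have := (hβs _ s (Finsupp.mem_support_iff.2 hne)).1
      have h0 : S 0 ≤ S t := hSm.monotone (Nat.zero_le t)
      exact hlt (h0.trans this)
    · rintro H ⟨k, G, hG, hk, -, rfl⟩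
      set H := Finset.univ.biUnion G with hH
      -- Let `t₀` be the first average that `H` meets. Earlier averages have no hit mass. On later
      -- ones `k ≤ min H ≤ r (S t)`, and the `k` pieces together have mass at most `ε / 2`. The
      -- average `t₀` itself is only bounded by 1, which costs `1 / K < ε / 2`.
      have main : ∃ t₀, ∀ t, hitMass r H (β (S t)) ≤ ε / 2 + if t = t₀ then 1 else 0 := by
        by_cases hex : ∃ t, ∃ s ∈ (β (S t)).support, MeetsInterval r H s
        · refine ⟨Nat.find hex, fun t => ?_⟩
          rcases lt_trichotomy t (Nat.find hex) with ht | ht | ht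
          · rw [hitMass_eq_zero fun s hs hm => Nat.find_min hex ht ⟨s, hs, hm⟩, if_neg ht.ne]
            positivity
          · rw [if_pos ht]
            refine (hitMass_le_totalMass r H (hβ0 _)).trans ?_
            rw [hβ1]
            linarith
          · rw [if_neg ht.ne', add_zero]
            obtain ⟨s, hs, g, hg, -, hg2⟩ := Nat.find_spec hex
            have h1 : s + 1 ≤ S t := by
              have a1 := (hβs _ s hs).2
              have a2 : S (Nat.find hex + 1) ≤ S t := hSm.monotone ht
              rw [hS1] at a2
              omega
            have h2 : (k : ℕ) ≤ r (S t) := by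
              obtain ⟨i, -, hi⟩ := Finset.mem_biUnion.1 hg
              have a1 : (k : ℕ) ≤ g := hk i g hi
              exact a1.trans (hg2.trans (hr.monotone h1))
            refine (hitMass_biUnion_le r G (hβ0 _)).trans ?_
            refine (Finset.sum_le_sum fun i _ => hβm (S t) (G i) (hG i)).trans ?_
            rw [Finset.sum_const, Finset.card_univ, Fintype.card_fin, nsmul_eq_mul]
            have h3 : ((k : ℕ) : ℝ) ≤ r (S t) + 1 := by exact_mod_cast h2.trans (Nat.le_succ _)
            calc ((k : ℕ) : ℝ) * (ε / (2 * (r (S t) + 1)))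
                ≤ (r (S t) + 1) * (ε / (2 * (r (S t) + 1))) := by gcongr
              _ = ε / 2 := by field_simp
        · refine ⟨0, fun t => ?_⟩
          rw [hitMass_eq_zero fun s hs hm => hex ⟨t, s, hs, hm⟩]
          positivity
      obtain ⟨t₀, ht₀⟩ := main
      rw [map_smul, map_sum, smul_eq_mul, inv_mul_le_iff₀ hK0]
      refine (Finset.sum_le_sum fun t _ => ht₀ t).trans ?_
      rw [Finset.sum_add_distrib, Finset.sum_const, Finset.card_range, nsmul_eq_mul]
      have h5 : ∑ t ∈ Finset.range K, (if t = t₀ then (1 : ℝ) else 0) ≤ 1 := by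
        rw [Finset.sum_ite_eq']
        split_ifs <;> norm_num
      rw [div_lt_iff₀ hε] at hK
      linarith

/-! ### Absence of `ℓ₁` in the limit spaces -/

/-- Restriction to a set of coordinates as a linear map. -/
noncomputable def restrLin (E : Finset ℕ+) : (ℕ+ →₀ ℝ) →ₗ[ℝ] (ℕ+ →₀ ℝ) where
  toFun := restr E
  map_add' := restr_add E
  map_smul' := restr_smul E

theorem restr_sum (E : Finset ℕ+) {ι : Type*} (s : Finset ι) (z : ι → ℕ+ →₀ ℝ) :
    restr E (∑ i ∈ s, z i) = ∑ i ∈ s, restr E (z i) := map_sum (restrLin E) z s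

theorem restr_sum_smul (E : Finset ℕ+) {ι : Type*} (s : Finset ι) (b : ι → ℝ)
    (z : ι → ℕ+ →₀ ℝ) : restr E (∑ i ∈ s, b i • z i) = ∑ i ∈ s, b i • restr E (z i) := by
  rw [restr_sum]
  exact Finset.sum_congr rfl fun i _ => restr_smul _ _ _

theorem UncNorm.sum_smul_le (N : UncNorm) {ι : Type*} (s : Finset ι) (b : ι → ℝ)
    (hb : ∀ i, 0 ≤ b i) (z : ι → ℕ+ →₀ ℝ) :
    N.toFun (∑ i ∈ s, b i • z i) ≤ ∑ i ∈ s, b i * N.toFun (z i) := by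
  refine (N.sum_le _ _).trans (Finset.sum_le_sum fun i _ => ?_)
  rw [N.smul_eq, abs_of_nonneg (hb i)]

/-- `∑ᵢ N (E_i y) ≤ t` for any `M` pairwise disjoint sets `E_i`. -/
def UncNorm.CutBound (N : UncNorm) (M : ℕ) (y : ℕ+ →₀ ℝ) (t : ℝ) : Prop :=
  ∀ ⦃ι : Type⦄ (s : Finset ι) (E : ι → Finset ℕ+), (s : Set ι).PairwiseDisjoint E →
    s.card ≤ M → ∑ i ∈ s, N.toFun (restr (E i) y) ≤ t

theorem UncNorm.CutBound.mono {N : UncNorm} {M M' : ℕ} {y : ℕ+ →₀ ℝ} {t : ℝ}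
    (h : N.CutBound M' y t) (hM : M ≤ M') : N.CutBound M y t :=
  fun _ s E hd hs => h s E hd (hs.trans hM)

theorem UncNorm.CutBound.le {N : UncNorm} {M : ℕ} {y : ℕ+ →₀ ℝ} {t : ℝ}
    (h : N.CutBound M y t) (hM : 1 ≤ M) : N.toFun y ≤ t := by
  have := h (ι := Unit) Finset.univ (fun _ => y.support)
    (fun i _ j _ hij => absurd (Subsingleton.elim i j) hij) (by simpa using hM)
  simpa [restr_eq_self] using this

/-- For fixed sets the sum `∑ N (E_i y)` is convex in `y`. -/
theorem UncNorm.CutBound.sum_smul {N : UncNorm} {M : ℕ} {T : ℝ} {ι : Type*} (I : Finset ι)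
    (b : ι → ℝ) (hb : ∀ i, 0 ≤ b i) (hb1 : ∑ i ∈ I, b i = 1) (z : ι → ℕ+ →₀ ℝ)
    (hz : ∀ i ∈ I, N.CutBound M (z i) T) : N.CutBound M (∑ i ∈ I, b i • z i) T := by
  intro κ s E hd hs
  calc ∑ i ∈ s, N.toFun (restr (E i) (∑ j ∈ I, b j • z j))
      ≤ ∑ i ∈ s, ∑ j ∈ I, b j * N.toFun (restr (E i) (z j)) := by
        refine Finset.sum_le_sum fun i _ => ?_
        rw [restr_sum_smul]
        exact N.sum_smul_le _ _ hb _
    _ = ∑ j ∈ I, b j * ∑ i ∈ s, N.toFun (restr (E i) (z j)) := by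
        rw [Finset.sum_comm]
        simp_rw [Finset.mul_sum]
    _ ≤ ∑ j ∈ I, b j * T :=
        Finset.sum_le_sum fun j hj => mul_le_mul_of_nonneg_left (hz j hj s E hd hs) (hb j)
    _ = T := by rw [← Finset.sum_mul, hb1, one_mul]

/-- `θ_n ∑ᵢ N (E_i y)` for a level `n` and a family `(E_i)`. -/
noncomputable def famVal (N : UncNorm) (θ : ℕ+ → ℝ)
    (p : ℕ+ × (Σ k : ℕ, (Fin k → Finset ℕ+))) (y : ℕ+ →₀ ℝ) : ℝ :=
  θ p.1 * ∑ i, N.toFun (restr (p.2.2 i) y)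

theorem famVal_sum_smul_le {θ : ℕ+ → ℝ} (hθ : ∀ n, θ n ∈ Ioo (0 : ℝ) 1) (N : UncNorm)
    (p : ℕ+ × (Σ k : ℕ, (Fin k → Finset ℕ+))) {ι : Type*}
    (s : Finset ι) (b : ι → ℝ) (hb : ∀ i, 0 ≤ b i) (z : ι → ℕ+ →₀ ℝ) :
    famVal N θ p (∑ j ∈ s, b j • z j) ≤ ∑ j ∈ s, b j * famVal N θ p (z j) := by
  unfold famVal
  calc θ p.1 * ∑ i, N.toFun (restr (p.2.2 i) (∑ j ∈ s, b j • z j))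
      ≤ θ p.1 * ∑ i, ∑ j ∈ s, b j * N.toFun (restr (p.2.2 i) (z j)) := by
        refine mul_le_mul_of_nonneg_left (Finset.sum_le_sum fun i _ => ?_) (hθ _).1.le
        rw [restr_sum_smul]
        exact N.sum_smul_le _ _ hb _
    _ = _ := by
        rw [Finset.sum_comm, Finset.mul_sum]
        refine Finset.sum_congr rfl fun j _ => ?_
        rw [← Finset.mul_sum]
        ring

theorem famVal_le_l1 {θ : ℕ+ → ℝ} (hθ : ∀ n, θ n ∈ Ioo (0 : ℝ) 1) (N : UncNorm)
    {p : ℕ+ × (Σ k : ℕ, (Fin k → Finset ℕ+))}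
    (hp : IsAllowable p.1 p.2.2) (E : Finset ℕ+) (y) :
    famVal N θ p (restr E y) ≤ θ p.1 * l1Norm y := by
  refine mul_le_mul_of_nonneg_left ?_ (hθ _).1.le
  refine (Finset.sum_le_sum fun i _ => N.le_l1 _).trans ((sum_l1_restr_le _ _ hp.1).trans ?_)
  have := sum_l1_restr_le y (fun _ : Fin 1 => E)
    fun i j h => absurd (Subsingleton.elim i j) h
  simpa using this

/-- If no `E_{i,c}` has its minimum in the interval `(ρ, ρ']` that contains the support of `z`, then
only few of them meet the support of `z`. -/
theorem sum_sum_restr_le_of_cutBound {N : UncNorm} {ι : Type} (s : Finset ι)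
    (E : ι → Finset ℕ+) (hd : (s : Set ι).PairwiseDisjoint E)
    (p : ι → ℕ+ × (Σ k : ℕ, (Fin k → Finset ℕ+))) (hp : ∀ i ∈ s, IsAllowable (p i).1 (p i).2.2)
    {ρ ρ' : ℕ} {z : ℕ+ →₀ ℝ} (hz : ∀ a ∈ z.support, (a : ℕ) ≤ ρ') {T : ℝ}
    (hT : N.CutBound (s.card * ρ) z T)
    (hmiss : ∀ i ∈ s, ∀ c, ∀ h : ((p i).2.2 c).Nonempty,
      ((((p i).2.2 c).min' h : ℕ+) : ℕ) ≤ ρ ∨ ρ' < ((((p i).2.2 c).min' h : ℕ+) : ℕ)) :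
    ∑ i ∈ s, ∑ c, N.toFun (restr ((p i).2.2 c) (restr (E i) z)) ≤ T := by
  classical
  -- A set whose minimum exceeds `ρ'` misses the support of `z`, so only minima at most `ρ` count.
  -- For fixed `i` the minima are distinct, hence there are at most `ρ` of them and at most `s.card
  -- * ρ` pieces altogether.
  set J := fun i => (Finset.univ : Finset (Fin (p i).2.1)).filter
    fun c => ∃ h : ((p i).2.2 c).Nonempty, ((((p i).2.2 c).min' h : ℕ+) : ℕ) ≤ ρ with hJ
  have h1 : ∀ i ∈ s, ∑ c, N.toFun (restr ((p i).2.2 c) (restr (E i) z))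
      = ∑ c ∈ J i, N.toFun (restr ((p i).2.2 c ∩ E i) z) := by
    intro i hi
    simp_rw [restr_restr]
    refine (Finset.sum_subset (Finset.subset_univ _) fun c _ hc => ?_).symm
    rw [restr_eq_zero, N.zero]
    rw [Finset.disjoint_left]
    intro a ha haz
    have hne : ((p i).2.2 c).Nonempty := ⟨a, (Finset.mem_inter.1 ha).1⟩
    rcases hmiss i hi c hne with h | h
    · exact hc (Finset.mem_filter.2 ⟨Finset.mem_univ _, hne, h⟩)
    · have h2 : ((((p i).2.2 c).min' hne : ℕ+) : ℕ) ≤ a :=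
        PNat.coe_le_coe _ _ |>.2 (Finset.min'_le _ _ (Finset.mem_inter.1 ha).1)
      have := hz a haz
      omega
  rw [Finset.sum_congr rfl h1, Finset.sum_sigma' s J]
  refine hT (s.sigma J) (fun x => (p x.1).2.2 x.2 ∩ E x.1) ?_ ?_
  · rintro ⟨i, c⟩ hx ⟨i', c'⟩ hx' hne
    have hi := (Finset.mem_sigma.1 hx).1
    have hi' := (Finset.mem_sigma.1 hx').1
    by_cases h : i = i'
    · subst h
      have : c ≠ c' := fun h => hne (by rw [h])
      exact ((hp i hi).1 _ _ this).mono Finset.inter_subset_left Finset.inter_subset_left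
    · exact (hd hi hi' h).mono Finset.inter_subset_right Finset.inter_subset_right
  · rw [Finset.card_sigma, ← smul_eq_mul, ← Finset.sum_const]
    refine Finset.sum_le_sum fun i hi => ?_
    obtain ⟨hdis, hne, -⟩ := hp i hi
    have : (J i).card ≤ (Finset.Icc 1 ρ).card := by
      refine Finset.card_le_card_of_injOn
        (fun c => ((((p i).2.2 c).min' (hne c) : ℕ+) : ℕ)) ?_ ?_
      · intro c hc
        obtain ⟨_, h⟩ := (Finset.mem_filter.1 hc).2
        exact Finset.mem_coe.2 (Finset.mem_Icc.2 ⟨PNat.pos _, h⟩)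
      · intro c _ c' _ hcc
        exact min'_injective_of_disjoint hdis hne (PNat.coe_injective hcc)
    simpa using this

/-- This is where the factor `Θ` is gained. Families of level at least `n'` contribute at most `η`
each. For those of level at most `n` the minima form `S_n`-sets, so the `z j` whose interval
contains a minimum have total weight at most `M * ε`, and the implicit inequality bounds each of
them by `T`. On every other `z j` the families only cut into `M * r j` pieces, at cost `T` before
multiplication by `θ ≤ Θ`. -/
theorem sum_famVal_average_le {θ : ℕ+ → ℝ} (hθ : ∀ n, θ n ∈ Ioo (0 : ℝ) 1) {A : FamilyRule}
    (hA : A.Disj) (hG : A.Good) {Θ : ℝ} (hΘ : ∀ n, θ n ≤ Θ) {ι : Type} (s : Finset ι)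
    (E : ι → Finset ℕ+) (hd : (s : Set ι).PairwiseDisjoint E)
    (p : ι → ℕ+ × (Σ k : ℕ, (Fin k → Finset ℕ+)))
    (hp : ∀ i ∈ s, A (p i).1 (p i).2.1 (p i).2.2) {M : ℕ} (hs : s.card ≤ M)
    {r : ℕ → ℕ} {z : ℕ → ℕ+ →₀ ℝ} (hz : ∀ j, ∀ a ∈ (z j).support, (a : ℕ) ≤ r (j + 1))
    {T : ℝ} (hT0 : 0 ≤ T) (hT : ∀ j, (limNorm hθ hA).CutBound (M * r j + M) (z j) T)
    {b : ℕ →₀ ℝ} (hb0 : ∀ j, 0 ≤ b j) (hb1 : totalMass b = 1) {n n' : ℕ} {ε η : ℝ}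
    (hε : 0 ≤ ε) (hη0 : 0 ≤ η) (hscc : ∀ G ∈ schreier n, hitMass r G b ≤ ε)
    (hη : ∀ ν : ℕ+, n' ≤ (ν : ℕ) → θ ν * l1Norm (∑ j ∈ b.support, b j • z j) ≤ η)
    (hgood : ∀ i ∈ s, ((p i).1 : ℕ) ≤ n ∨ n' ≤ ((p i).1 : ℕ)) :
    ∑ i ∈ s, famVal (limNorm hθ hA) θ (p i) (restr (E i) (∑ j ∈ b.support, b j • z j))
      ≤ M * η + Θ * T + M * ε * T := by
  classical
  have hΘ0 : 0 ≤ Θ := (hθ 1).1.le.trans (hΘ 1)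
  set N := limNorm hθ hA with hN
  set s₁ := s.filter fun i => ((p i).1 : ℕ) ≤ n with hs₁
  have hsub : s₁ ⊆ s := Finset.filter_subset _ _
  have hd₁ : (s₁ : Set ι).PairwiseDisjoint E := hd.subset (Finset.coe_subset.2 hsub)
  have hc₁ : s₁.card ≤ M := (Finset.card_le_card hsub).trans hs
  have hcR : (s₁.card : ℝ) ≤ M := by exact_mod_cast hc₁
  have hbig : ∑ i ∈ s.filter (fun i => ¬ ((p i).1 : ℕ) ≤ n),
      famVal N θ (p i) (restr (E i) (∑ j ∈ b.support, b j • z j)) ≤ M * η := by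
    refine (Finset.sum_le_sum (g := fun _ => η) fun i hi => ?_).trans ?_
    · obtain ⟨hi1, hi2⟩ := Finset.mem_filter.1 hi
      exact (famVal_le_l1 hθ N (hG.allowable (hp i hi1)) _ _).trans
        (hη _ ((hgood i hi1).resolve_left hi2))
    · rw [Finset.sum_const, nsmul_eq_mul]
      have : ((s.filter (fun i => ¬ ((p i).1 : ℕ) ≤ n)).card : ℝ) ≤ M := by
        exact_mod_cast (Finset.card_le_card (Finset.filter_subset _ _)).trans hs
      gcongr
  have hGex : ∀ i ∈ s₁, ∃ G ∈ schreier n, ∀ c (h : ((p i).2.2 c).Nonempty),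
      ((p i).2.2 c).min' h ∈ G := by
    intro i hi
    obtain ⟨hi1, hi2⟩ := Finset.mem_filter.1 hi
    obtain ⟨-, hne, hmem⟩ := hG.allowable (hp i hi1)
    refine ⟨_, schreier_mono hi2 hmem, fun c h => ?_⟩
    exact Finset.mem_image.2 ⟨c, Finset.mem_univ _, rfl⟩
  choose! G hGs hGm using hGex
  have hj : ∀ j, ∑ i ∈ s₁, famVal N θ (p i) (restr (E i) (z j))
      ≤ Θ * T + (if ∃ i ∈ s₁, MeetsInterval r (G i) j then T else 0) := by
    intro j
    split_ifs with hhit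
    · have h1 : ∑ i ∈ s₁, famVal N θ (p i) (restr (E i) (z j)) ≤ T :=
        (Finset.sum_le_sum fun i hi => le_limNorm hθ hA (hp i (hsub hi)) _).trans
          ((hT j).mono (Nat.le_add_left _ _) s₁ E hd₁ hc₁)
      have : 0 ≤ Θ * T := mul_nonneg hΘ0 hT0
      linarith
    · rw [add_zero]
      have h2 := sum_sum_restr_le_of_cutBound s₁ E hd₁ p
        (fun i hi => hG.allowable (hp i (hsub hi))) (hz j)
        ((hT j).mono ((Nat.mul_le_mul_right _ hc₁).trans (Nat.le_add_right _ _))) (by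
          intro i hi c h
          by_contra! hcon
          exact hhit ⟨i, hi, _, hGm i hi c h, hcon.1, hcon.2⟩)
      refine le_trans ?_ (mul_le_mul_of_nonneg_left h2 hΘ0)
      rw [Finset.mul_sum]
      exact Finset.sum_le_sum fun i _ => mul_le_mul_of_nonneg_right (hΘ _)
        (Finset.sum_nonneg fun c _ => N.nonneg _)
  have hsmall : ∑ i ∈ s₁, famVal N θ (p i) (restr (E i) (∑ j ∈ b.support, b j • z j))
      ≤ Θ * T + M * ε * T := by
    have hmass : ∑ j ∈ b.support, (if ∃ i ∈ s₁, MeetsInterval r (G i) j then b j else 0)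
        ≤ M * ε := by
      refine (sum_ite_exists_le s₁ (fun i => MeetsInterval r (G i)) b hb0).trans ?_
      refine (Finset.sum_le_sum (g := fun _ => ε) fun i hi => ?_).trans ?_
      · rw [← hitMass_apply]
        exact hscc _ (hGs i hi)
      · rw [Finset.sum_const, nsmul_eq_mul]
        gcongr
    calc _ ≤ ∑ i ∈ s₁, ∑ j ∈ b.support, b j * famVal N θ (p i) (restr (E i) (z j)) := by
          refine Finset.sum_le_sum fun i _ => ?_
          rw [restr_sum_smul]
          exact famVal_sum_smul_le hθ N _ _ _ hb0 _
      _ = ∑ j ∈ b.support, b j * ∑ i ∈ s₁, famVal N θ (p i) (restr (E i) (z j)) := by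
          rw [Finset.sum_comm]
          simp_rw [Finset.mul_sum]
      _ ≤ ∑ j ∈ b.support,
            b j * (Θ * T + (if ∃ i ∈ s₁, MeetsInterval r (G i) j then T else 0)) :=
          Finset.sum_le_sum fun j _ => mul_le_mul_of_nonneg_left (hj j) (hb0 j)
      _ = (∑ j ∈ b.support, b j) * (Θ * T) +
            (∑ j ∈ b.support, if ∃ i ∈ s₁, MeetsInterval r (G i) j then b j else 0) * T := by
          rw [Finset.sum_mul, Finset.sum_mul, ← Finset.sum_add_distrib]
          refine Finset.sum_congr rfl fun j _ => ?_
          split_ifs <;> ring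
      _ ≤ Θ * T + M * ε * T := by
          rw [← totalMass_apply, hb1, one_mul]
          gcongr
  rw [← Finset.sum_filter_add_sum_filter_not s fun i => ((p i).1 : ℕ) ≤ n]
  linarith

/-- Only finitely many terms exceed `1 / 2`, so the pointwise bound by 1 is uniform. -/
theorem exists_lt_one_bound {θ : ℕ+ → ℝ} (hθ : ∀ n, θ n ∈ Ioo (0 : ℝ) 1)
    (hlim : Tendsto θ atTop (𝓝 0)) : ∃ Θ < 1, ∀ n, θ n ≤ Θ := by
  obtain ⟨n₀, hn₀⟩ := eventually_atTop.1 (hlim.eventually_le_const (by norm_num : (0 : ℝ) < 1 / 2))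
  obtain ⟨m, -, hm⟩ := (Finset.Icc 1 n₀).exists_max_image θ ⟨1, by simp⟩
  refine ⟨max (1 / 2) (θ m), max_lt (by norm_num) (hθ m).2, fun n => ?_⟩
  rcases le_total n n₀ with h | h
  · exact (hm n (by simp [h])).trans (le_max_right _ _)
  · exact (hn₀ n h).trans (le_max_left _ _)

theorem exists_level_mul_le {θ : ℕ+ → ℝ} (hθ : ∀ n, θ n ∈ Ioo (0 : ℝ) 1)
    (hlim : Tendsto θ atTop (𝓝 0)) {η : ℝ} (hη : 0 < η) {L : ℝ} (hL : 0 ≤ L) (n : ℕ) :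
    ∃ n', n ≤ n' ∧ ∀ ν : ℕ+, n' ≤ (ν : ℕ) → θ ν * L ≤ η := by
  obtain ⟨n₀, hn₀⟩ := eventually_atTop.1
    (hlim.eventually_le_const (by positivity : (0 : ℝ) < η / (L + 1)))
  refine ⟨max n n₀, le_max_left _ _, fun ν hν => ?_⟩
  have h1 := hn₀ ν ((le_max_right n (n₀ : ℕ)).trans hν)
  rw [le_div_iff₀ (by positivity)] at h1
  nlinarith [(hθ ν).1]

theorem supNorm_le_of_forall {x : ℕ+ →₀ ℝ} {t : ℝ} (h : ∀ i, |x i| ≤ t) : supNorm x ≤ t :=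
  ciSup_le h

/-- After trimming to the support of `y`, the at most `M` cutting sets lie at or beyond `M`. This
makes the asymptotic cutting cost finite. -/
theorem UncNorm.cutBound_of_lowerEllOne {N : UncNorm} {c : ℝ} (hc : 0 < c) (h : N.LowerEllOne c)
    {M : ℕ} {y : ℕ+ →₀ ℝ} (hy : ∀ a ∈ y.support, M ≤ (a : ℕ)) :
    N.CutBound M y (N.toFun y / c) := by
  classical
  intro ι s E hd hs
  have e : ∀ i, restr (E i) y = restr (E i ∩ y.support) y := fun i => by
    rw [← restr_restr, restr_eq_self (Finset.Subset.refl _)]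
  simp_rw [e]
  rw [le_div_iff₀ hc, mul_comm]
  refine h s (fun i => E i ∩ y.support) (fun i hi j hj hij => (hd hi hj hij).mono
    Finset.inter_subset_left Finset.inter_subset_left) (fun i _ a ha => ?_) y
  exact hs.trans (hy a (Finset.mem_inter.1 ha).2)

/-- In the limit space of a good rule there is no decreasing sequence of non-empty convex sets of
finitely supported vectors moving to infinity on which the norm is bounded and bounded below. -/
theorem limNorm_not_bounded_below {θ : ℕ+ → ℝ} (hθ : ∀ n, θ n ∈ Ioo (0 : ℝ) 1)
    (hlim : Tendsto θ atTop (𝓝 0)) {A : FamilyRule} (hA : A.Disj) (hG : A.Good)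
    (𝒞 : ℕ → Set (ℕ+ →₀ ℝ)) (hconv : ∀ n, Convex ℝ (𝒞 n)) (hanti : Antitone 𝒞)
    (hne : ∀ n, (𝒞 n).Nonempty) (hsupp : ∀ n, ∀ y ∈ 𝒞 n, ∀ a ∈ y.support, n < (a : ℕ))
    {δ B : ℝ} (hδ : 0 < δ) (hlow : ∀ y ∈ 𝒞 0, δ ≤ (limNorm hθ hA).toFun y)
    (hup : ∀ y ∈ 𝒞 0, (limNorm hθ hA).toFun y ≤ B) : False := by
  classical
  set N := limNorm hθ hA with hN
  have hlower : N.LowerEllOne (θ 1) := limNorm_lowerEllOne hθ hA hG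
  -- A number `t` is in `S` if, for some number of pieces and far enough out, every vector has a cut
  -- costing more than `t`. The supremum `τ` is the asymptotic cutting cost; the contradiction will
  -- be a vector of `𝒞 n₀` whose cuts cost less than `τ - η`.
  set S : Set ℝ := {t | ∃ M n, ∀ y ∈ 𝒞 n, ¬ N.CutBound M y t} with hS
  have hSne : δ / 2 ∈ S := ⟨1, 0, fun y hy hcb => by
    have := hcb.le le_rfl
    have := hlow y hy
    linarith⟩
  have hSbdd : BddAbove S := by
    refine ⟨B / θ 1, ?_⟩
    rintro t ⟨M, n, h⟩
    by_contra! hlt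
    obtain ⟨y, hy⟩ := hne (max M n)
    refine h y (hanti (le_max_right _ _) hy) fun ι s E hd hs => ?_
    have h1 := N.cutBound_of_lowerEllOne (hθ 1).1 hlower (M := M) (y := y)
      (fun a ha => ((le_max_left M n).trans_lt (hsupp _ y hy a ha)).le) s E hd hs
    refine h1.trans (le_trans ?_ hlt.le)
    have := (hθ 1).1
    have := hup y (hanti (Nat.zero_le _) hy)
    gcongr
  set τ := sSup S with hτ
  have hτ0 : 0 < τ := (half_pos hδ).trans_le (le_csSup hSbdd hSne)
  obtain ⟨Θ, hΘ1, hΘ⟩ := exists_lt_one_bound hθ hlim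
  have hΘ0 : 0 < Θ := (hθ 1).1.trans_le (hΘ 1)
  -- The final estimate of the cost is `Θ τ + 6 η = τ - 14 η`; the 20 leaves room.
  set η := τ * (1 - Θ) / 20 with hη
  have hη0 : 0 < η := by have := sub_pos.2 hΘ1; positivity
  set T := τ + η with hT
  have hT0 : 0 < T := by positivity
  obtain ⟨t₁, ⟨M, n₀, hM⟩, ht₁⟩ := exists_lt_of_lt_csSup ⟨_, hSne⟩ (sub_lt_self τ hη0)
  -- Hence, arbitrarily far out and for any number of pieces, there are vectors whose cuts all cost
  -- at most `T`.
  have hnot : T ∉ S := fun h => absurd (le_csSup hSbdd h) (by linarith)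
  have hM1 : 1 ≤ M := by
    by_contra! h0
    obtain ⟨y, hy⟩ := hne n₀
    refine hM y hy fun ι s E hd hs => ?_
    have : s = ∅ := Finset.card_eq_zero.1 (by omega)
    rw [this, Finset.sum_empty]
    have : τ * (1 - Θ) ≤ τ * 20 := by gcongr; linarith
    linarith
  have hMR : (1 : ℝ) ≤ M := by exact_mod_cast hM1
  -- the sequence of vectors with small cuts
  have pick : ∀ ρ : ℕ, ∃ (z : ℕ+ →₀ ℝ) (ρ' : ℕ), z ∈ 𝒞 ρ ∧ N.CutBound (M * ρ + M) z T ∧ ρ < ρ' ∧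
      ∀ a ∈ z.support, (a : ℕ) ≤ ρ' := by
    intro ρ
    -- The summand `M * ρ` allows for `M` families with up to `ρ` small minima each, the summand `M`
    -- for cutting directly by the `E_i`.
    have : ∃ z ∈ 𝒞 ρ, N.CutBound (M * ρ + M) z T := by
      by_contra! hcon
      exact hnot ⟨_, _, hcon⟩
    obtain ⟨z, hz, hzc⟩ := this
    refine ⟨z, max (ρ + 1) (z.support.sup fun a => (a : ℕ)), hz, hzc, by omega, fun a ha => ?_⟩
    exact (Finset.le_sup (f := fun a : ℕ+ => (a : ℕ)) ha).trans (le_max_right _ _)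
  choose zf nx hz𝒞 hzT hnx hzs using pick
  set r : ℕ → ℕ := fun j => nx^[j] n₀ with hr
  have hr1 : ∀ j, r (j + 1) = nx (r j) := fun j => Function.iterate_succ_apply' nx j n₀
  have hrm : StrictMono r := strictMono_nat_of_lt_succ fun j => by rw [hr1]; exact hnx _
  set z : ℕ → ℕ+ →₀ ℝ := fun j => zf (r j) with hz
  have hzs' : ∀ j, ∀ a ∈ (z j).support, (a : ℕ) ≤ r (j + 1) := fun j a ha => by
    rw [hr1]; exact hzs _ a ha
  have hzl : ∀ j, ∀ a ∈ (z j).support, r j < (a : ℕ) := fun j a ha => hsupp _ _ (hz𝒞 _) a ha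
  -- the sequence of averages
  set ε := η / (M * T) with hε
  have hε0 : 0 < ε := by positivity
  have pick2 : ∀ q : ℕ × ℕ, ∃ (b : ℕ →₀ ℝ) (q' : ℕ × ℕ), (∀ j, 0 ≤ b j) ∧ totalMass b = 1 ∧
      q.1 < q'.1 ∧ q.2 ≤ q'.2 ∧ (∀ j ∈ b.support, q.1 ≤ j ∧ j < q'.1) ∧
      (∀ G ∈ schreier q.2, hitMass r G b ≤ ε) ∧
      ∀ ν : ℕ+, q'.2 ≤ (ν : ℕ) → θ ν * l1Norm (∑ j ∈ b.support, b j • z j) ≤ η / M := by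
    rintro ⟨s, n⟩
    obtain ⟨b, h1, h2, h3, h4⟩ := exists_average_hitMass_le hrm n ε hε0 s
    obtain ⟨n', hn', hν⟩ := exists_level_mul_le hθ hlim (by positivity : 0 < η / M)
      (l1Norm_nonneg (∑ j ∈ b.support, b j • z j)) n
    refine ⟨b, (max (s + 1) (b.support.sup id + 1), n'), h1, h2, by simp, hn',
      fun j hj => ⟨h3 j hj, ?_⟩, h4, hν⟩
    have : j ≤ b.support.sup id := Finset.le_sup (f := id) hj
    simp only
    omega
  choose β nq hβ0 hβ1 hq1 hq2 hβs hβm hβν using pick2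
  -- The first component is the position where the `t`-th average may start, the second the Schreier
  -- level against which it is small. The next level is so high that `θ` kills the `t`-th average
  -- from there on, so only levels strictly between `(Q t).2` and `(Q (t + 1)).2` are uncontrolled
  -- for it.
  set Q : ℕ → ℕ × ℕ := fun t => nq^[t] (0, 0) with hQ
  have hQ1 : ∀ t, Q (t + 1) = nq (Q t) := fun t => Function.iterate_succ_apply' nq t _
  have hQs : StrictMono fun t => (Q t).1 := strictMono_nat_of_lt_succ fun t => by
    simp only [hQ1]; exact hq1 _
  have hQn : Monotone fun t => (Q t).2 := monotone_nat_of_le_succ fun t => by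
    simp only [hQ1]; exact hq2 _
  set y : ℕ → ℕ+ →₀ ℝ := fun t => ∑ j ∈ (β (Q t)).support, β (Q t) j • z j with hy
  have hβsum : ∀ t, ∑ j ∈ (β (Q t)).support, β (Q t) j = 1 := fun t => by
    rw [← totalMass_apply]; exact hβ1 _
  have hy𝒞 : ∀ t, y t ∈ 𝒞 n₀ := fun t => (hconv n₀).sum_mem (fun j _ => hβ0 _ j) (hβsum t)
    fun j _ => hanti (hrm.monotone (Nat.zero_le j) : r 0 ≤ r j) (hz𝒞 (r j))
  have hycut : ∀ t, N.CutBound M (y t) T := fun t =>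
    UncNorm.CutBound.sum_smul _ _ (hβ0 _) (hβsum t) z
      fun j _ => (hzT (r j)).mono (Nat.le_add_left _ _)
  have hysupp : ∀ t, ∀ a : ℕ+, y t a ≠ 0 → r (Q t).1 < (a : ℕ) ∧ (a : ℕ) ≤ r (Q (t + 1)).1 := by
    intro t a ha
    have : ∃ j ∈ (β (Q t)).support, z j a ≠ 0 := by
      by_contra! hcon
      refine ha ?_
      simp only [hy, Finsupp.finsetSum_apply, Finsupp.smul_apply]
      exact Finset.sum_eq_zero fun j hj => by rw [hcon j hj, smul_zero]
    obtain ⟨j, hj, hja⟩ := this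
    have hj' := hβs _ j hj
    rw [← hQ1] at hj'
    have hsup := Finsupp.mem_support_iff.2 hja
    exact ⟨(hrm.monotone hj'.1).trans_lt (hzl j a hsup), (hzs' j a hsup).trans (hrm.monotone hj'.2)⟩
  obtain ⟨K, hK⟩ := exists_nat_gt (M * T / η)
  have hK0 : (0 : ℝ) < K := (by positivity : (0 : ℝ) < M * T / η).trans hK
  set Y := ∑ t ∈ Finset.range K, (K : ℝ)⁻¹ • y t with hY
  have hY𝒞 : Y ∈ 𝒞 n₀ := (hconv n₀).sum_mem (fun _ _ => by positivity)
    (by simp [hK0.ne']) fun t _ => hy𝒞 t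
  -- The `y t` have disjoint supports, so at each coordinate at most one term of the average
  -- survives.
  have hYsup : supNorm Y ≤ T / K := by
    refine supNorm_le_of_forall fun a => ?_
    have e : Y a = (K : ℝ)⁻¹ * ∑ t ∈ Finset.range K, y t a := by
      rw [hY, Finsupp.finsetSum_apply, Finset.mul_sum]
      rfl
    rw [e, abs_mul, abs_of_nonneg (by positivity : (0 : ℝ) ≤ (K : ℝ)⁻¹), div_eq_inv_mul]
    refine mul_le_mul_of_nonneg_left ?_ (by positivity)
    by_cases hex : ∃ t ∈ Finset.range K, y t a ≠ 0
    · obtain ⟨t, ht, hta⟩ := hex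
      rw [Finset.sum_eq_single t]
      · exact (N.coord_le _ _).trans ((hycut t).le hM1)
      · intro t' _ hne'
        by_contra hta'
        obtain ⟨a1, a2⟩ := hysupp t a hta
        obtain ⟨b1, b2⟩ := hysupp t' a hta'
        have h1 := hQs.lt_iff_lt.1 (hrm.lt_iff_lt.1 (a1.trans_le b2))
        have h2 := hQs.lt_iff_lt.1 (hrm.lt_iff_lt.1 (b1.trans_le a2))
        omega
      · exact fun h => absurd ht h
    · push Not at hex
      rw [Finset.sum_eq_zero hex, abs_zero]
      exact hT0.le
  -- cutting the average
  have hcut := hM Y hY𝒞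
  simp only [UncNorm.CutBound, not_forall, not_le] at hcut
  obtain ⟨ι, s, E, hd, hs, hlt⟩ := hcut
  have hsR : (s.card : ℝ) ≤ M := by exact_mod_cast hs
  choose p hpA hpv using fun i =>
    exists_family_of_limNorm hθ hA hG.nonempty (restr (E i) Y) (by positivity : 0 < η / M)
  -- The uncontrolled level ranges of different `t` are disjoint, so each of the at most `M`
  -- families is bad for at most one `t`. The bad `t` cost at most `M * T / K` in the average.
  have hbad : ((Finset.range K).filter fun t =>
      ∃ i ∈ s, (Q t).2 < ((p i).1 : ℕ) ∧ ((p i).1 : ℕ) < (Q (t + 1)).2).card ≤ M := by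
    refine le_trans ?_ hs
    rcases s.eq_empty_or_nonempty with rfl | ⟨i₀, -⟩
    · simp
    have : Nonempty ι := ⟨i₀⟩
    have hex : ∀ t ∈ (Finset.range K).filter fun t =>
      ∃ i ∈ s, (Q t).2 < ((p i).1 : ℕ) ∧ ((p i).1 : ℕ) < (Q (t + 1)).2, ∃ i ∈ s,
        (Q t).2 < ((p i).1 : ℕ) ∧ ((p i).1 : ℕ) < (Q (t + 1)).2 :=
      fun t ht => (Finset.mem_filter.1 ht).2
    choose! f hfs hf using hex
    refine Finset.card_le_card_of_injOn f hfs fun t ht t' ht' hff => ?_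
    have a := hf t ht
    have a' := hf t' ht'
    rw [← hff] at a'
    by_contra hne'
    rcases lt_or_gt_of_ne hne' with h | h
    · have := hQn (show t + 1 ≤ t' from h)
      simp only at this
      omega
    · have := hQn (show t' + 1 ≤ t from h)
      simp only at this
      omega
  have hMε : M * ε * T = η := by rw [hε]; field_simp
  have hMη : M * (η / M) = η := by field_simp
  have hval : ∀ t, ∑ i ∈ s, famVal N θ (p i) (restr (E i) (y t)) ≤
      (η + Θ * T + η) + if (∃ i ∈ s, (Q t).2 < ((p i).1 : ℕ) ∧ ((p i).1 : ℕ) < (Q (t + 1)).2)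
        then T else 0 := by
    intro t
    split_ifs with hb
    · have h1 : ∑ i ∈ s, famVal N θ (p i) (restr (E i) (y t)) ≤ T :=
        (Finset.sum_le_sum fun i _ => le_limNorm hθ hA (hpA i) _).trans (hycut t s E hd hs)
      have : 0 < Θ * T := by positivity
      linarith
    · have := sum_famVal_average_le hθ hA hG hΘ s E hd p (fun i _ => hpA i) hs hzs' hT0.le
        (fun j => hzT (r j)) (hβ0 (Q t)) (hβ1 (Q t)) hε0.le (by positivity) (hβm (Q t))
        (hβν (Q t)) (fun i hi => by
          by_contra! hcon
          refine hb ⟨i, hi, hcon.1, ?_⟩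
          rw [hQ1]
          exact hcon.2)
      rw [hMε, hMη] at this
      rw [add_zero]
      exact this
  have hsum : ∑ i ∈ s, famVal N θ (p i) (restr (E i) Y) ≤ η + Θ * T + η + M * T / K := by
    calc _ ≤ ∑ i ∈ s, ∑ t ∈ Finset.range K, (K : ℝ)⁻¹ * famVal N θ (p i) (restr (E i) (y t)) := by
          refine Finset.sum_le_sum fun i _ => ?_
          rw [hY, restr_sum_smul]
          exact famVal_sum_smul_le hθ N _ _ _ (fun _ => by positivity) _
      _ = (K : ℝ)⁻¹ * ∑ t ∈ Finset.range K, ∑ i ∈ s, famVal N θ (p i) (restr (E i) (y t)) := by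
          rw [Finset.sum_comm, Finset.mul_sum]
          simp_rw [Finset.mul_sum]
      _ ≤ (K : ℝ)⁻¹ * (K * (η + Θ * T + η) + M * T) := by
          refine mul_le_mul_of_nonneg_left ?_ (by positivity)
          refine (Finset.sum_le_sum fun t _ => hval t).trans ?_
          rw [Finset.sum_add_distrib, Finset.sum_const, Finset.card_range, nsmul_eq_mul,
            ← Finset.sum_filter, Finset.sum_const, nsmul_eq_mul]
          have : (((Finset.range K).filter fun t => ∃ i ∈ s, (Q t).2 < ((p i).1 : ℕ) ∧
            ((p i).1 : ℕ) < (Q (t + 1)).2).card : ℝ) ≤ M := by exact_mod_cast hbad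
          gcongr
      _ = _ := by field_simp
  have hfin : ∑ i ∈ s, N.toFun (restr (E i) Y) ≤
      M * (T / K + η / M) + (η + Θ * T + η + M * T / K) := by
    calc _ ≤ ∑ i ∈ s, ((T / K + η / M) + famVal N θ (p i) (restr (E i) Y)) := by
          refine Finset.sum_le_sum fun i _ => (hpv i).trans ?_
          have : supNorm (restr (E i) Y) ≤ supNorm Y := UncNorm.sup.restr_le _ _
          have := this.trans hYsup
          simp only [famVal]
          linarith
      _ = s.card * (T / K + η / M) + ∑ i ∈ s, famVal N θ (p i) (restr (E i) Y) := by
          rw [Finset.sum_add_distrib, Finset.sum_const, nsmul_eq_mul]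
      _ ≤ _ := by gcongr
  have hKη : M * T / K ≤ η := by
    rw [div_le_iff₀ hK0]
    rw [div_lt_iff₀ hη0] at hK
    linarith
  have e1 : M * (T / K + η / M) = M * T / K + η := by field_simp
  have e2 : Θ * T = Θ * τ + Θ * η := by rw [hT]; ring
  have e3 : Θ * η ≤ η := by nlinarith
  have e4 : 20 * η = τ - Θ * τ := by rw [hη]; ring
  linarith

/-! ### Block cones -/

/-- A decreasing sequence of non-trivial cones of non-negative finitely supported vectors that
moves to infinity. -/
structure BlockCones (𝒞 : ℕ → Set (ℕ+ →₀ ℝ)) : Prop where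
  add : ∀ {n x y}, x ∈ 𝒞 n → y ∈ 𝒞 n → x + y ∈ 𝒞 n
  smul : ∀ {n x} {a : ℝ}, 0 < a → x ∈ 𝒞 n → a • x ∈ 𝒞 n
  anti : Antitone 𝒞
  supp : ∀ n, ∀ y ∈ 𝒞 n, ∀ a ∈ y.support, n < (a : ℕ)
  nonneg : ∀ n, ∀ y ∈ 𝒞 n, ∀ a, 0 ≤ y a
  exists_ne : ∀ n, ∃ y ∈ 𝒞 n, y ≠ 0

/-- The recursive choice shared by the constructions below: `good` depends on the position `ρ k` and
level `n k` known before `y k` is chosen, while `next` constrains the level `n (k + 1)` in terms of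
`y k`. -/
theorem exists_block_sequence (𝒞 : ℕ → Set (ℕ+ →₀ ℝ)) (good : ℕ → ℕ → (ℕ+ →₀ ℝ) → Prop)
    (next : ℕ → (ℕ+ →₀ ℝ) → ℕ → Prop) (h : ∀ ρ n, ∃ y ∈ 𝒞 ρ, good ρ n y)
    (h' : ∀ ρ n y, ∃ n', n ≤ n' ∧ next ρ y n') (ρ₀ n₀ : ℕ) :
    ∃ (y : ℕ → ℕ+ →₀ ℝ) (ρ n : ℕ → ℕ), ρ 0 = ρ₀ ∧ StrictMono ρ ∧ Monotone n ∧
      ∀ k, y k ∈ 𝒞 (ρ k) ∧ good (ρ k) (n k) (y k) ∧ next (ρ k) (y k) (n (k + 1)) ∧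
        ∀ a ∈ (y k).support, (a : ℕ) ≤ ρ (k + 1) := by
  have pick : ∀ q : ℕ × ℕ, ∃ (y : ℕ+ →₀ ℝ) (q' : ℕ × ℕ), y ∈ 𝒞 q.1 ∧ good q.1 q.2 y ∧
      next q.1 y q'.2 ∧ q.1 < q'.1 ∧ q.2 ≤ q'.2 ∧ ∀ a ∈ y.support, (a : ℕ) ≤ q'.1 := by
    rintro ⟨ρ, n⟩
    obtain ⟨y, hy, hg⟩ := h ρ n
    obtain ⟨n', hn', hx⟩ := h' ρ n y
    refine ⟨y, (max (ρ + 1) (y.support.sup fun a => (a : ℕ)), n'), hy, hg, hx, by simp, hn',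
      fun a ha => ?_⟩
    exact (Finset.le_sup (f := fun a : ℕ+ => (a : ℕ)) ha).trans (le_max_right _ _)
  choose yf nx h1 h2 h3 h4 h5 h6 using pick
  set Q : ℕ → ℕ × ℕ := fun t => nx^[t] (ρ₀, n₀) with hQ
  have hQ1 : ∀ t, Q (t + 1) = nx (Q t) := fun t => Function.iterate_succ_apply' nx t _
  refine ⟨fun k => yf (Q k), fun k => (Q k).1, fun k => (Q k).2, rfl,
    strictMono_nat_of_lt_succ fun t => ?_, monotone_nat_of_le_succ fun t => ?_, fun k => ?_⟩
  · simp only [hQ1]; exact h4 _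
  · simp only [hQ1]; exact h5 _
  · simp only [hQ1]; exact ⟨h1 _, h2 _, h3 _, h6 _⟩

theorem BlockCones.sum_mem {𝒞 : ℕ → Set (ℕ+ →₀ ℝ)} (h𝒞 : BlockCones 𝒞) {r : ℕ} {ι : Type*}
    {s : Finset ι} (hs : s.Nonempty) {y : ι → ℕ+ →₀ ℝ} (hy : ∀ i ∈ s, y i ∈ 𝒞 r) :
    ∑ i ∈ s, y i ∈ 𝒞 r := by
  classical
  induction hs using Finset.Nonempty.cons_induction with
  | singleton a => simpa using hy
  | cons a s ha _ ih =>
    rw [Finset.sum_cons]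
    exact h𝒞.add (hy a (Finset.mem_cons_self _ _)) (ih fun i hi => hy i (Finset.mem_cons_of_mem hi))

/-- Restricting a sum of disjointly supported vectors. -/
theorem restr_sum_support {ι : Type*} (s : Finset ι) (y : ι → ℕ+ →₀ ℝ)
    (hd : (s : Set ι).PairwiseDisjoint fun i => (y i).support) {i : ι} (hi : i ∈ s) :
    restr (y i).support (∑ j ∈ s, y j) = y i := by
  rw [restr_sum, Finset.sum_eq_single i]
  · exact restr_eq_self (Finset.Subset.refl _)
  · intro j hj hji
    exact restr_eq_zero (hd hi hj hji.symm)
  · exact fun h => absurd hi h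

theorem disjoint_support_of_blocks {y : ℕ → ℕ+ →₀ ℝ} {ρ : ℕ → ℕ} (hρ : StrictMono ρ)
    (h1 : ∀ k, ∀ a ∈ (y k).support, ρ k < (a : ℕ))
    (h2 : ∀ k, ∀ a ∈ (y k).support, (a : ℕ) ≤ ρ (k + 1)) (S : Set ℕ) :
    S.PairwiseDisjoint fun i => (y i).support := by
  intro i _ j _ hij
  show Disjoint (y i).support (y j).support
  rw [Finset.disjoint_left]
  intro a hi hj
  have e1 := hρ.lt_iff_lt.1 ((h1 i a hi).trans_le (h2 j a hj))
  have e2 := hρ.lt_iff_lt.1 ((h1 j a hj).trans_le (h2 i a hi))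
  omega

/-- Smallness of an estimate on normalized elements of block cones. -/
def SmallOn (N : UncNorm) (𝒞 : ℕ → Set (ℕ+ →₀ ℝ)) (B : (ℕ+ →₀ ℝ) → ℝ → Prop) : Prop :=
  ∀ r (ε : ℝ), 0 < ε → ∃ y ∈ 𝒞 r, N.toFun y = 1 ∧ B y ε

/-- If the sums of normalized blocks stay bounded for an estimate, then it is small somewhere. -/
theorem SmallOn.of_sum_bounded {N : UncNorm} {c : ℝ} (hc : 0 < c) (hN : N.LowerEllOne c)
    {𝒞 : ℕ → Set (ℕ+ →₀ ℝ)} (h𝒞 : BlockCones 𝒞) {B : (ℕ+ →₀ ℝ) → ℝ → Prop}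
    (hsmul : ∀ y t (a : ℝ), 0 < a → B y t → B (a • y) (a * t))
    (hmono : ∀ y t t', t ≤ t' → B y t → B y t') {D : ℝ} (hD : 0 ≤ D)
    (h : ∀ ρ₀, ∃ (y : ℕ → ℕ+ →₀ ℝ) (ρ : ℕ → ℕ), ρ 0 = ρ₀ ∧ StrictMono ρ ∧
      ∀ k, y k ∈ 𝒞 (ρ k) ∧ N.toFun (y k) = 1 ∧ (∀ a ∈ (y k).support, (a : ℕ) ≤ ρ (k + 1)) ∧
        B (∑ i ∈ Finset.range k, y i) D) : SmallOn N 𝒞 B := by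
  intro r ε hε
  -- Blocks beyond `K` fall under the lower estimate, so the sum of `K` of them has norm at least `c
  -- * K` while its estimate remains `D`. Normalizing gives at most `D / (c * K) < ε`.
  obtain ⟨K, hK⟩ := exists_nat_gt (D / (c * ε))
  have hK0 : (0 : ℝ) < K := (by positivity : 0 ≤ D / (c * ε)).trans_lt hK
  have hK1 : 0 < K := by exact_mod_cast hK0
  obtain ⟨y, ρ, hρ0, hρ, hy⟩ := h (max r K)
  have hsl : ∀ k, ∀ a ∈ (y k).support, ρ k < (a : ℕ) := fun k => h𝒞.supp _ _ (hy k).1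
  have hρk : ∀ k, max r K ≤ ρ k := fun k => hρ0 ▸ hρ.monotone (Nat.zero_le k)
  set Y := ∑ i ∈ Finset.range K, y i with hY
  have hd := disjoint_support_of_blocks hρ hsl (fun k => (hy k).2.2.1) (Finset.range K : Set ℕ)
  have hlow : c * K ≤ N.toFun Y := by
    have := hN (Finset.range K) (fun i => (y i).support) hd (fun i _ a ha => by
      rw [Finset.card_range]
      have := hsl i a ha
      have := hρk i
      omega) Y
    rw [Finset.sum_congr rfl fun i hi => by rw [restr_sum_support _ _ hd hi, (hy i).2.1]] at this
    simpa using this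
  have hpos : 0 < N.toFun Y := lt_of_lt_of_le (by positivity) hlow
  have hY𝒞 : Y ∈ 𝒞 r := h𝒞.sum_mem (Finset.nonempty_range_iff.2 hK1.ne')
    fun i _ => h𝒞.anti ((le_max_left _ _).trans (hρk i)) (hy i).1
  refine ⟨(N.toFun Y)⁻¹ • Y, h𝒞.smul (by positivity) hY𝒞, ?_, hmono _ _ _ ?_
    (hsmul Y D _ (by positivity) (hy K).2.2.2)⟩
  · rw [N.smul_eq, abs_of_pos (by positivity), inv_mul_cancel₀ hpos.ne']
  · rw [inv_mul_le_iff₀ hpos]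
    rw [div_lt_iff₀ (by positivity)] at hK
    calc D ≤ c * K * ε := by linarith
      _ ≤ N.toFun Y * ε := by gcongr

/-- Used with a `k₀` depending on the family under consideration: every block but one contributes a
geometrically small amount. The bound does not depend on `k₀`. -/
theorem sum_le_of_geometric {g : ℕ → ℝ} {C : ℝ} (hC : 0 ≤ C) {k₀ : ℕ}
    (h : ∀ k, g k ≤ (1 / 2) ^ k + if k = k₀ then C else 0) (K : ℕ) :
    ∑ k ∈ Finset.range K, g k ≤ 2 + C := by
  refine (Finset.sum_le_sum fun k _ => h k).trans ?_
  rw [Finset.sum_add_distrib, Finset.sum_ite_eq']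
  refine add_le_add ?_ (by split_ifs <;> simp [hC])
  have := (summable_geometric_two).sum_le_tsum (Finset.range K) (fun i _ => by positivity)
  rwa [tsum_geometric_two] at this

/-! ### Sums of iterates over families of bounded level -/

section Iterated

variable {θ : ℕ+ → ℝ} (hθ : ∀ n, θ n ∈ Ioo (0 : ℝ) 1) {A : FamilyRule} (hA : A.Disj)

/-- The `m`-th norm of `y`, and all sums `∑ᵢ ‖E_i y‖_m` for permitted families of levels up to `n`,
are at most `t`. -/
def FamBound (m n : ℕ) (y : ℕ+ →₀ ℝ) (t : ℝ) : Prop :=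
  (iterNorm hθ hA m).toFun y ≤ t ∧ ∀ ν : ℕ+, (ν : ℕ) ≤ n → ∀ k (E : Fin k → Finset ℕ+), A ν k E →
    ∑ i, (iterNorm hθ hA m).toFun (restr (E i) y) ≤ t

variable {hθ hA}

theorem FamBound.smul {m n : ℕ} {y : ℕ+ →₀ ℝ} {t a : ℝ} (ha : 0 < a)
    (h : FamBound hθ hA m n y t) : FamBound hθ hA m n (a • y) (a * t) := by
  refine ⟨?_, fun ν hν k E hE => ?_⟩
  · rw [UncNorm.smul_eq, abs_of_pos ha]
    exact mul_le_mul_of_nonneg_left h.1 ha.le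
  · simp_rw [restr_smul, UncNorm.smul_eq, abs_of_pos ha, ← Finset.mul_sum]
    exact mul_le_mul_of_nonneg_left (h.2 ν hν k E hE) ha.le

theorem FamBound.mono {m n : ℕ} {y : ℕ+ →₀ ℝ} {t t' : ℝ} (ht : t ≤ t')
    (h : FamBound hθ hA m n y t) : FamBound hθ hA m n y t' :=
  ⟨h.1.trans ht, fun ν hν k E hE => (h.2 ν hν k E hE).trans ht⟩

theorem FamBound.add {m n : ℕ} {y y' : ℕ+ →₀ ℝ} {t t' : ℝ} (h : FamBound hθ hA m n y t)
    (h' : FamBound hθ hA m n y' t') : FamBound hθ hA m n (y + y') (t + t') := by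
  refine ⟨(UncNorm.add_le _ _ _).trans (add_le_add h.1 h'.1), fun ν hν k E hE => ?_⟩
  refine le_trans ?_ (add_le_add (h.2 ν hν k E hE) (h'.2 ν hν k E hE))
  rw [← Finset.sum_add_distrib]
  refine Finset.sum_le_sum fun i _ => ?_
  rw [restr_add]
  exact UncNorm.add_le _ _ _

theorem FamBound.sum {m n : ℕ} {y : ℕ → ℕ+ →₀ ℝ} {t : ℕ → ℝ}
    (h : ∀ i, FamBound hθ hA m n (y i) (t i)) (K : ℕ) :
    FamBound hθ hA m n (∑ i ∈ Finset.range K, y i) (∑ i ∈ Finset.range K, t i) := by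
  induction K with
  | zero =>
    refine ⟨by simp [UncNorm.zero], fun ν hν k E hE => ?_⟩
    have : ∀ i, restr (E i) 0 = 0 := fun i => restr_eq_zero (by simp)
    simp [UncNorm.zero, this]
  | succ K ih =>
    rw [Finset.sum_range_succ, Finset.sum_range_succ]
    exact ih.add (h K)

/-- A permitted family of level `n + 1` splits into `q` permitted families of level `n`, where `q`
does not exceed the elements of its sets. -/
theorem FamBound.sum_succ_le (hG : A.Good) {m n : ℕ} {k : ℕ} {E : Fin k → Finset ℕ+}
    (hE : A n.succPNat k E) : ∃ q : ℕ, (∀ i, ∀ a ∈ E i, q ≤ (a : ℕ)) ∧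
      ∀ (y : ℕ+ →₀ ℝ) (t : ℝ), 0 ≤ t → FamBound hθ hA m n y t →
        ∑ i, (iterNorm hθ hA m).toFun (restr (E i) y) ≤ q * t := by
  classical
  obtain ⟨hdis, hne, q, G, hGS, hGq, -, hGu⟩ := hG.allowable hE
  have hmem : ∀ i, ∃ j, (E i).min' (hne i) ∈ G j := fun i => by
    have : (E i).min' (hne i) ∈ Finset.univ.image fun i => (E i).min' (hne i) :=
      Finset.mem_image_of_mem _ (Finset.mem_univ i)
    rw [hGu] at this
    simpa using this
  refine ⟨q, fun i a ha => ?_, fun y t ht h => ?_⟩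
  · obtain ⟨j, hj⟩ := hmem i
    have h1 : (q : ℕ) ≤ ((E i).min' (hne i) : ℕ+) := hGq j _ hj
    have h2 : (((E i).min' (hne i) : ℕ+) : ℕ) ≤ a := (E i).min'_le a ha
    exact h1.trans h2
  · choose f hf using hmem
    rw [← Finset.sum_fiberwise Finset.univ f]
    refine (Finset.sum_le_card_nsmul _ _ t fun j _ => ?_).trans (by simp)
    -- The fibre of `f` is enlarged to all indices with minimum in `G j`: their minima then form
    -- exactly `G j`, so hereditariness of the Schreier families is not needed.
    set s := Finset.univ.filter fun i => (E i).min' (hne i) ∈ G j with hs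
    have hsub : (Finset.univ.filter fun i => f i = j) ⊆ s := by
      intro i hi
      rw [hs, Finset.mem_filter]
      exact ⟨Finset.mem_univ _, (Finset.mem_filter.1 hi).2 ▸ hf i⟩
    refine (Finset.sum_le_sum_of_subset_of_nonneg hsub fun i _ _ => UncNorm.nonneg _ _).trans ?_
    have hinj := min'_injective_of_disjoint hdis hne
    -- Rule levels start at 1. For `n = 0` the piece `G j` has at most one element, so at most one
    -- set is involved and the norm bound in `FamBound` suffices.
    rcases n with _ | n
    · have hcard : s.card ≤ 1 := by
        rw [Finset.card_le_one]
        intro i hi i' hi'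
        refine hinj ?_
        have h1 := (Finset.mem_filter.1 hi).2
        have h2 := (Finset.mem_filter.1 hi').2
        rcases hGS j with h0 | ⟨a, h0⟩
        · rw [h0] at h1; simp at h1
        · rw [h0, Finset.mem_singleton] at h1 h2
          exact h1.trans h2.symm
      refine (Finset.sum_le_card_nsmul _ _ t fun i _ => (UncNorm.restr_le _ _ _).trans h.1).trans ?_
      rw [nsmul_eq_mul]
      have : (s.card : ℝ) ≤ 1 := by exact_mod_cast hcard
      nlinarith
    · have hA' : A n.succPNat s.card fun j => E (s.orderEmbOfFin rfl j) := by
        refine hG.subfamily hE s ⟨fun i => hne _, ?_⟩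
        have : (Finset.univ.image fun c => (E (s.orderEmbOfFin rfl c)).min' (hne _)) = G j := by
          ext a
          rw [Finset.mem_image]
          constructor
          · rintro ⟨c, -, rfl⟩
            exact (Finset.mem_filter.1 (s.orderEmbOfFin_mem rfl c)).2
          · intro ha
            have h1 : a ∈ Finset.univ.image fun i => (E i).min' (hne i) := by
              rw [hGu]
              exact Finset.mem_biUnion.2 ⟨j, Finset.mem_univ _, ha⟩
            obtain ⟨i, -, rfl⟩ := Finset.mem_image.1 h1
            have hi : i ∈ Set.range (s.orderEmbOfFin rfl) := by
              rw [Finset.range_orderEmbOfFin]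
              exact Finset.mem_filter.2 ⟨Finset.mem_univ _, ha⟩
            obtain ⟨c, rfl⟩ := hi
            exact ⟨c, Finset.mem_univ _, rfl⟩
        rw [this]
        exact hGS j
      refine le_trans (le_of_eq ?_) (h.2 n.succPNat (by simp) _ _ hA')
      conv_lhs => rw [← Finset.map_orderEmbOfFin_univ s rfl]
      rw [Finset.sum_map]
      rfl

end Iterated

theorem BlockCones.exists_norm_one {𝒞 : ℕ → Set (ℕ+ →₀ ℝ)} (h𝒞 : BlockCones 𝒞) (N : UncNorm)
    (r : ℕ) : ∃ y ∈ 𝒞 r, N.toFun y = 1 := by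
  obtain ⟨y, hy, hy0⟩ := h𝒞.exists_ne r
  have hpos : 0 < N.toFun y := (N.nonneg y).lt_of_ne' fun h => hy0 (N.eq_zero h)
  refine ⟨(N.toFun y)⁻¹ • y, h𝒞.smul (by positivity) hy, ?_⟩
  rw [N.smul_eq, abs_of_pos (by positivity), inv_mul_cancel₀ hpos.ne']

theorem one_div_mul_two_pow_le {ρ k : ℕ} (h : k ≤ ρ) :
    1 / (((ρ : ℝ) + 1) * 2 ^ ρ) ≤ (1 / 2 : ℝ) ^ k := by
  rw [div_pow, one_pow]
  apply one_div_le_one_div_of_le (by positivity)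
  calc (2 : ℝ) ^ k ≤ 2 ^ ρ := pow_le_pow_right₀ one_le_two h
    _ ≤ ((ρ : ℝ) + 1) * 2 ^ ρ := le_mul_of_one_le_left (by positivity) (by linarith [ρ.cast_nonneg (α := ℝ)])

/-! ### Block cones contain normalized vectors with small iterates -/

section Small

variable {θ : ℕ+ → ℝ} {hθ : ∀ n, θ n ∈ Ioo (0 : ℝ) 1} {A : FamilyRule} {hA : A.Disj}
  {N : UncNorm} {c : ℝ} {𝒞 : ℕ → Set (ℕ+ →₀ ℝ)}

/-- The sup norm of a sum of disjoint normalized blocks is at most 1, and at level 0 there are no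
families to consider. -/
theorem smallOn_zero (hc : 0 < c) (hN : N.LowerEllOne c) (h𝒞 : BlockCones 𝒞) :
    SmallOn N 𝒞 (FamBound hθ hA 0 0) := by
  refine SmallOn.of_sum_bounded hc hN h𝒞 (fun _ _ _ ha h => h.smul ha)
    (fun _ _ _ ht h => h.mono ht) zero_le_one fun ρ₀ => ?_
  obtain ⟨y, ρ, n, h0, hρ, -, hy⟩ := exists_block_sequence 𝒞 (fun _ _ y => N.toFun y = 1)
    (fun _ _ _ => True) (fun ρ _ => h𝒞.exists_norm_one N ρ) (fun _ n _ => ⟨n, le_rfl, trivial⟩) ρ₀ 0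
  refine ⟨y, ρ, h0, hρ, fun k => ⟨(hy k).1, (hy k).2.1, (hy k).2.2.2, ?_, fun ν hν => ?_⟩⟩
  · refine supNorm_le_of_forall fun a => ?_
    rw [Finsupp.finsetSum_apply]
    have hd := disjoint_support_of_blocks hρ (fun k => h𝒞.supp _ _ (hy k).1)
      (fun k => (hy k).2.2.2) Set.univ
    by_cases hex : ∃ i ∈ Finset.range k, y i a ≠ 0
    · obtain ⟨i, hi, hia⟩ := hex
      rw [Finset.sum_eq_single_of_mem i hi]
      · exact (N.coord_le _ _).trans (hy i).2.1.le
      · intro j _ hji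
        by_contra hja
        exact Finset.disjoint_left.1 (hd (mem_univ j) (mem_univ i) hji)
          (Finsupp.mem_support_iff.2 hja) (Finsupp.mem_support_iff.2 hia)
    · push Not at hex
      rw [Finset.sum_eq_zero hex]
      simp
  · exact absurd hν (by simp)

/-- Sum normalized blocks whose level-`n` bounds decrease very fast. Let a family of level `n + 1`
first meet the block `k₀`. That block costs at most `C / θ_{n+1}` because the next iterate is
dominated by `N`. On a later block starting at `ρ j` the family splits into `q ≤ ρ j` families of
level `n`, and the choice `1 / ((ρ + 1) * 2 ^ ρ)` absorbs the factor `q`. -/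
theorem smallOn_succ_level (hc : 0 < c) (hN : N.LowerEllOne c) (h𝒞 : BlockCones 𝒞)
    (hG : A.Good) {m n : ℕ} {C : ℝ} (hC0 : 0 ≤ C)
    (hC : ∀ y, (iterNorm hθ hA (m + 1)).toFun y ≤ C * N.toFun y)
    (h : SmallOn N 𝒞 (FamBound hθ hA m n)) : SmallOn N 𝒞 (FamBound hθ hA m (n + 1)) := by
  classical
  have hθ0 := (hθ n.succPNat).1
  refine SmallOn.of_sum_bounded hc hN h𝒞 (fun _ _ _ ha h => h.smul ha)
    (fun _ _ _ ht h => h.mono ht) (D := 2 + C / θ n.succPNat) (by positivity) fun ρ₀ => ?_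
  obtain ⟨y, ρ, _, h0, hρ, -, hy⟩ := exists_block_sequence 𝒞
    (fun ρ _ y => N.toFun y = 1 ∧ FamBound hθ hA m n y (1 / (((ρ : ℝ) + 1) * 2 ^ ρ)))
    (fun _ _ _ => True) (fun ρ _ => h ρ _ (by positivity)) (fun _ n _ => ⟨n, le_rfl, trivial⟩) ρ₀ 0
  have hρk : ∀ k, k ≤ ρ k := fun k => hρ.le_apply
  refine ⟨y, ρ, h0, hρ, fun K => ⟨(hy K).1, (hy K).2.1.1, (hy K).2.2.2, ?_⟩⟩
  have hlow : FamBound hθ hA m n (∑ i ∈ Finset.range K, y i) (2 + C / θ n.succPNat) :=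
    (FamBound.sum (fun i => (hy i).2.1.2) K).mono <|
      sum_le_of_geometric (by positivity) (k₀ := 0) (fun k => by
        have := one_div_mul_two_pow_le (hρk k)
        have : (0 : ℝ) ≤ if k = 0 then C / θ n.succPNat else 0 := by split_ifs <;> positivity
        linarith) K
  refine ⟨hlow.1, fun ν hν k E hE => ?_⟩
  rcases Nat.lt_or_ge n (ν : ℕ) with hlt | hle
  swap
  · exact hlow.2 ν hle k E hE
  obtain rfl : ν = n.succPNat := PNat.coe_injective (by simp; omega)
  obtain ⟨q, hq, hqb⟩ := FamBound.sum_succ_le (hθ := hθ) (hA := hA) hG hE (m := m)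
  have hmain : ∃ k₀, ∀ j, ∑ i, (iterNorm hθ hA m).toFun (restr (E i) (y j)) ≤
      (1 / 2) ^ j + if j = k₀ then C / θ n.succPNat else 0 := by
    by_cases hex : ∃ j, ∃ i, ∃ a ∈ E i, a ∈ (y j).support
    · refine ⟨Nat.find hex, fun j => ?_⟩
      rcases lt_trichotomy j (Nat.find hex) with hj | hj | hj
      · rw [if_neg hj.ne, add_zero, Finset.sum_eq_zero]
        · positivity
        · intro i _
          rw [restr_eq_zero, UncNorm.zero]
          rw [Finset.disjoint_left]
          exact fun a ha ha' => Nat.find_min hex hj ⟨i, a, ha, ha'⟩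
      · rw [if_pos hj]
        have h1 := le_iterNorm_succ hθ hA m hE (y j)
        have h2 := hC (y j)
        rw [(hy j).2.1.1, mul_one] at h2
        have : ∑ i, (iterNorm hθ hA m).toFun (restr (E i) (y j)) ≤ C / θ n.succPNat := by
          rw [le_div_iff₀ hθ0]
          linarith
        have : (0 : ℝ) ≤ (1 / 2) ^ j := by positivity
        linarith
      · rw [if_neg hj.ne', add_zero]
        obtain ⟨i, a, ha, ha'⟩ := Nat.find_spec hex
        have h1 : q ≤ ρ j := (hq i a ha).trans
          (((hy _).2.2.2 a ha').trans (hρ.monotone hj))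
        refine (hqb (y j) _ (by positivity) (hy j).2.1.2).trans ?_
        have h2 : (q : ℝ) ≤ (ρ j : ℝ) + 1 := by exact_mod_cast h1.trans (Nat.le_succ _)
        calc (q : ℝ) * (1 / (((ρ j : ℝ) + 1) * 2 ^ ρ j))
            ≤ ((ρ j : ℝ) + 1) * (1 / (((ρ j : ℝ) + 1) * 2 ^ ρ j)) := by gcongr
          _ = (1 / 2) ^ ρ j := by rw [div_pow, one_pow]; field_simp
          _ ≤ (1 / 2) ^ j := pow_le_pow_of_le_one (by norm_num) (by norm_num) (hρk j)
    · refine ⟨0, fun j => ?_⟩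
      rw [Finset.sum_eq_zero]
      · positivity
      · intro i _
        rw [restr_eq_zero, UncNorm.zero]
        rw [Finset.disjoint_left]
        exact fun a ha ha' => hex ⟨j, i, a, ha, ha'⟩
  obtain ⟨k₀, hk₀⟩ := hmain
  calc ∑ i, (iterNorm hθ hA m).toFun (restr (E i) (∑ j ∈ Finset.range K, y j))
      ≤ ∑ i, ∑ j ∈ Finset.range K, (iterNorm hθ hA m).toFun (restr (E i) (y j)) := by
        refine Finset.sum_le_sum fun i _ => ?_
        rw [restr_sum]
        exact UncNorm.sum_le _ _ _
    _ = ∑ j ∈ Finset.range K, ∑ i, (iterNorm hθ hA m).toFun (restr (E i) (y j)) :=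
        Finset.sum_comm
    _ ≤ _ := sum_le_of_geometric (by positivity) hk₀ K

/-- Blocks are chosen along increasing levels `n j`. A family of level `ν` is small on the `j`-th
block if `ν ≤ n j`, by the bound at the previous iterate, and if `ν ≥ n (j + 1)`, since `θ_ν` then
beats the `ℓ₁` norm of the block. At most one `j` escapes both cases, and there domination by `C *
N` is used. -/
theorem smallOn_succ_iter (hlim : Tendsto θ atTop (𝓝 0)) (hc : 0 < c) (hN : N.LowerEllOne c)
    (h𝒞 : BlockCones 𝒞) (hG : A.Good) {m : ℕ} {C : ℝ} (hC0 : 0 ≤ C)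
    (hC : ∀ y, (iterNorm hθ hA (m + 1)).toFun y ≤ C * N.toFun y)
    (h : ∀ n, SmallOn N 𝒞 (FamBound hθ hA m n)) : SmallOn N 𝒞 (FamBound hθ hA (m + 1) 0) := by
  classical
  refine SmallOn.of_sum_bounded hc hN h𝒞 (fun _ _ _ ha h => h.smul ha)
    (fun _ _ _ ht h => h.mono ht) (D := 2 + C) (by positivity) fun ρ₀ => ?_
  obtain ⟨y, ρ, n, h0, hρ, hn, hy⟩ := exists_block_sequence 𝒞
    (fun ρ n y => N.toFun y = 1 ∧ FamBound hθ hA m n y (1 / (((ρ : ℝ) + 1) * 2 ^ ρ)))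
    (fun ρ y n' => ∀ ν : ℕ+, n' ≤ (ν : ℕ) → θ ν * l1Norm y ≤ (1 / 2) ^ ρ)
    (fun ρ n => h n ρ _ (by positivity))
    (fun ρ n y => exists_level_mul_le hθ hlim (by positivity) (l1Norm_nonneg y) n) ρ₀ 0
  have hρk : ∀ k, k ≤ ρ k := fun k => hρ.le_apply
  refine ⟨y, ρ, h0, hρ, fun K => ⟨(hy K).1, (hy K).2.1.1, (hy K).2.2.2, ?_,
    fun ν hν => absurd hν (by simp)⟩⟩
  have hsup : supNorm (∑ i ∈ Finset.range K, y i) ≤ 2 + C := by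
    have h1 : ∀ x, supNorm x ≤ (iterNorm hθ hA m).toFun x := fun x =>
      supNorm_le_of_forall fun a => UncNorm.coord_le _ _ _
    refine (h1 _).trans ((UncNorm.sum_le _ _ _).trans
      ((Finset.sum_le_sum fun i _ => (hy i).2.1.2.1).trans ?_))
    exact sum_le_of_geometric (by positivity) (k₀ := 0) (fun k => by
        have := one_div_mul_two_pow_le (hρk k)
        have : (0 : ℝ) ≤ if k = 0 then C else 0 := by split_ifs <;> positivity
        linarith) K
  refine max_le hsup (Real.iSup_le ?_ (by positivity))
  rintro ⟨⟨ν, k, E⟩, hE⟩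
  simp only at hE ⊢
  have hmain : ∃ k₀, ∀ j, θ ν * ∑ i, (iterNorm hθ hA m).toFun (restr (E i) (y j)) ≤
      (1 / 2) ^ j + if j = k₀ then C else 0 := by
    have hCj : ∀ j, θ ν * ∑ i, (iterNorm hθ hA m).toFun (restr (E i) (y j)) ≤ C := fun j => by
      refine (le_iterNorm_succ hθ hA m hE (y j)).trans ((hC (y j)).trans ?_)
      rw [(hy j).2.1.1, mul_one]
    have hlo : ∀ j, (ν : ℕ) ≤ n j →
        θ ν * ∑ i, (iterNorm hθ hA m).toFun (restr (E i) (y j)) ≤ (1 / 2) ^ j := fun j hj => by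
      have h1 := (hy j).2.1.2.2 ν hj k E hE
      have h2 := one_div_mul_two_pow_le (hρk j)
      have h3 : 0 ≤ ∑ i, (iterNorm hθ hA m).toFun (restr (E i) (y j)) :=
        Finset.sum_nonneg fun i _ => UncNorm.nonneg _ _
      have h4 := (hθ ν).2
      nlinarith
    have hhi : ∀ j, n (j + 1) ≤ (ν : ℕ) →
        θ ν * ∑ i, (iterNorm hθ hA m).toFun (restr (E i) (y j)) ≤ (1 / 2) ^ j := fun j hj => by
      have h1 : ∑ i, (iterNorm hθ hA m).toFun (restr (E i) (y j)) ≤ l1Norm (y j) :=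
        (Finset.sum_le_sum fun i _ => UncNorm.le_l1 _ _).trans
          (sum_l1_restr_le _ _ (hG.allowable hE).1)
      have h2 := (hy j).2.2.1 ν hj
      have h3 : (1 / 2 : ℝ) ^ ρ j ≤ (1 / 2) ^ j :=
        pow_le_pow_of_le_one (by norm_num) (by norm_num) (hρk j)
      have h4 := mul_le_mul_of_nonneg_left h1 (hθ ν).1.le
      linarith
    by_cases hex : ∃ j, n j < (ν : ℕ) ∧ (ν : ℕ) < n (j + 1)
    · obtain ⟨k₀, hk₀⟩ := hex
      refine ⟨k₀, fun j => ?_⟩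
      rcases lt_trichotomy j k₀ with hj | hj | hj
      · rw [if_neg hj.ne, add_zero]
        exact hhi j ((hn (show j + 1 ≤ k₀ from hj)).trans hk₀.1.le)
      · rw [if_pos hj]
        have : (0 : ℝ) ≤ (1 / 2) ^ j := by positivity
        linarith [hCj j]
      · rw [if_neg hj.ne', add_zero]
        exact hlo j (hk₀.2.le.trans (hn (show k₀ + 1 ≤ j from hj)))
    · push Not at hex
      refine ⟨0, fun j => ?_⟩
      have : (0 : ℝ) ≤ if j = 0 then C else 0 := by split_ifs <;> positivity
      rcases Nat.lt_or_ge (n j) (ν : ℕ) with hj | hj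
      · linarith [hhi j (hex j hj)]
      · linarith [hlo j hj]
  obtain ⟨k₀, hk₀⟩ := hmain
  refine le_trans ?_ (sum_le_of_geometric hC0 hk₀ K)
  rw [← Finset.mul_sum, Finset.sum_comm]
  refine mul_le_mul_of_nonneg_left (Finset.sum_le_sum fun i _ => ?_) (hθ ν).1.le
  rw [restr_sum]
  exact UncNorm.sum_le _ _ _

/-- Block cones contain normalized vectors on which a given iterate is small. -/
theorem smallOn_iterNorm (hlim : Tendsto θ atTop (𝓝 0)) (hc : 0 < c) (hN : N.LowerEllOne c)
    (h𝒞 : BlockCones 𝒞) (hG : A.Good)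
    (hC : ∀ m, ∃ C : ℝ, 0 ≤ C ∧ ∀ y, (iterNorm hθ hA (m + 1)).toFun y ≤ C * N.toFun y) (m : ℕ) :
    SmallOn N 𝒞 fun y t => (iterNorm hθ hA m).toFun y ≤ t := by
  -- The induction on `m` contains one on `n`: all levels for `m` are needed before level 0 for `m +
  -- 1`.
  have key : ∀ m n, SmallOn N 𝒞 (FamBound hθ hA m n) := by
    intro m
    have lev : ∀ m, SmallOn N 𝒞 (FamBound hθ hA m 0) → ∀ n, SmallOn N 𝒞 (FamBound hθ hA m n) := by
      intro m h0 n
      obtain ⟨C, hC0, hC⟩ := hC m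
      induction n with
      | zero => exact h0
      | succ n ih => exact smallOn_succ_level hc hN h𝒞 hG hC0 hC ih
    induction m with
    | zero => exact lev 0 (smallOn_zero hc hN h𝒞)
    | succ m ih =>
      obtain ⟨C, hC0, hC⟩ := hC m
      exact lev _ (smallOn_succ_iter hlim hc hN h𝒞 hG hC0 hC ih)
  intro r ε hε
  obtain ⟨y, hy, hy1, hyb⟩ := key m 0 r ε hε
  exact ⟨y, hy, hy1, hyb.1⟩

end Small

/-! ### The norms `∑ α_n ‖·‖_n` -/

section SumNorm

variable {α : ℕ+ → ℝ} (hα : ∀ n, α n ∈ Ioo (0 : ℝ) 1) (hsum : HasSum α 1)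

theorem hasSum_sumNorm (N : ℕ+ → UncNorm) (x) :
    HasSum (fun n => α n * (N n).toFun x) ((sumNorm hα hsum N).toFun x) :=
  (Summable.of_nonneg_of_le (fun n => mul_nonneg (hα n).1.le ((N n).nonneg x))
      (fun n => mul_le_mul_of_nonneg_left ((N n).le_l1 x) (hα n).1.le)
      (hsum.summable.mul_right (l1Norm x))).hasSum

theorem sum_le_sumNorm (N : ℕ+ → UncNorm) (x) (s : Finset ℕ+) :
    ∑ n ∈ s, α n * (N n).toFun x ≤ (sumNorm hα hsum N).toFun x :=
  sum_le_hasSum s (fun n _ => mul_nonneg (hα n).1.le ((N n).nonneg x)) (hasSum_sumNorm hα hsum N x)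

theorem sumNorm_le {N : ℕ+ → UncNorm} {M : UncNorm} (h : ∀ n x, (N n).toFun x ≤ M.toFun x) (x) :
    (sumNorm hα hsum N).toFun x ≤ M.toFun x := by
  have h1 := hsum.mul_right (M.toFun x)
  rw [one_mul] at h1
  exact hasSum_le (fun n => mul_le_mul_of_nonneg_left (h n x) (hα n).1.le)
    (hasSum_sumNorm hα hsum N x) h1

variable {θ : ℕ+ → ℝ} (hθ : ∀ n, θ n ∈ Ioo (0 : ℝ) 1) {A : FamilyRule} (hA : A.Disj)

/-- An `S_1`-allowable family passes from the `n`-th iterate to the `(n + 1)`-st. The shift is paid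
for by `α (n + 1) ≥ l * α n`, and the first term of the shifted series is dropped. -/
theorem sumNorm_iterNorm_lowerEllOne (hG : A.Good) {l : ℝ}
    (hlα : ∀ n, l ≤ α (n + 1) / α n) :
    (sumNorm hα hsum fun n => iterNorm hθ hA n).LowerEllOne (l * θ 1) := by
  intro ι s E hd hs x
  have h1 : HasSum (fun n : ℕ+ => l * θ 1 * ∑ i ∈ s, α n * (iterNorm hθ hA n).toFun (restr (E i) x))
      (l * θ 1 * ∑ i ∈ s, (sumNorm hα hsum fun n => iterNorm hθ hA n).toFun (restr (E i) x)) :=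
    (hasSum_sum fun i _ => hasSum_sumNorm hα hsum (fun n => iterNorm hθ hA n) _).mul_left _
  refine hasSum_le_inj (fun n : ℕ+ => n + 1) (add_left_injective 1) (fun n _ => ?_) (fun n => ?_) h1
    (hasSum_sumNorm hα hsum (fun n => iterNorm hθ hA n) x)
  · exact mul_nonneg (hα n).1.le (UncNorm.nonneg _ x)
  · have h2 := iterNorm_lowerEllOne hθ hA hG (n : ℕ) s E hd hs x
    have h3 : l * α n ≤ α (n + 1) := (le_div_iff₀ (hα n).1).1 (hlα n)
    have h4 : 0 ≤ ∑ i ∈ s, (iterNorm hθ hA n).toFun (restr (E i) x) :=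
      Finset.sum_nonneg fun i _ => UncNorm.nonneg _ _
    rw [← Finset.mul_sum]
    calc l * θ 1 * (α n * ∑ i ∈ s, (iterNorm hθ hA n).toFun (restr (E i) x))
        = (l * α n) * (θ 1 * ∑ i ∈ s, (iterNorm hθ hA n).toFun (restr (E i) x)) := by ring
      _ ≤ α (n + 1) * (iterNorm hθ hA (n + 1)).toFun x := by
          have := (hα (n + 1)).1
          have := (hθ 1).1
          have := (hα n).1
          gcongr
      _ = _ := by simp

/-- In the spaces with norm `∑ α_n ‖·‖_n` block cones contain sequences equivalent to the unit
vector basis of `ℓ₁`. -/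
theorem exists_ellOne_blocks (hlim : Tendsto θ atTop (𝓝 0)) (hG : A.Good) {l : ℝ} (hl : 0 < l)
    (hlα : ∀ n, l ≤ α (n + 1) / α n) {𝒞 : ℕ → Set (ℕ+ →₀ ℝ)} (h𝒞 : BlockCones 𝒞) :
    ∃ (y : ℕ → ℕ+ →₀ ℝ) (ρ : ℕ → ℕ), StrictMono ρ ∧
      (∀ k, y k ∈ 𝒞 (ρ k) ∧ (sumNorm hα hsum fun n => iterNorm hθ hA n).toFun (y k) = 1 ∧
        ∀ a ∈ (y k).support, (a : ℕ) ≤ ρ (k + 1)) ∧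
      ∀ (F : Finset ℕ) (a : ℕ → ℝ), (∀ i, 0 ≤ a i) → (∑ i ∈ F, a i) / 2 ≤
        (sumNorm hα hsum fun n => iterNorm hθ hA n).toFun (∑ i ∈ F, a i • y i) := by
  classical
  set N := sumNorm hα hsum fun n => iterNorm hθ hA n with hN
  have hlow := sumNorm_iterNorm_lowerEllOne hα hsum hθ hA hG hlα
  have hsmall := smallOn_iterNorm (hθ := hθ) (hA := hA) hlim (mul_pos hl (hθ 1).1) hlow h𝒞 hG
    -- A single summand of the series gives `α_{m+1} ‖y‖_{m+1} ≤ N y`.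
    (fun m => ⟨(α m.succPNat)⁻¹, by have := (hα m.succPNat).1; positivity, fun y => by
      have := sum_le_sumNorm hα hsum (fun n => iterNorm hθ hA n) y {m.succPNat}
      rw [Finset.sum_singleton] at this
      rw [inv_mul_eq_div, le_div_iff₀ (hα m.succPNat).1, mul_comm]
      exact this⟩)
  -- Of the norm 1 of `y k`, the indices up to `n k` carry at most `1 / 4` and some finite set of
  -- indices up to `n (k + 1)` carries at least `3 / 4`. Hence at least `1 / 2` comes from indices
  -- in `(n k, n (k + 1)]`, and these ranges are disjoint.
  obtain ⟨y, ρ, n, -, hρ, hn, hy⟩ := exists_block_sequence 𝒞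
    (fun ρ n y => N.toFun y = 1 ∧ (iterNorm hθ hA n).toFun y ≤ 1 / 4)
    (fun ρ y n' => N.toFun y = 1 → ∃ s : Finset ℕ+, (∀ i ∈ s, (i : ℕ) ≤ n') ∧
      3 / 4 ≤ ∑ i ∈ s, α i * (iterNorm hθ hA i).toFun y)
    (fun ρ n => hsmall n ρ _ (by norm_num)) (fun ρ n y => by
      by_cases h1 : N.toFun y = 1
      · have h2 := hasSum_sumNorm hα hsum (fun n => iterNorm hθ hA n) y
        rw [← hN, h1] at h2
        obtain ⟨s, hs⟩ := (h2.eventually_const_le (by norm_num : (3 / 4 : ℝ) < 1)).exists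
        refine ⟨max n (s.sup fun i => (i : ℕ)), le_max_left _ _, fun _ => ⟨s, fun i hi => ?_, hs⟩⟩
        exact (Finset.le_sup (f := fun i : ℕ+ => (i : ℕ)) hi).trans (le_max_right _ _)
      · exact ⟨n, le_rfl, fun h => absurd h h1⟩) 0 0
  refine ⟨y, ρ, hρ, fun k => ⟨(hy k).1, (hy k).2.1.1, (hy k).2.2.2⟩, fun F a ha => ?_⟩
  have hs : ∀ k, ∃ s : Finset ℕ+, (∀ i ∈ s, n k < (i : ℕ) ∧ (i : ℕ) ≤ n (k + 1)) ∧
      1 / 2 ≤ ∑ i ∈ s, α i * (iterNorm hθ hA i).toFun (y k) := by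
    intro k
    obtain ⟨s, hs1, hs2⟩ := (hy k).2.2.1 (hy k).2.1.1
    refine ⟨s.filter fun i : ℕ+ => n k < (i : ℕ), fun i hi => ?_, ?_⟩
    · obtain ⟨h1, h2⟩ := Finset.mem_filter.1 hi
      exact ⟨h2, hs1 i h1⟩
    · rw [← Finset.sum_filter_add_sum_filter_not s fun i : ℕ+ => n k < (i : ℕ)] at hs2
      have h3 : ∑ i ∈ s.filter (fun i : ℕ+ => ¬ n k < (i : ℕ)), α i * (iterNorm hθ hA i).toFun (y k)
          ≤ 1 / 4 := by
        calc _ ≤ ∑ i ∈ s.filter (fun i : ℕ+ => ¬ n k < (i : ℕ)), α i * (1 / 4) := by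
              refine Finset.sum_le_sum fun i hi => mul_le_mul_of_nonneg_left ?_ (hα i).1.le
              have h4 : (i : ℕ) ≤ n k := not_lt.1 (Finset.mem_filter.1 hi).2
              exact (monotone_nat_of_le_succ (f := fun m => (iterNorm hθ hA m).toFun (y k))
                (fun m => iterNorm_le_succ hθ hA m _) h4).trans (hy k).2.1.2
          _ = (∑ i ∈ s.filter (fun i : ℕ+ => ¬ n k < (i : ℕ)), α i) * (1 / 4) := by
              rw [Finset.sum_mul]
          _ ≤ 1 * (1 / 4) := by
              gcongr
              exact sum_le_hasSum _ (fun i _ => (hα i).1.le) hsum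
          _ = 1 / 4 := by norm_num
      linarith
  choose s hs1 hs2 using hs
  have hdis : (F : Set ℕ).PairwiseDisjoint s := by
    intro i _ j _ hij
    show Disjoint (s i) (s j)
    rw [Finset.disjoint_left]
    intro x hi hj
    have h1 := hs1 i x hi
    have h2 := hs1 j x hj
    rcases lt_or_gt_of_ne hij with h | h
    · have := hn (show i + 1 ≤ j from h)
      omega
    · have := hn (show j + 1 ≤ i from h)
      omega
  refine le_trans ?_ (sum_le_sumNorm hα hsum _ _ (F.biUnion s))
  rw [Finset.sum_biUnion hdis, Finset.sum_div]
  refine Finset.sum_le_sum fun k hk => ?_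
  calc a k / 2 ≤ a k * ∑ i ∈ s k, α i * (iterNorm hθ hA i).toFun (y k) := by
        rw [div_eq_mul_one_div]
        exact mul_le_mul_of_nonneg_left (hs2 k) (ha k)
    _ = ∑ i ∈ s k, α i * (iterNorm hθ hA i).toFun (a k • y k) := by
        rw [Finset.mul_sum]
        refine Finset.sum_congr rfl fun i _ => ?_
        rw [UncNorm.smul_eq, abs_of_nonneg (ha k)]
        ring
    _ ≤ _ := by
        refine Finset.sum_le_sum fun i _ => mul_le_mul_of_nonneg_left ?_ (hα i).1.le
        refine UncNorm.mono _ _ _ fun b => ?_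
        have h0 : ∀ j, 0 ≤ (a j • y j) b := fun j =>
          mul_nonneg (ha j) (h𝒞.nonneg _ _ (hy j).1 b)
        rw [abs_of_nonneg (h0 k), Finsupp.finsetSum_apply,
          abs_of_nonneg (Finset.sum_nonneg fun j _ => h0 j)]
        exact Finset.single_le_sum (f := fun j => (a j • y j) b) (fun j _ => h0 j) hk

end SumNorm

/-! ### Spaces with a 1-unconditional basis -/

section Basis

variable {X : Type*} [NormedAddCommGroup X] [NormedSpace ℝ X]

/-- The vector with finitely many given coordinates. -/
noncomputable def ofSeq (b : UnconditionalSchauderBasis ℕ+ ℝ X) : (ℕ+ →₀ ℝ) →ₗ[ℝ] X :=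
  Finsupp.linearCombination ℝ b.basis

theorem coord_ofSeq (b : UnconditionalSchauderBasis ℕ+ ℝ X) (x : ℕ+ →₀ ℝ) (j : ℕ+) :
    b.coord j (ofSeq b x) = x j := by
  classical
  rw [ofSeq, Finsupp.linearCombination_apply, Finsupp.sum, basis_coord_sum]
  split_ifs with h
  · rfl
  · exact (Finsupp.notMem_support_iff.1 h).symm

variable {b : UnconditionalSchauderBasis ℕ+ ℝ X}

theorem OneUnconditional.norm_eq (hb : OneUnconditional b) {x y : X}
    (h : ∀ i, |b.coord i x| = |b.coord i y|) : ‖x‖ = ‖y‖ :=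
  le_antisymm (hb _ _ fun i => (h i).le) (hb _ _ fun i => (h i).ge)

section Band

variable [CompleteSpace X]

theorem OneUnconditional.exists_band (hb : OneUnconditional b) (A : Set ℕ+) (z : X) :
    ∃ w : X, ∀ i, b.coord i w = A.indicator (fun i => b.coord i z) i :=
  hb.exists_of_le z _ fun i => by
    by_cases h : i ∈ A
    · rw [indicator_of_mem h]
    · rw [indicator_of_notMem h]; simp

variable (hb : OneUnconditional b)

/-- The projection onto the vectors supported in a set of coordinates. -/
noncomputable def band (A : Set ℕ+) : X →L[ℝ] X :=
  LinearMap.mkContinuous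
    { toFun := fun z => (hb.exists_band A z).choose
      map_add' := fun x y => basis_coord_ext b fun i => by
        rw [map_add, (hb.exists_band A _).choose_spec, (hb.exists_band A _).choose_spec,
          (hb.exists_band A _).choose_spec]
        by_cases h : i ∈ A <;> simp [h]
      map_smul' := fun c x => basis_coord_ext b fun i => by
        rw [map_smul, (hb.exists_band A _).choose_spec, RingHom.id_apply,
          (hb.exists_band A _).choose_spec]
        by_cases h : i ∈ A <;> simp [h] } 1 fun z => by
    rw [one_mul]
    refine hb _ _ fun i => ?_
    simp only [LinearMap.coe_mk, AddHom.coe_mk]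
    rw [(hb.exists_band A _).choose_spec]
    by_cases h : i ∈ A <;> simp [h]

open Classical in
theorem coord_band (A : Set ℕ+) (z : X) (i : ℕ+) :
    b.coord i (band hb A z) = if i ∈ A then b.coord i z else 0 :=
  ((hb.exists_band A z).choose_spec i).trans (by rw [indicator_apply])

theorem norm_band_le (A : Set ℕ+) (z : X) : ‖band hb A z‖ ≤ ‖z‖ := by
  classical
  refine hb _ _ fun i => ?_
  rw [coord_band]
  split_ifs <;> simp

theorem band_coe_finset (F : Finset ℕ+) (z : X) :
    band hb (F : Set ℕ+) z = ∑ i ∈ F, b.coord i z • b.basis i := by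
  classical
  refine basis_coord_ext b fun j => ?_
  rw [coord_band, basis_coord_sum b F fun i => b.coord i z]
  simp

theorem exists_band_finset_eq_ofSeq (F : Finset ℕ+) (z : X) :
    ∃ x : ℕ+ →₀ ℝ, x.support ⊆ F ∧ (∀ i ∈ F, x i = b.coord i z) ∧
      band hb (F : Set ℕ+) z = ofSeq b x := by
  classical
  refine ⟨Finsupp.indicator F fun i _ => b.coord i z, Finsupp.support_indicator_subset _ _,
    fun i hi => Finsupp.indicator_of_mem hi _, basis_coord_ext b fun j => ?_⟩
  rw [coord_band, coord_ofSeq, Finsupp.indicator_apply]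
  simp

/-- The coordinates up to `n`. -/
def firstCoords (n : ℕ) : Finset ℕ+ := (Finset.range n).image Nat.succPNat

theorem mem_firstCoords {n : ℕ} {i : ℕ+} : i ∈ firstCoords n ↔ (i : ℕ) ≤ n := by
  rw [firstCoords, Finset.mem_image]
  constructor
  · rintro ⟨k, hk, rfl⟩
    simpa using hk
  · intro h
    refine ⟨i.natPred, ?_, PNat.succPNat_natPred i⟩
    rw [Finset.mem_range]
    have := PNat.natPred_add_one i
    omega

theorem tendsto_firstCoords : Tendsto firstCoords atTop atTop :=
  tendsto_atTop_finset_of_monotone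
    (fun _ _ h _ hi => mem_firstCoords.2 ((mem_firstCoords.1 hi).trans h))
    fun i => ⟨i, mem_firstCoords.2 le_rfl⟩

/-- The projection onto the first `n` coordinates. -/
noncomputable def trunc (n : ℕ) : X →L[ℝ] X := band hb (firstCoords n : Set ℕ+)

theorem tendsto_trunc (z : X) : Tendsto (fun n => trunc hb n z) atTop (𝓝 z) := by
  have h : HasSum (fun i => b.coord i z • b.basis i) z := b.expansion z
  refine (h.comp tendsto_firstCoords).congr fun n => ?_
  exact (band_coe_finset hb _ _).symm

open Classical in
theorem coord_trunc (n : ℕ) (z : X) (i : ℕ+) :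
    b.coord i (trunc hb n z) = if (i : ℕ) ≤ n then b.coord i z else 0 := by
  rw [trunc, coord_band]
  simp [mem_firstCoords]

end Band

end Basis

/-! ### The unit vector basis of the 2-convexification -/

section ConvBasis

variable {X : Type*} [NormedAddCommGroup X] [NormedSpace ℝ X] [CompleteSpace X]
  {b : UnconditionalSchauderBasis ℕ+ ℝ X} (hb : OneUnconditional b)

namespace Conv2

theorem norm_le_of_seq_abs_le {hb : OneUnconditional b} {x y : Conv2 b hb}
    (h : ∀ i, |y.seq i| ≤ |x.seq i|) : ‖y‖ ≤ ‖x‖ := by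
  refine le_of_sq_le_sq ?_ (norm_nonneg x)
  rw [norm_sq_eq, norm_sq_eq]
  refine hb _ _ fun i => ?_
  rw [coord_sq, coord_sq, abs_of_nonneg (sq_nonneg _), abs_of_nonneg (sq_nonneg _)]
  exact sq_le_sq.2 (h i)

/-- The unit vectors of `X^(2)`. -/
noncomputable def unit (i : ℕ+) : Conv2 b hb :=
  (⟨Pi.single i 1, b.basis i, fun j => by
    rw [b.ortho]
    by_cases h : j = i
    · subst h; simp
    · simp [h]⟩ : conv2Submodule b hb)

theorem seq_unit (i : ℕ+) : (unit hb i).seq = Pi.single i 1 := rfl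

/-- The coordinate functionals of `X^(2)`. -/
noncomputable def coord (i : ℕ+) : Conv2 b hb →L[ℝ] ℝ :=
  LinearMap.mkContinuous
    { toFun := fun x => x.seq i
      map_add' := fun x y => seq_add x y i
      map_smul' := fun c x => seq_smul c x i } (‖b.coord i‖ ^ (1 / 2 : ℝ)) fun x => seq_abs_le x i

theorem coord_apply (i : ℕ+) (x : Conv2 b hb) : coord hb i x = x.seq i := rfl

theorem seq_sum_smul_unit (F : Finset ℕ+) (a : ℕ+ → ℝ) (j : ℕ+) [Decidable (j ∈ F)] :
    (∑ i ∈ F, a i • unit hb i).seq j = if j ∈ F then a j else 0 := by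
  classical
  rw [← coord_apply hb, map_sum]
  simp only [map_smul, coord_apply, seq_unit, Pi.single_apply, smul_eq_mul]
  simp

/-- The squared norm of a remainder of `x` is the norm of the corresponding remainder of `x.sq`,
whence the radius `ε ^ 2`. -/
theorem hasSum_coord (x : Conv2 b hb) : HasSum (fun i => coord hb i x • unit hb i) x := by
  classical
  have h : HasSum (fun i => b.coord i x.sq • b.basis i) x.sq := b.expansion x.sq
  rw [HasSum, SummationFilter.unconditional_filter, Metric.tendsto_atTop] at h ⊢
  intro ε hε
  obtain ⟨s, hs⟩ := h (ε ^ 2) (by positivity)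
  refine ⟨s, fun F hF => ?_⟩
  have h1 := hs F hF
  rw [dist_eq_norm] at h1 ⊢
  refine lt_of_pow_lt_pow_left₀ 2 hε.le (lt_of_eq_of_lt ?_ h1)
  rw [norm_sq_eq]
  refine hb.norm_eq fun i => ?_
  rw [coord_sq, seq_sub, seq_sum_smul_unit hb F (fun i => coord hb i x), map_sub,
    basis_coord_sum b F fun i => b.coord i x.sq, coord_sq, coord_apply]
  split_ifs <;> simp

/-- The unit vector basis of `X^(2)`. -/
noncomputable def basis : UnconditionalSchauderBasis ℕ+ ℝ (Conv2 b hb) where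
  basis i := unit hb i
  coord i := coord hb i
  ortho i j := by
    rw [coord_apply, seq_unit]
    classical
    simp [Pi.single_apply]
  expansion x := hasSum_coord hb x

theorem basis_oneUnconditional : OneUnconditional (basis hb) := fun _ _ h =>
  norm_le_of_seq_abs_le h

theorem seq_ofSeq (x : ℕ+ →₀ ℝ) (i : ℕ+) : (ofSeq (basis hb) x).seq i = x i :=
  coord_ofSeq (basis hb) x i

/-- The coordinatewise square. -/
noncomputable def _root_.Finsupp.sqr (x : ℕ+ →₀ ℝ) : ℕ+ →₀ ℝ :=
  x.mapRange (fun t => t ^ 2) (by simp)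

theorem norm_ofSeq_sq (x : ℕ+ →₀ ℝ) : ‖ofSeq (basis hb) x‖ ^ 2 = ‖ofSeq b x.sqr‖ := by
  rw [norm_sq_eq]
  refine hb.norm_eq fun i => ?_
  rw [coord_sq, seq_ofSeq, coord_ofSeq]
  rfl

end Conv2

theorem C00Completion.norm_ofSeq (N : UncNorm) (x : ℕ+ →₀ ℝ) :
    ‖ofSeq (C00Completion.basis N) x‖ = N.toFun x := by
  have h := sum_coe N x.support (C00.mk N x)
  have h1 : ofSeq (C00Completion.basis N) x = ((C00.mk N x : C00 N) : C00Completion N) := by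
    have h2 : restr x.support (C00.mk N x) = x := restr_eq_self (Finset.Subset.refl _)
    rw [h2] at h
    rw [← h, ofSeq, Finsupp.linearCombination_apply, Finsupp.sum]
    refine Finset.sum_congr rfl fun i _ => ?_
    rw [coord_coe]
    rfl
  rw [h1, UniformSpace.Completion.norm_coe]
  rfl

end ConvBasis

open scoped ENNReal

/-! ### Sequences equivalent to the unit vector basis of `ℓ_p` -/

section LpSequences

/-- The `ℓ_p` norm of a finite family of coefficients. -/
noncomputable def lpSum (p : ℝ≥0∞) (F : Finset ℕ) (a : ℕ → ℝ) : ℝ :=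
  ‖∑ i ∈ F, lp.single (E := fun _ : ℕ => ℝ) p i (a i)‖

theorem lpSum_nonneg (p : ℝ≥0∞) (hp : p ≠ 0) (F : Finset ℕ) (a : ℕ → ℝ) : 0 ≤ lpSum p F a := by
  rcases eq_or_ne p ∞ with rfl | hp'
  · exact lp.norm_nonneg' _
  · exact lp.norm_nonneg' _

theorem lpSum_one (F : Finset ℕ) (a : ℕ → ℝ) : lpSum 1 F a = ∑ i ∈ F, |a i| := by
  have := lp.norm_sum_single (E := fun _ : ℕ => ℝ) (p := 1) (by simp) a F
  simpa [lpSum] using this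

theorem lpSum_two_sq (F : Finset ℕ) (a : ℕ → ℝ) : lpSum 2 F a ^ 2 = ∑ i ∈ F, a i ^ 2 := by
  have := lp.norm_sum_single (E := fun _ : ℕ => ℝ) (p := 2) (by simp) a F
  simpa [lpSum] using this

variable {p : ℝ≥0∞} [Fact (1 ≤ p)]

theorem lpSum_rpow (hp : p ≠ ∞) (F : Finset ℕ) (a : ℕ → ℝ) :
    lpSum p F a ^ p.toReal = ∑ i ∈ F, |a i| ^ p.toReal :=
  lp.norm_sum_single (E := fun _ : ℕ => ℝ)
    (ENNReal.toReal_pos (zero_lt_one.trans_le Fact.out).ne' hp) a F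

theorem abs_le_lpSum {F : Finset ℕ} {i : ℕ} (hi : i ∈ F) (a : ℕ → ℝ) : |a i| ≤ lpSum p F a := by
  have h := lp.norm_apply_le_norm (E := fun _ : ℕ => ℝ) (zero_lt_one.trans_le
    (Fact.out : 1 ≤ p)).ne' (∑ i ∈ F, lp.single (E := fun _ : ℕ => ℝ) p i (a i)) i
  have e : (∑ i ∈ F, lp.single (E := fun _ : ℕ => ℝ) p i (a i) : lp (fun _ : ℕ => ℝ) p) i = a i := by
    simp only [lp.coeFn_sum, Finset.sum_apply, lp.coeFn_single, Finset.sum_pi_single, if_pos hi]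
  rwa [e] at h

/-- `(v_i)` satisfies upper and lower `ℓ_p` estimates. -/
def IsLpSeq (p : ℝ≥0∞) {X : Type*} [NormedAddCommGroup X] [NormedSpace ℝ X] (v : ℕ → X)
    (δ C : ℝ) : Prop :=
  ∀ (F : Finset ℕ) (a : ℕ → ℝ),
    δ * lpSum p F a ≤ ‖∑ i ∈ F, a i • v i‖ ∧ ‖∑ i ∈ F, a i • v i‖ ≤ C * lpSum p F a

variable {X : Type*} [NormedAddCommGroup X] [NormedSpace ℝ X]

theorem IsLpSeq.comp_strictMono (hp : p ≠ ∞) {v : ℕ → X} {δ C : ℝ} (h : IsLpSeq p v δ C)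
    {φ : ℕ → ℕ} (hφ : StrictMono φ) : IsLpSeq p (fun i => v (φ i)) δ C := by
  intro F a
  have hp0 : 0 < p.toReal := ENNReal.toReal_pos (zero_lt_one.trans_le Fact.out).ne' hp
  have := h (F.map ⟨φ, hφ.injective⟩) (Function.extend φ a 0)
  have e : lpSum p (F.map ⟨φ, hφ.injective⟩) (Function.extend φ a 0) = lpSum p F a := by
    refine Real.rpow_left_injOn hp0.ne' (lpSum_nonneg p (zero_lt_one.trans_le Fact.out).ne' _ _)
      (lpSum_nonneg p (zero_lt_one.trans_le Fact.out).ne' _ _) ?_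
    simp only
    rw [lpSum_rpow hp, lpSum_rpow hp, Finset.sum_map]
    simp [hφ.injective.extend_apply]
  rw [e, Finset.sum_map] at this
  simpa [hφ.injective.extend_apply] using this

/-- Each coefficient is at most the `ℓ_p` norm, so the errors add up to at most `2 * (δ / 4)` times
that norm. -/
theorem IsLpSeq.perturb {v v' : ℕ → X} {δ C : ℝ} (hδ : 0 ≤ δ) (h : IsLpSeq p v δ C)
    (hv : ∀ i, ‖v i - v' i‖ ≤ δ / 4 * (1 / 2) ^ i) : IsLpSeq p v' (δ / 2) (C + δ / 2) := by
  intro F a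
  have hp0 : p ≠ 0 := (zero_lt_one.trans_le Fact.out).ne'
  have hL := lpSum_nonneg p hp0 F a
  have hd : ‖∑ i ∈ F, a i • v i - ∑ i ∈ F, a i • v' i‖ ≤ δ / 2 * lpSum p F a := by
    rw [← Finset.sum_sub_distrib]
    calc _ ≤ ∑ i ∈ F, δ / 4 * lpSum p F a * (1 / 2) ^ i := by
          refine norm_sum_le_of_le _ fun i hi => ?_
          rw [← smul_sub, norm_smul, Real.norm_eq_abs]
          calc |a i| * ‖v i - v' i‖ ≤ lpSum p F a * (δ / 4 * (1 / 2) ^ i) :=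
                mul_le_mul (abs_le_lpSum hi a) (hv i) (norm_nonneg _) hL
            _ = _ := by ring
      _ = δ / 4 * lpSum p F a * ∑ i ∈ F, (1 / 2 : ℝ) ^ i := by rw [Finset.mul_sum]
      _ ≤ δ / 4 * lpSum p F a * 2 := by
          have := (summable_geometric_two).sum_le_tsum F (fun i _ => by positivity)
          rw [tsum_geometric_two] at this
          gcongr
      _ = _ := by ring
  obtain ⟨h1, h2⟩ := h F a
  have h3 := norm_sub_norm_le (∑ i ∈ F, a i • v i) (∑ i ∈ F, a i • v' i)
  have h4 := norm_sub_norm_le (∑ i ∈ F, a i • v' i) (∑ i ∈ F, a i • v i)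
  rw [norm_sub_rev] at h4
  constructor <;> linarith

theorem hasSum_single_smul (hp : p ≠ ∞) (x : lp (fun _ : ℕ => ℝ) p) :
    HasSum (fun i => lp.single (E := fun _ : ℕ => ℝ) p i (x i)) x := lp.hasSum_single hp x

/-- A sequence with upper and lower `ℓ_p` estimates is the image of the unit vectors under an
isomorphic embedding of `ℓ_p`. -/
theorem IsLpSeq.exists_embedding [CompleteSpace X] (hp : p ≠ ∞) {v : ℕ → X} {δ C : ℝ}
    (h : IsLpSeq p v δ C) : ∃ T : lp (fun _ : ℕ => ℝ) p →L[ℝ] X,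
      (∀ x, HasSum (fun i => x i • v i) (T x)) ∧ ∀ x, δ * ‖x‖ ≤ ‖T x‖ := by
  have hs : ∀ x : lp (fun _ : ℕ => ℝ) p, Summable fun i => x i • v i := by
    intro x
    rw [summable_iff_vanishing_norm]
    intro ε hε
    obtain ⟨s, hs⟩ := summable_iff_vanishing_norm.1 (hasSum_single_smul hp x).summable
      (ε / (|C| + 1)) (by positivity)
    refine ⟨s, fun t ht => ?_⟩
    have h1 := hs t ht
    rw [lt_div_iff₀ (by positivity)] at h1
    refine (h t x).2.trans_lt (lt_of_le_of_lt ?_ h1)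
    have h0 : 0 ≤ lpSum p t x := lpSum_nonneg p (zero_lt_one.trans_le Fact.out).ne' _ _
    show C * lpSum p t x ≤ lpSum p t x * (|C| + 1)
    nlinarith [le_abs_self C]
  have hlim : ∀ x : lp (fun _ : ℕ => ℝ) p, Tendsto (fun F : Finset ℕ => lpSum p F x) atTop (𝓝 ‖x‖) :=
    fun x => (hasSum_single_smul hp x).norm
  refine ⟨LinearMap.mkContinuous
    { toFun := fun x => ∑' i, x i • v i
      map_add' := fun x y => by
        rw [← (hs x).tsum_add (hs y)]
        refine tsum_congr fun i => ?_
        rw [← add_smul]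
        rfl
      map_smul' := fun c x => by
        rw [RingHom.id_apply, ← (hs x).tsum_const_smul]
        refine tsum_congr fun i => ?_
        rw [smul_smul]
        rfl } C fun x => ?_, fun x => (hs x).hasSum, fun x => ?_⟩
  · exact le_of_tendsto_of_tendsto' (hs x).hasSum.norm ((hlim x).const_mul C) fun F => (h F x).2
  · exact le_of_tendsto_of_tendsto' ((hlim x).const_mul δ) (hs x).hasSum.norm fun F => (h F x).1

theorem IsLpSeq.exists_submodule [CompleteSpace X] (hp : p ≠ ∞) {v : ℕ → X} {δ C : ℝ}
    (h : IsLpSeq p v δ C) (hδ : 0 < δ) {Z : Submodule ℝ X} (hZ : IsClosed (Z : Set X))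
    (hv : ∀ i, v i ∈ Z) : ∃ Z' : Submodule ℝ X, Z' ≤ Z ∧ Nonempty (Z' ≃L[ℝ] lp (fun _ : ℕ => ℝ) p) := by
  obtain ⟨T, hT, hTl⟩ := h.exists_embedding hp
  have hanti : AntilipschitzWith δ⁻¹.toNNReal T :=
    T.antilipschitz_of_bound fun x => by
      have := hTl x
      rw [Real.coe_toNNReal _ (by positivity), inv_mul_eq_div, le_div_iff₀ hδ]
      linarith
  refine ⟨T.range, ?_, ⟨(T.equivRange hanti.injective
    (hanti.isClosed_range T.uniformContinuous)).symm⟩⟩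
  rintro _ ⟨x, rfl⟩
  exact hZ.mem_of_tendsto (hT x) (Eventually.of_forall fun F =>
    Z.sum_mem fun i _ => Z.smul_mem _ (hv i))

theorem ContainsIsomorph.exists_embedding {Y : Type*} [NormedAddCommGroup Y] [NormedSpace ℝ Y]
    (h : ContainsIsomorph X Y) : ∃ (T : Y →L[ℝ] X) (δ : ℝ), 0 < δ ∧ ∀ x, δ * ‖x‖ ≤ ‖T x‖ := by
  obtain ⟨Z, ⟨e⟩⟩ := h
  refine ⟨Z.subtypeL.comp (e.symm : Y →L[ℝ] Z), (‖(e : Z →L[ℝ] Y)‖ + 1)⁻¹, by positivity,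
    fun x => ?_⟩
  rw [inv_mul_le_iff₀ (by positivity)]
  have h1 := (e : Z →L[ℝ] Y).le_opNorm (e.symm x)
  simp only [ContinuousLinearEquiv.coe_coe, ContinuousLinearEquiv.apply_symm_apply] at h1
  have h2 : ‖(Z.subtypeL.comp (e.symm : Y →L[ℝ] Z)) x‖ = ‖e.symm x‖ := rfl
  rw [h2]
  nlinarith [norm_nonneg (e.symm x)]

end LpSequences

/-! ### Gliding hump -/

section GlidingHump

variable {X : Type*} [NormedAddCommGroup X] [NormedSpace ℝ X] [CompleteSpace X]
  {b : UnconditionalSchauderBasis ℕ+ ℝ X}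

/-- Gliding hump: a vector nearly vanishing on the first `ρ` coordinates is cut off beyond a large
`ρ'`, from which the next vector is taken. The index in `P` lets the vectors come from a
subsequence. -/
theorem exists_blocks_near (hb : OneUnconditional b) {P : ℕ → X → Prop} {c : ℝ} (hc : 0 < c)
    (h : ∀ (n ρ : ℕ) (η : ℝ), 0 < η → ∃ n' x, n < n' ∧ P n' x ∧ ‖trunc hb ρ x‖ ≤ η) :
    ∃ (φ ρ : ℕ → ℕ) (x : ℕ → X) (w : ℕ → ℕ+ →₀ ℝ), StrictMono φ ∧ StrictMono ρ ∧
      ∀ k, P (φ k) (x k) ∧ ‖x k - ofSeq b (w k)‖ ≤ c * (1 / 2) ^ k ∧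
        ∀ a ∈ (w k).support, ρ k < (a : ℕ) ∧ (a : ℕ) ≤ ρ (k + 1) := by
  classical
  have pick : ∀ q : ℕ × ℕ, ∃ (q' : ℕ × ℕ) (x : X) (w : ℕ+ →₀ ℝ), q.1 < q'.1 ∧ q.2 < q'.2 ∧
      P q'.1 x ∧ ‖x - ofSeq b w‖ ≤ c * (1 / 2) ^ q.2 ∧
      ∀ a ∈ w.support, q.2 < (a : ℕ) ∧ (a : ℕ) ≤ q'.2 := by
    rintro ⟨n, ρ⟩
    obtain ⟨n', x, hn, hP, hx⟩ := h n ρ (c * (1 / 2) ^ ρ / 2) (by positivity)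
    have h1 := (tendsto_trunc hb x).eventually (Metric.ball_mem_nhds x
      (by positivity : 0 < c * (1 / 2) ^ ρ / 2))
    obtain ⟨ρ', hρ', hlt⟩ := (h1.and (eventually_gt_atTop ρ)).exists
    obtain ⟨u, hu, -, hue⟩ := exists_band_finset_eq_ofSeq hb (firstCoords ρ') (x - trunc hb ρ x)
    have hz : ∀ a ∈ u.support, ρ < (a : ℕ) := by
      intro a ha
      by_contra! hle
      refine Finsupp.mem_support_iff.1 ha ?_
      rw [← coord_ofSeq b u a, ← hue, coord_band, map_sub, coord_trunc, if_pos hle, sub_self]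
      simp
    refine ⟨(n', ρ'), x, u, hn, hlt, hP, ?_, fun a ha => ⟨hz a ha, mem_firstCoords.1 (hu ha)⟩⟩
    rw [← hue]
    -- The two errors, from the tail beyond `ρ'` and the head up to `ρ`, each take half of the
    -- allowance.
    have e : x - band hb (firstCoords ρ' : Set ℕ+) (x - trunc hb ρ x)
        = (x - trunc hb ρ' x) + band hb (firstCoords ρ' : Set ℕ+) (trunc hb ρ x) := by
      have e' : band hb (firstCoords ρ' : Set ℕ+) x = trunc hb ρ' x := rfl
      rw [map_sub, e']
      abel
    rw [e]
    have h2 : ‖x - trunc hb ρ' x‖ ≤ c * (1 / 2) ^ ρ / 2 := by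
      rw [← dist_eq_norm, dist_comm]
      exact (Metric.mem_ball.1 hρ').le
    refine (norm_add_le _ _).trans ?_
    have h3 := (norm_band_le hb (firstCoords ρ' : Set ℕ+) (trunc hb ρ x)).trans hx
    linarith
  choose nx xf wf h1 h2 h3 h4 h5 using pick
  set Q : ℕ → ℕ × ℕ := fun t => nx^[t] (0, 0) with hQ
  have hQ1 : ∀ t, Q (t + 1) = nx (Q t) := fun t => Function.iterate_succ_apply' nx t _
  have hρ : StrictMono fun k => (Q k).2 := strictMono_nat_of_lt_succ fun t => by
    simp only [hQ1]; exact h2 _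
  refine ⟨fun k => (Q (k + 1)).1, fun k => (Q k).2, fun k => xf (Q k), fun k => wf (Q k),
    strictMono_nat_of_lt_succ fun t => ?_, hρ, fun k => ⟨?_, ?_, ?_⟩⟩
  · simp only [hQ1]; exact h1 _
  · simp only [hQ1]; exact h3 _
  · refine (h4 _).trans ?_
    have := pow_le_pow_of_le_one (by norm_num : (0 : ℝ) ≤ 1 / 2) (by norm_num) (hρ.le_apply (x := k))
    gcongr
  · simp only [hQ1]; exact h5 _

theorem exists_blocks_near_of_coord_tendsto (hb : OneUnconditional b) {v : ℕ → X}
    (hv : ∀ i, Tendsto (fun n => b.coord i (v n)) atTop (𝓝 0)) {c : ℝ} (hc : 0 < c) :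
    ∃ (φ ρ : ℕ → ℕ) (w : ℕ → ℕ+ →₀ ℝ), StrictMono φ ∧ StrictMono ρ ∧
      ∀ k, ‖v (φ k) - ofSeq b (w k)‖ ≤ c * (1 / 2) ^ k ∧
        ∀ a ∈ (w k).support, ρ k < (a : ℕ) ∧ (a : ℕ) ≤ ρ (k + 1) := by
  obtain ⟨φ, ρ, x, w, hφ, hρ, h⟩ := exists_blocks_near hb (P := fun n x => x = v n) hc (by
    intro n ρ η hη
    have h1 : Tendsto (fun m => trunc hb ρ (v m)) atTop (𝓝 0) := by
      have : Tendsto (fun m => ∑ i ∈ firstCoords ρ, b.coord i (v m) • b.basis i) atTop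
          (𝓝 (∑ i ∈ firstCoords ρ, (0 : ℝ) • b.basis i)) :=
        tendsto_finsetSum _ fun i _ => (hv i).smul_const _
      simp only [zero_smul, Finset.sum_const_zero] at this
      exact this.congr fun m => (band_coe_finset hb _ _).symm
    obtain ⟨m, hm, hlt⟩ := ((h1.eventually (Metric.ball_mem_nhds 0 hη)).and
      (eventually_gt_atTop n)).exists
    exact ⟨m, v m, hlt, rfl, (mem_ball_zero_iff.1 hm).le⟩)
  exact ⟨φ, ρ, w, hφ, hρ, fun k => ⟨(h k).1 ▸ (h k).2.1, (h k).2.2⟩⟩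

end GlidingHump

/-! ### Isomorphs of `ℓ₁` in `X` and of `ℓ₂` in its 2-convexification -/

/-- With at most one non-zero summand any `g` fixing 0 commutes with the sum. It is applied
coordinatewise to disjoint blocks, with modulus and square as `g`. -/
theorem apply_sum_of_subsingleton_support {ι : Type*} (F : Finset ι) (f : ι → ℝ) (g : ℝ → ℝ)
    (g0 : g 0 = 0) (h : ∀ i ∈ F, ∀ j ∈ F, i ≠ j → f i = 0 ∨ f j = 0) :
    g (∑ i ∈ F, f i) = ∑ i ∈ F, g (f i) := by
  by_cases hex : ∃ i ∈ F, f i ≠ 0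
  · obtain ⟨i, hi, hfi⟩ := hex
    have h0 : ∀ j ∈ F, j ≠ i → f j = 0 := fun j hj hji => (h i hi j hj hji.symm).resolve_left hfi
    rw [Finset.sum_eq_single_of_mem i hi h0,
      Finset.sum_eq_single_of_mem i hi fun j hj hji => by rw [h0 j hj hji, g0]]
  · push Not at hex
    rw [Finset.sum_eq_zero hex, g0, Finset.sum_eq_zero fun i hi => by rw [hex i hi, g0]]

/-- The supports of the `w k` lie in consecutive intervals `(ρ k, ρ (k + 1)]`. -/
def IsBlockSeq (w : ℕ → ℕ+ →₀ ℝ) (ρ : ℕ → ℕ) : Prop :=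
  StrictMono ρ ∧ ∀ k, ∀ a ∈ (w k).support, ρ k < (a : ℕ) ∧ (a : ℕ) ≤ ρ (k + 1)

theorem IsBlockSeq.eq_zero_or {w : ℕ → ℕ+ →₀ ℝ} {ρ : ℕ → ℕ} (h : IsBlockSeq w ρ) {k l : ℕ}
    (hkl : k ≠ l) (i : ℕ+) : w k i = 0 ∨ w l i = 0 := by
  by_contra! hcon
  exact Finset.disjoint_left.1 (disjoint_support_of_blocks h.1 (fun k a ha => (h.2 k a ha).1)
    (fun k a ha => (h.2 k a ha).2) Set.univ (mem_univ k) (mem_univ l) hkl)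
    (Finsupp.mem_support_iff.2 hcon.1) (Finsupp.mem_support_iff.2 hcon.2)

theorem IsBlockSeq.apply_sum {w : ℕ → ℕ+ →₀ ℝ} {ρ : ℕ → ℕ} (h : IsBlockSeq w ρ) (F : Finset ℕ)
    (a : ℕ → ℝ) (g : ℝ → ℝ) (g0 : g 0 = 0) (i : ℕ+) :
    g ((∑ k ∈ F, a k • w k) i) = ∑ k ∈ F, g (a k * w k i) := by
  rw [Finsupp.finsetSum_apply]
  refine apply_sum_of_subsingleton_support F _ g g0 fun k _ l _ hkl => ?_
  rcases h.eq_zero_or hkl i with h' | h'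
  · left; simp [h']
  · right; simp [h']

theorem IsBlockSeq.mapRange {w : ℕ → ℕ+ →₀ ℝ} {ρ : ℕ → ℕ} (h : IsBlockSeq w ρ) (g : ℝ → ℝ)
    (g0 : g 0 = 0) : IsBlockSeq (fun k => (w k).mapRange g g0) ρ :=
  ⟨h.1, fun k a ha => h.2 k a (Finsupp.support_mapRange ha)⟩

theorem IsBlockSeq.abs_sum_apply {w : ℕ → ℕ+ →₀ ℝ} {ρ : ℕ → ℕ} (h : IsBlockSeq w ρ)
    (F : Finset ℕ) (a : ℕ → ℝ) (i : ℕ+) :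
    |(∑ k ∈ F, a k • w k) i| = ∑ k ∈ F, |a k| * |w k i| := by
  rw [h.apply_sum F a (fun t => |t|) abs_zero i]
  simp only [abs_mul]

theorem IsBlockSeq.sqr_sum_apply {w : ℕ → ℕ+ →₀ ℝ} {ρ : ℕ → ℕ} (h : IsBlockSeq w ρ)
    (F : Finset ℕ) (a : ℕ → ℝ) (i : ℕ+) :
    (∑ k ∈ F, a k • w k).sqr i = ∑ k ∈ F, a k ^ 2 * (w k i) ^ 2 := by
  have := h.apply_sum F a (fun t => t ^ 2) (by simp) i
  simp only [mul_pow] at this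
  exact this

section Equivalence

variable {X : Type*} [NormedAddCommGroup X] [NormedSpace ℝ X]
  {b : UnconditionalSchauderBasis ℕ+ ℝ X}

/-- There is a sequence of blocks of the basis equivalent to the unit vector basis of `ℓ₁`. -/
def HasEllOneBlocks (b : UnconditionalSchauderBasis ℕ+ ℝ X) : Prop :=
  ∃ (w : ℕ → ℕ+ →₀ ℝ) (ρ : ℕ → ℕ) (δ C : ℝ), 0 < δ ∧ IsBlockSeq w ρ ∧
    IsLpSeq 1 (fun k => ofSeq b (w k)) δ C

theorem sum_smul_ofSeq (b : UnconditionalSchauderBasis ℕ+ ℝ X) (F : Finset ℕ) (a : ℕ → ℝ)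
    (w : ℕ → ℕ+ →₀ ℝ) : ∑ k ∈ F, a k • ofSeq b (w k) = ofSeq b (∑ k ∈ F, a k • w k) := by
  rw [map_sum]
  simp_rw [map_smul]

theorem isLpSeq_of_embedding {p : ℝ≥0∞} [Fact (1 ≤ p)] (T : lp (fun _ : ℕ => ℝ) p →L[ℝ] X)
    {δ : ℝ} (hT : ∀ x, δ * ‖x‖ ≤ ‖T x‖) :
    IsLpSeq p (fun i => T (lp.single (E := fun _ : ℕ => ℝ) p i 1)) δ ‖T‖ := by
  intro F a
  have e : ∑ i ∈ F, a i • T (lp.single (E := fun _ : ℕ => ℝ) p i 1)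
      = T (∑ i ∈ F, lp.single (E := fun _ : ℕ => ℝ) p i (a i)) := by
    rw [map_sum]
    refine Finset.sum_congr rfl fun i _ => ?_
    rw [← map_smul, ← lp.single_smul, smul_eq_mul, mul_one]
  rw [e]
  exact ⟨hT _, T.le_opNorm _⟩

/-- Testing `ψ` on the vector with coefficients `ψ (e_n)` shows that these are square summable. -/
theorem tendsto_apply_single_ell2 (ψ : Ell2 →L[ℝ] ℝ) :
    Tendsto (fun n => ψ (lp.single (E := fun _ : ℕ => ℝ) 2 n 1)) atTop (𝓝 0) := by
  set a : ℕ → ℝ := fun n => ψ (lp.single (E := fun _ : ℕ => ℝ) 2 n 1) with ha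
  have hb : ∀ F : Finset ℕ, ∑ n ∈ F, a n ^ 2 ≤ ‖ψ‖ ^ 2 := by
    intro F
    have h1 : ∑ n ∈ F, a n ^ 2 = ψ (∑ n ∈ F, lp.single (E := fun _ : ℕ => ℝ) 2 n (a n)) := by
      rw [map_sum]
      refine Finset.sum_congr rfl fun n _ => ?_
      have : lp.single (E := fun _ : ℕ => ℝ) 2 n (a n)
          = a n • lp.single (E := fun _ : ℕ => ℝ) 2 n (1 : ℝ) := by
        rw [← lp.single_smul, smul_eq_mul, mul_one]
      rw [this, map_smul, smul_eq_mul, pow_two]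
    have h2 : ∑ n ∈ F, a n ^ 2 ≤ ‖ψ‖ * lpSum 2 F a := by
      rw [h1]
      exact (le_abs_self _).trans (ψ.le_opNorm _)
    rw [← lpSum_two_sq] at h2 ⊢
    have h3 := lpSum_nonneg 2 two_ne_zero F a
    rcases h3.eq_or_lt with h | h
    · rw [← h]; simp
    · have : lpSum 2 F a ≤ ‖ψ‖ := by nlinarith
      gcongr
  have hs : Summable fun n => a n ^ 2 :=
    summable_of_sum_le (fun n => sq_nonneg _) hb
  have := hs.tendsto_atTop_zero.sqrt
  rw [Real.sqrt_zero] at this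
  simp_rw [Real.sqrt_sq_eq_abs] at this
  exact (tendsto_zero_iff_abs_tendsto_zero _).2 this

variable [CompleteSpace X]

/-- The unit vectors of `ℓ₁` are not weakly null, so their images need not tend to zero
coordinatewise. By compactness of a product of intervals a subsequence converges coordinatewise;
differences of its terms at positions `2 n` and `2 n + 1` tend to zero coordinatewise and still span
`ℓ₁`. -/
theorem ContainsIsomorph.hasEllOneBlocks (hb : OneUnconditional b) (h : ContainsIsomorph X Ell1) :
    HasEllOneBlocks b := by
  obtain ⟨T, δ, hδ, hT⟩ := h.exists_embedding
  set e : ℕ → Ell1 := fun n => lp.single (E := fun _ : ℕ => ℝ) 1 n 1 with he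
  have hne : ∀ n, ‖e n‖ = 1 := fun n => by
    rw [he, lp.norm_single zero_lt_one]; simp
  have hbd : ∀ n, (fun i => b.coord i (T (e n))) ∈
      Set.pi univ fun i : ℕ+ => Icc (-(‖b.coord i‖ * ‖T‖)) (‖b.coord i‖ * ‖T‖) := by
    intro n i _
    rw [mem_Icc, ← abs_le]
    refine ((b.coord i).le_opNorm _).trans ?_
    have := T.le_opNorm (e n)
    rw [hne, mul_one] at this
    gcongr
  obtain ⟨y, -, φ, hφ, hy⟩ := (isCompact_univ_pi fun i : ℕ+ =>
    isCompact_Icc (a := -(‖b.coord i‖ * ‖T‖)) (b := ‖b.coord i‖ * ‖T‖)).tendsto_subseq hbd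
  rw [tendsto_pi_nhds] at hy
  set u : ℕ → X := fun n => T (e (φ (2 * n)) - e (φ (2 * n + 1))) with hu
  have hu0 : ∀ i, Tendsto (fun n => b.coord i (u n)) atTop (𝓝 0) := by
    intro i
    have h1 := (hy i).comp (tendsto_id.const_mul_atTop' (zero_lt_two (α := ℕ)))
    have h2 := h1.sub ((hy i).comp (tendsto_atTop_mono (fun n : ℕ => (show n ≤ 2 * n + 1 by omega))
      tendsto_id))
    rw [sub_self] at h2
    refine h2.congr fun n => ?_
    simp [hu]
  have hlp : IsLpSeq 1 u δ (2 * ‖T‖) := by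
    intro F a
    rw [lpSum_one]
    have e1 : ∑ i ∈ F, a i • u i = T (∑ i ∈ F, a i • (e (φ (2 * i)) - e (φ (2 * i + 1)))) := by
      rw [map_sum]
      simp_rw [map_smul]
      rfl
    rw [e1]
    set x := ∑ i ∈ F, a i • (e (φ (2 * i)) - e (φ (2 * i + 1))) with hx
    have hinj : Function.Injective fun i => φ (2 * i) := fun i j hij => by
      have := hφ.injective hij
      omega
    constructor
    · refine le_trans ?_ (hT x)
      gcongr
      -- Only the coordinates `φ (2 n)` with `n ∈ F` are kept; at each of them a single difference
      -- is non-zero and contributes `a n`.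
      have h1 := lp.sum_rpow_le_norm_rpow (E := fun _ : ℕ => ℝ) (p := 1) (by simp) x
        (F.map ⟨_, hinj⟩)
      simp only [ENNReal.toReal_one, Real.rpow_one, Finset.sum_map, Function.Embedding.coeFn_mk] at h1
      refine le_trans (le_of_eq (Finset.sum_congr rfl fun n hn => ?_)) h1
      rw [Real.norm_eq_abs]
      congr 1
      rw [hx]
      simp only [lp.coeFn_sum, Finset.sum_apply]
      rw [Finset.sum_eq_single_of_mem n hn]
      · have h2 : φ (2 * n) ≠ φ (2 * n + 1) := fun h => by
          have := hφ.injective h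
          omega
        show a n = a n * ((e (φ (2 * n))) (φ (2 * n)) - (e (φ (2 * n + 1))) (φ (2 * n)))
        rw [he]
        simp [h2]
      · intro m _ hmn
        have h2 : φ (2 * n) ≠ φ (2 * m + 1) := fun h => by
          have := hφ.injective h
          omega
        have h3 : φ (2 * n) ≠ φ (2 * m) := fun h => by
          have := hφ.injective h
          omega
        show a m * ((e (φ (2 * m))) (φ (2 * n)) - (e (φ (2 * m + 1))) (φ (2 * n))) = 0
        rw [he]
        simp [h2, h3]
    · refine (T.le_opNorm x).trans ?_
      have : ‖x‖ ≤ ∑ i ∈ F, |a i| * 2 := by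
        refine norm_sum_le_of_le _ fun i _ => ?_
        rw [norm_smul, Real.norm_eq_abs]
        have := norm_sub_le (e (φ (2 * i))) (e (φ (2 * i + 1)))
        rw [hne, hne] at this
        gcongr
        linarith
      rw [← Finset.sum_mul] at this
      nlinarith [norm_nonneg T]
  obtain ⟨ψ, ρ, w, hψ, hρ, hw⟩ := exists_blocks_near_of_coord_tendsto hb hu0
    (by positivity : 0 < δ / 4)
  exact ⟨w, ρ, _, _, half_pos hδ, ⟨hρ, fun k => (hw k).2⟩,
    (hlp.comp_strictMono ENNReal.one_ne_top hψ).perturb hδ.le fun k => (hw k).1⟩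

theorem HasEllOneBlocks.containsIsomorph (h : HasEllOneBlocks b) : ContainsIsomorph X Ell1 := by
  obtain ⟨w, ρ, δ, C, hδ, -, hw⟩ := h
  obtain ⟨Z, -, hZ⟩ := hw.exists_submodule ENNReal.one_ne_top hδ (Z := ⊤) isClosed_univ
    fun _ => Submodule.mem_top
  exact ⟨Z, hZ⟩

/-- If the squares of blocks satisfy `ℓ₁` estimates in `X`, then the blocks satisfy `ℓ₂` estimates
in `X^(2)`. -/
theorem isLpSeq_two_of_sqr (hb : OneUnconditional b) {w : ℕ → ℕ+ →₀ ℝ} {ρ : ℕ → ℕ}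
    (hw : IsBlockSeq w ρ) {δ C : ℝ} (hδ : 0 ≤ δ)
    (h : ∀ (F : Finset ℕ) (a : ℕ → ℝ), (∀ k, 0 ≤ a k) →
      δ * ∑ k ∈ F, a k ≤ ‖ofSeq b (∑ k ∈ F, a k • (w k).sqr)‖ ∧
      ‖ofSeq b (∑ k ∈ F, a k • (w k).sqr)‖ ≤ C * ∑ k ∈ F, a k) :
    IsLpSeq 2 (fun k => ofSeq (Conv2.basis hb) (w k)) (√δ) (√|C|) := by
  intro F a
  obtain ⟨h1, h2⟩ := h F (fun k => a k ^ 2) fun k => sq_nonneg _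
  have e : ∑ k ∈ F, a k ^ 2 • (w k).sqr = (∑ k ∈ F, a k • w k).sqr := by
    ext i
    rw [hw.sqr_sum_apply, Finsupp.finsetSum_apply]
    rfl
  have hL := lpSum_nonneg 2 two_ne_zero F a
  rw [e, ← Conv2.norm_ofSeq_sq hb, ← lpSum_two_sq] at h1 h2
  rw [sum_smul_ofSeq]
  constructor
  · refine le_of_sq_le_sq ?_ (norm_nonneg _)
    rw [mul_pow, Real.sq_sqrt hδ]
    exact h1
  · refine le_of_sq_le_sq ?_ (by positivity)
    rw [mul_pow, Real.sq_sqrt (abs_nonneg _)]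
    exact h2.trans (mul_le_mul_of_nonneg_right (le_abs_self _) (sq_nonneg _))

/-- The blocks `√|w k|` of `X^(2)` have squares `|w k|`, which by unconditionality satisfy the same
estimates as `w k`. -/
theorem HasEllOneBlocks.containsIsomorph_conv2 (hb : OneUnconditional b) (h : HasEllOneBlocks b) :
    ContainsIsomorph (Conv2 b hb) Ell2 := by
  obtain ⟨w, ρ, δ, C, hδ, hρ, hw⟩ := h
  set u : ℕ → ℕ+ →₀ ℝ := fun k => (w k).mapRange (fun t => √|t|) (by simp) with hu
  have hub : IsBlockSeq u ρ := hρ.mapRange _ _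
  have husq : ∀ k i, (u k).sqr i = |w k i| := fun k i => Real.sq_sqrt (abs_nonneg _)
  have hlp := isLpSeq_two_of_sqr hb hub hδ.le (C := C) (by
    intro F a ha
    have e : ‖ofSeq b (∑ k ∈ F, a k • (u k).sqr)‖ = ‖∑ k ∈ F, a k • ofSeq b (w k)‖ := by
      rw [sum_smul_ofSeq]
      refine hb.norm_eq fun i => ?_
      rw [coord_ofSeq, coord_ofSeq, hρ.abs_sum_apply, Finsupp.finsetSum_apply]
      simp only [Finsupp.smul_apply, husq, smul_eq_mul]
      rw [abs_of_nonneg (Finset.sum_nonneg fun k _ => mul_nonneg (ha k) (abs_nonneg _))]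
      exact Finset.sum_congr rfl fun k _ => by rw [abs_of_nonneg (ha k)]
    rw [e]
    have := hw F a
    rw [lpSum_one, Finset.sum_congr rfl fun k _ => abs_of_nonneg (ha k)] at this
    exact this)
  obtain ⟨Z, -, hZ⟩ := hlp.exists_submodule ENNReal.ofNat_ne_top (Real.sqrt_pos.2 hδ) (Z := ⊤)
    isClosed_univ fun _ => Submodule.mem_top
  exact ⟨Z, hZ⟩

/-- Block the copy of `ℓ₂` by a gliding hump and square. An `ℓ₁` combination of the squares with
coefficients `a k` corresponds to the `ℓ₂` combination with coefficients `√|a k|`. -/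
theorem hasEllOneBlocks_of_containsIsomorph_conv2 (hb : OneUnconditional b)
    (h : ContainsIsomorph (Conv2 b hb) Ell2) : HasEllOneBlocks b := by
  obtain ⟨T, δ, hδ, hT⟩ := h.exists_embedding
  have hlp := isLpSeq_of_embedding T hT
  obtain ⟨φ, ρ, w, hφ, hρ, hw⟩ := exists_blocks_near_of_coord_tendsto
    (Conv2.basis_oneUnconditional hb) (v := fun i => T (lp.single (E := fun _ : ℕ => ℝ) 2 i 1))
    (fun i => tendsto_apply_single_ell2 (((Conv2.basis hb).coord i).comp T))
    (by positivity : 0 < δ / 4)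
  have hwb : IsBlockSeq w ρ := ⟨hρ, fun k => (hw k).2⟩
  have hlp' := (hlp.comp_strictMono ENNReal.ofNat_ne_top hφ).perturb hδ.le fun k => (hw k).1
  refine ⟨fun k => (w k).sqr, ρ, (δ / 2) ^ 2, (‖T‖ + δ / 2) ^ 2, by positivity,
    hwb.mapRange _ _, fun F a => ?_⟩
  have e : ‖∑ k ∈ F, a k • ofSeq b (w k).sqr‖
      = ‖∑ k ∈ F, √|a k| • ofSeq (Conv2.basis hb) (w k)‖ ^ 2 := by
    rw [sum_smul_ofSeq, sum_smul_ofSeq, Conv2.norm_ofSeq_sq]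
    refine hb.norm_eq fun i => ?_
    have hsq : IsBlockSeq (fun k => (w k).sqr) ρ := hwb.mapRange _ _
    have happ : ∀ k, (w k).sqr i = w k i ^ 2 := fun _ => rfl
    rw [coord_ofSeq, coord_ofSeq, hwb.sqr_sum_apply, hsq.abs_sum_apply]
    simp only [happ]
    rw [abs_of_nonneg (Finset.sum_nonneg fun k _ => by positivity)]
    refine Finset.sum_congr rfl fun k _ => ?_
    rw [Real.sq_sqrt (abs_nonneg _), abs_of_nonneg (sq_nonneg (w k i))]
  obtain ⟨h1, h2⟩ := hlp' F fun k => √|a k|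
  have e2 : lpSum 1 F a = lpSum 2 F (fun k => √|a k|) ^ 2 := by
    rw [lpSum_one, lpSum_two_sq]
    exact Finset.sum_congr rfl fun k _ => (Real.sq_sqrt (abs_nonneg _)).symm
  have hL := lpSum_nonneg 2 two_ne_zero F fun k => √|a k|
  rw [e, e2, ← mul_pow, ← mul_pow]
  exact ⟨by gcongr, by gcongr⟩

/-- `X` contains `ℓ₁` if and only if `X^(2)` contains `ℓ₂`. -/
theorem containsIsomorph_ell1_iff (hb : OneUnconditional b) :
    ContainsIsomorph X Ell1 ↔ ContainsIsomorph (Conv2 b hb) Ell2 :=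
  ⟨fun h => (h.hasEllOneBlocks hb).containsIsomorph_conv2 hb,
    fun h => (hasEllOneBlocks_of_containsIsomorph_conv2 hb h).containsIsomorph⟩

end Equivalence

/-! ### The limit spaces contain no blocks equivalent to `ℓ₁` -/

/-- Convex combinations of the moduli `|w k|` with `ρ k ≥ n` have norm between the two `ℓ₁`
constants, so they are sets of the kind excluded by `limNorm_not_bounded_below`. Moduli have the
same norms as the signed blocks. -/
theorem limNorm_not_hasEllOneBlocks {θ : ℕ+ → ℝ} (hθ : ∀ n, θ n ∈ Ioo (0 : ℝ) 1)
    (hlim : Tendsto θ atTop (𝓝 0)) {A : FamilyRule} (hA : A.Disj) (hG : A.Good) :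
    ¬ HasEllOneBlocks (C00Completion.basis (limNorm hθ hA)) := by
  rintro ⟨w, ρ, δ, C, hδ, hw, hlp⟩
  set N := limNorm hθ hA with hN
  set W : ℕ → ℕ+ →₀ ℝ := fun k => (w k).mapRange (fun t => |t|) abs_zero with hW
  have hWb : IsBlockSeq W ρ := hw.mapRange _ _
  set L : (ℕ →₀ ℝ) →ₗ[ℝ] (ℕ+ →₀ ℝ) := Finsupp.linearCombination ℝ W with hL
  set 𝒞 : ℕ → Set (ℕ+ →₀ ℝ) := fun n => L '' {a | (∀ k, 0 ≤ a k) ∧ totalMass a = 1 ∧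
    ∀ k, a k ≠ 0 → n ≤ ρ k} with h𝒞
  have hval : ∀ y ∈ 𝒞 0, δ ≤ N.toFun y ∧ N.toFun y ≤ C := by
    rintro _ ⟨a, ⟨ha0, ha1, -⟩, rfl⟩
    have e : N.toFun (L a) = ‖∑ k ∈ a.support, a k • ofSeq (C00Completion.basis N) (w k)‖ := by
      rw [sum_smul_ofSeq, C00Completion.norm_ofSeq]
      have e1 : ∀ i, |(L a) i| = |(∑ k ∈ a.support, a k • w k) i| := fun i => by
        rw [hL, Finsupp.linearCombination_apply, Finsupp.sum, hWb.abs_sum_apply, hw.abs_sum_apply]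
        refine Finset.sum_congr rfl fun k _ => ?_
        rw [hW, Finsupp.mapRange_apply, abs_abs]
      exact le_antisymm (N.mono _ _ fun i => (e1 i).le) (N.mono _ _ fun i => (e1 i).ge)
    have h1 := hlp a.support a
    rw [lpSum_one, Finset.sum_congr rfl fun k _ => abs_of_nonneg (ha0 k), ← totalMass_apply, ha1,
      mul_one, mul_one, ← e] at h1
    exact h1
  refine limNorm_not_bounded_below hθ hlim hA hG 𝒞 (fun n => ?_) (fun m n hmn => ?_) (fun n => ?_)
    (fun n => ?_) hδ (fun y hy => (hval y hy).1) (fun y hy => (hval y hy).2)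
  · refine Convex.linear_image ?_ L
    rintro a ⟨ha0, ha1, ha2⟩ a' ⟨ha0', ha1', ha2'⟩ s t hs ht hst
    refine ⟨fun k => add_nonneg (mul_nonneg hs (ha0 k)) (mul_nonneg ht (ha0' k)), ?_,
      fun k hk => ?_⟩
    · rw [map_add, map_smul, map_smul, ha1, ha1']
      simpa using hst
    · by_contra hn
      have h1 : a k = 0 := by by_contra h; exact hn (ha2 k h)
      have h2 : a' k = 0 := by by_contra h; exact hn (ha2' k h)
      exact hk (by simp [h1, h2])
  · exact image_mono fun a ⟨h0, h1, h2⟩ => ⟨h0, h1, fun k hk => hmn.trans (h2 k hk)⟩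
  · refine ⟨_, Finsupp.single n 1, ⟨fun k => ?_, by simp [totalMass], fun k hk => ?_⟩, rfl⟩
    · rw [Finsupp.single_apply]
      split_ifs <;> simp
    · have : n = k := by
        by_contra hne
        exact hk (by simp [hne])
      rw [← this]
      exact hw.1.le_apply
  · rintro _ ⟨a, ⟨-, -, ha⟩, rfl⟩ i hi
    by_contra! hle
    refine Finsupp.mem_support_iff.1 hi ?_
    rw [hL, Finsupp.linearCombination_apply, Finsupp.sum, Finsupp.finsetSum_apply]
    refine Finset.sum_eq_zero fun k hk => ?_
    have h1 := ha k (Finsupp.mem_support_iff.1 hk)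
    have : W k i = 0 := by
      by_contra hne
      have := (hWb.2 k i (Finsupp.mem_support_iff.2 hne)).1
      omega
    simp [this]

/-! ### Complemented Euclidean subspaces -/

/-- A finite dimensional subspace on which an operator into a Hilbert space is bounded below is
complemented and Euclidean. -/
theorem exists_projection_of_hilbert_estimate {Y H : Type*} [NormedAddCommGroup Y]
    [NormedSpace ℝ Y] [NormedAddCommGroup H] [InnerProductSpace ℝ H] (T : Y →L[ℝ] H)
    (F : Submodule ℝ Y) [FiniteDimensional ℝ F] {A B : ℝ} (hB0 : 0 ≤ B)
    (hA : ∀ x, ‖T x‖ ≤ A * ‖x‖) (hB : ∀ x ∈ F, ‖x‖ ≤ B * ‖T x‖) (hA0 : 0 ≤ A) :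
    ∃ P : Y →L[ℝ] F, (∀ x : F, P x = x) ∧ euclideanDist F ≤ A * B ∧ ‖P‖ ≤ A * B := by
  set S : F →ₗ[ℝ] H := (T : Y →ₗ[ℝ] H).domRestrict F with hS
  have hinj : Function.Injective S := by
    rw [← LinearMap.ker_eq_bot, LinearMap.ker_eq_bot']
    intro x hx
    have h1 := hB x x.2
    have h2 : T x = 0 := hx
    rw [h2, norm_zero, mul_zero] at h1
    exact Subtype.ext (norm_le_zero_iff.1 h1)
  set K := LinearMap.range S with hK
  set e : F ≃ₗ[ℝ] K := LinearEquiv.ofInjective S hinj with he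
  have he1 : ∀ x : F, ‖e x‖ ≤ A * ‖x‖ := fun x => hA x
  have he2 : ∀ y : K, ‖e.symm y‖ ≤ B * ‖y‖ := fun y => by
    have h := hB (e.symm y) (e.symm y).2
    have h1 : T (e.symm y) = y := congrArg Subtype.val (e.apply_symm_apply y)
    rwa [h1] at h
  set e' : F ≃L[ℝ] K := e.toContinuousLinearEquiv with he'
  have hn1 : ‖(e' : F →L[ℝ] K)‖ ≤ A := ContinuousLinearMap.opNorm_le_bound _ hA0 he1
  have hn2 : ‖(e'.symm : K →L[ℝ] F)‖ ≤ B := ContinuousLinearMap.opNorm_le_bound _ hB0 he2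
  have hfr : Module.finrank ℝ K = Module.finrank ℝ F := e.symm.finrank_eq
  -- Map into the Hilbert space, project orthogonally onto the image of `F`, and return by the
  -- inverse of `T` on `F`.
  refine ⟨(e'.symm : K →L[ℝ] F).comp (K.orthogonalProjectionOnto.comp T), fun x => ?_, ?_, ?_⟩
  · have h1 : T x = e x := rfl
    simp only [ContinuousLinearMap.comp_apply, h1,
      Submodule.orthogonalProjectionOnto_mem_subspace_eq_self]
    exact e.symm_apply_apply x
  · set o := ((stdOrthonormalBasis ℝ K).reindex (finCongr hfr)).repr with ho
    set O : F ≃L[ℝ] EuclideanSpace ℝ (Fin (Module.finrank ℝ F)) :=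
      e'.trans o.toContinuousLinearEquiv with hO
    have hbdd : BddBelow {r | ∃ T : F ≃L[ℝ] EuclideanSpace ℝ (Fin (Module.finrank ℝ F)),
        r = ‖(T : F →L[ℝ] EuclideanSpace ℝ (Fin (Module.finrank ℝ F)))‖ *
          ‖(T.symm : EuclideanSpace ℝ (Fin (Module.finrank ℝ F)) →L[ℝ] F)‖} := by
      refine ⟨0, ?_⟩
      rintro _ ⟨T, rfl⟩
      positivity
    refine (csInf_le hbdd ⟨O, rfl⟩).trans ?_
    · refine mul_le_mul ?_ ?_ (ContinuousLinearMap.opNorm_nonneg _) hA0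
      · refine ContinuousLinearMap.opNorm_le_bound _ hA0 fun x => ?_
        have : ‖O x‖ = ‖e x‖ := o.norm_map _
        exact this.trans_le (he1 x)
      · refine ContinuousLinearMap.opNorm_le_bound _ hB0 fun x => ?_
        refine (he2 _).trans_eq ?_
        congr 1
        exact o.symm.norm_map x
  · refine ContinuousLinearMap.opNorm_le_bound _ (by positivity) fun x => ?_
    refine (he2 _).trans ?_
    have h1 := K.norm_orthogonalProjectionOnto_apply_le (T x)
    have := hA x
    calc _ ≤ B * (A * ‖x‖) := by gcongr; exact h1.trans this
      _ = _ := by ring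

/-! ### Subspaces and spanning sets in finite dimension -/

theorem Submodule.exists_le_finrank_eq {Y : Type*} [AddCommGroup Y] [Module ℝ Y]
    (E : Submodule ℝ Y) [FiniteDimensional ℝ E] {k : ℕ} (hk : k ≤ Module.finrank ℝ E) :
    ∃ F ≤ E, Module.finrank ℝ F = k := by
  have hli : LinearIndependent ℝ fun i : Fin k =>
      ((Module.finBasis ℝ E (Fin.castLE hk i) : E) : Y) :=
    ((Module.finBasis ℝ E).linearIndependent.comp _ (Fin.castLE_injective hk)).map'
      E.subtype E.ker_subtype
  refine ⟨Submodule.span ℝ (Set.range fun i : Fin k =>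
      ((Module.finBasis ℝ E (Fin.castLE hk i) : E) : Y)), ?_, ?_⟩
  · rw [Submodule.span_le]
    rintro _ ⟨i, rfl⟩
    exact (Module.finBasis ℝ E _).2
  · rw [finrank_span_eq_card hli, Fintype.card_fin]

/-- A crude substitute for an Auerbach basis; exponential coefficient bounds are affordable because
doubly exponentially many sets will be available. Riesz's lemma adds a unit vector at distance at
least `1 / 2` from a hyperplane. -/
theorem exists_spanning_bounded_coeff (k : ℕ) : ∀ (F : Type*) [NormedAddCommGroup F]
    [NormedSpace ℝ F] [FiniteDimensional ℝ F], Module.finrank ℝ F = k →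
    ∃ x : Fin k → F, (∀ j, ‖x j‖ ≤ 1) ∧
      ∀ y, ∃ a : Fin k → ℝ, y = ∑ j, a j • x j ∧ ∑ j, |a j| ≤ 5 ^ k * ‖y‖ := by
  induction k with
  | zero =>
    intro F _ _ _ hF
    have := Module.finrank_zero_iff.1 hF
    exact ⟨fun _ => 0, by simp, fun y => ⟨0, Subsingleton.elim _ _, by simp⟩⟩
  | succ k ih =>
    intro F _ _ _ hF
    have hnt : Nontrivial F := Module.nontrivial_of_finrank_pos (R := ℝ) (by omega)
    obtain ⟨y₀, hy₀⟩ := exists_ne (0 : F)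
    obtain ⟨f, -, hf⟩ := exists_dual_vector ℝ y₀ (norm_ne_zero_iff.2 hy₀)
    set G := LinearMap.ker (f : F →ₗ[ℝ] ℝ) with hG
    have hy₀G : y₀ ∉ G := fun h => by
      have h1 : f y₀ = 0 := h
      rw [hf] at h1
      exact hy₀ (norm_eq_zero.1 h1)
    have hGk : Module.finrank ℝ G = k := by
      have h1 := LinearMap.finrank_range_add_finrank_ker (f : F →ₗ[ℝ] ℝ)
      have h2 : LinearMap.range (f : F →ₗ[ℝ] ℝ) = ⊤ := by
        refine LinearMap.range_eq_top.2 (LinearMap.surjective fun h => hy₀G ?_)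
        show (f : F →ₗ[ℝ] ℝ) y₀ = 0
        rw [h]; rfl
      rw [h2, finrank_top, Module.finrank_self, hF, ← hG] at h1
      omega
    obtain ⟨x, hx, hxG⟩ := ih G hGk
    obtain ⟨z, hzG, hz1, hz⟩ := riesz_lemma_of_lt_one (𝕜 := ℝ) (G.closed_of_finiteDimensional)
      ⟨y₀, hy₀G⟩ (r := 1 / 2) (by norm_num)
    have hfz : f z ≠ 0 := hzG
    refine ⟨Fin.cons z fun j => (x j : F), fun j => ?_, fun y => ?_⟩
    · refine Fin.cases ?_ (fun j => ?_) j
      · simp [hz1]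
      · simpa using hx j
    · set t := f y / f z with ht
      have hg : y - t • z ∈ G := by
        show f (y - t • z) = 0
        rw [map_sub, map_smul, smul_eq_mul, ht, div_mul_cancel₀ _ hfz, sub_self]
      obtain ⟨a, ha, ha'⟩ := hxG ⟨_, hg⟩
      have ha2 := congrArg Subtype.val ha
      simp only [Submodule.coe_sum, Submodule.coe_smul] at ha2
      have htb : |t| ≤ 2 * ‖y‖ := by
        by_cases h0 : t = 0
        · rw [h0, abs_zero]; positivity
        -- The difference between `z` and this element of `G` is `t⁻¹ • y`, so the distance bound
        -- reads `1 / 2 ≤ |t|⁻¹ * ‖y‖`.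
        · have h1 := hz (-t⁻¹ • (y - t • z)) (G.smul_mem _ hg)
          have h2 : z - -t⁻¹ • (y - t • z) = t⁻¹ • y := by
            rw [smul_sub, smul_smul, neg_mul, inv_mul_cancel₀ h0]
            simp
          rw [h2, norm_smul, norm_inv, Real.norm_eq_abs, inv_mul_eq_div,
            le_div_iff₀ (abs_pos.2 h0)] at h1
          linarith
      have hgn : ‖y - t • z‖ ≤ 3 * ‖y‖ := by
        refine (norm_sub_le _ _).trans ?_
        rw [norm_smul, hz1, Real.norm_eq_abs]
        linarith
      refine ⟨Fin.cons t a, ?_, ?_⟩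
      · rw [Fin.sum_univ_succ]
        simp only [Fin.cons_zero, Fin.cons_succ]
        rw [← ha2]
        abel
      · rw [Fin.sum_univ_succ]
        simp only [Fin.cons_zero, Fin.cons_succ]
        have h1 : ∑ j, |a j| ≤ 5 ^ k * (3 * ‖y‖) := ha'.trans (by gcongr; exact hgn)
        have h5 : (1 : ℝ) ≤ 5 ^ k := one_le_pow₀ (by norm_num)
        rw [pow_succ]
        -- The constants close since `2 + 3 * 5 ^ k ≤ 5 ^ (k + 1)`.
        nlinarith [norm_nonneg y]

/-! ### Iterating lower `ℓ₁` estimates -/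

/-- At most `f m` disjoint sets beyond `m` satisfy a lower `ℓ₁` estimate. -/
def UncNorm.LowerEllOneAt (N : UncNorm) (f : ℕ → ℕ) (C : ℝ) : Prop :=
  ∀ ⦃ι : Type⦄ (s : Finset ι) (E : ι → Finset ℕ+) (m : ℕ), (s : Set ι).PairwiseDisjoint E →
    s.card ≤ f m → (∀ i ∈ s, ∀ a ∈ E i, m ≤ (a : ℕ)) →
      ∀ x, ∑ i ∈ s, N.toFun (restr (E i) x) ≤ C * N.toFun x

theorem UncNorm.LowerEllOne.at_id {N : UncNorm} {c : ℝ} (hc : 0 < c) (h : N.LowerEllOne c) :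
    N.LowerEllOneAt (fun m => m) c⁻¹ := fun ι s E m hd hs hm x => by
  rw [inv_mul_eq_div, le_div_iff₀ hc, mul_comm]
  exact h s E hd (fun i hi a ha => hs.trans (hm i hi a ha)) x

/-- Order the non-empty sets by their minima and group the ranks dyadically. The `u`-th group has at
most `2 ^ u` sets, and their minima are at least rank plus one, hence at least `2 ^ u`; so `h₀`
applies inside each group. There are at most `f m` groups, to whose unions `h` applies. The `- 1` in
the exponent's companion `2 ^ f m - 1` keeps the logarithms of the ranks below `f m`. -/
theorem UncNorm.LowerEllOneAt.exp {N : UncNorm} {f : ℕ → ℕ} {C C₀ : ℝ} (hC₀ : 0 ≤ C₀)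
    (h₀ : N.LowerEllOneAt (fun m => m) C₀) (h : N.LowerEllOneAt f C) :
    N.LowerEllOneAt (fun m => 2 ^ f m - 1) (C₀ * C) := by
  classical
  intro ι s E m hd hs hm x
  beta_reduce at hs
  set s' := s.filter fun i => (E i).Nonempty with hs'
  have hs's : s' ⊆ s := Finset.filter_subset _ _
  have hne : ∀ i ∈ s', (E i).Nonempty := fun i hi => (Finset.mem_filter.1 hi).2
  set μ : ι → ℕ := fun i => if h : (E i).Nonempty then ((E i).min' h : ℕ) else 0 with hμ
  have hμ1 : ∀ i ∈ s', ∃ a ∈ E i, (a : ℕ) = μ i := fun i hi =>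
    ⟨_, (E i).min'_mem (hne i hi), by rw [hμ]; simp only [dif_pos (hne i hi)]⟩
  have hμ2 : ∀ i ∈ s', ∀ a ∈ E i, μ i ≤ (a : ℕ) := fun i hi a ha => by
    rw [hμ]; simp only [dif_pos (hne i hi)]
    exact (E i).min'_le a ha
  have hμinj : ∀ i ∈ s', ∀ j ∈ s', μ i = μ j → i = j := by
    intro i hi j hj hij
    by_contra hne'
    obtain ⟨a, ha, ha'⟩ := hμ1 i hi
    obtain ⟨c, hc, hc'⟩ := hμ1 j hj
    have : a = c := PNat.coe_injective (by rw [ha', hc', hij])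
    subst this
    exact Finset.disjoint_left.1 (hd (hs's hi) (hs's hj) hne') ha hc
  set r : ι → ℕ := fun i => (s'.filter fun j => μ j < μ i).card with hr
  have hrlt : ∀ i ∈ s', r i + 1 ≤ s'.card := fun i hi =>
    Finset.card_lt_card (Finset.filter_ssubset.2 ⟨i, hi, lt_irrefl _⟩)
  have hrμ : ∀ i ∈ s', r i + 1 ≤ μ i := by
    intro i hi
    have h1 : r i ≤ (Finset.Ico 1 (μ i)).card := by
      refine Finset.card_le_card_of_injOn μ (fun j hj => ?_) fun j hj l hl hjl => ?_
      · obtain ⟨h1, h2⟩ := Finset.mem_filter.1 hj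
        obtain ⟨a, -, ha⟩ := hμ1 j h1
        have := a.pos
        exact Finset.mem_coe.2 (Finset.mem_Ico.2 ⟨by omega, h2⟩)
      · exact hμinj j (Finset.mem_filter.1 hj).1 l (Finset.mem_filter.1 hl).1 hjl
    obtain ⟨a, -, ha⟩ := hμ1 i hi
    have := a.pos
    rw [Nat.card_Ico] at h1
    omega
  have hrinj : ∀ i ∈ s', ∀ j ∈ s', r i = r j → i = j := by
    have key : ∀ i ∈ s', ∀ j, μ i < μ j → r i < r j := fun i hi j hij =>
      Finset.card_lt_card (Finset.ssubset_iff_subset_ne.2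
        ⟨fun l hl => Finset.mem_filter.2 ⟨(Finset.mem_filter.1 hl).1,
          (Finset.mem_filter.1 hl).2.trans hij⟩, fun he => by
          have : i ∈ s'.filter fun l => μ l < μ i := by
            rw [he]; exact Finset.mem_filter.2 ⟨hi, hij⟩
          exact lt_irrefl _ (Finset.mem_filter.1 this).2⟩)
    intro i hi j hj hij
    refine hμinj i hi j hj ?_
    rcases lt_trichotomy (μ i) (μ j) with h' | h' | h'
    · have := key i hi j h'; omega
    · exact h'
    · have := key j hj i h'; omega
  set t : ι → ℕ := fun i => Nat.log 2 (r i + 1) with ht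
  have htf : ∀ i ∈ s', t i < f m := fun i hi => by
    refine Nat.log_lt_of_lt_pow (by omega) ?_
    have h1 := hrlt i hi
    have h2 := Finset.card_le_card hs's
    have h3 : 0 < 2 ^ f m := by positivity
    omega
  set B : ℕ → Finset ι := fun u => s'.filter fun i => t i = u with hB
  have hBcard : ∀ u, (B u).card ≤ 2 ^ u := fun u => by
    have h1 : (B u).card ≤ (Finset.Ico (2 ^ u) (2 ^ (u + 1))).card := by
      refine Finset.card_le_card_of_injOn (fun i => r i + 1) (fun i hi => ?_)
        fun i hi j hj hij => ?_
      · have h2 : t i = u := (Finset.mem_filter.1 hi).2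
        refine Finset.mem_coe.2 (Finset.mem_Ico.2 ⟨?_, ?_⟩)
        · rw [← h2]; exact Nat.pow_log_le_self 2 (by omega)
        · rw [← h2]; exact Nat.lt_pow_succ_log_self (by omega) _
      · exact hrinj i (Finset.mem_filter.1 hi).1 j (Finset.mem_filter.1 hj).1
          (Nat.succ_injective hij)
    rw [Nat.card_Ico, pow_succ] at h1
    omega
  set U : ℕ → Finset ℕ+ := fun u => (B u).biUnion E with hU
  have hBs : ∀ u, B u ⊆ s := fun u => (Finset.filter_subset _ _).trans hs's
  have hUd : (Finset.range (f m) : Set ℕ).PairwiseDisjoint U := by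
    intro u _ v _ huv
    refine (Finset.disjoint_biUnion_left _ _ _).2 fun i hi =>
      (Finset.disjoint_biUnion_right _ _ _).2 fun j hj => hd (hBs u hi) (hBs v hj) fun hij => ?_
    rw [hB, Finset.mem_filter] at hi hj
    exact huv (by rw [← hi.2, ← hj.2, hij])
  have hinner : ∀ u, ∑ i ∈ B u, N.toFun (restr (E i) x) ≤ C₀ * N.toFun (restr (U u) x) := by
    intro u
    have h1 := h₀ (B u) E (2 ^ u) (hd.subset (Finset.coe_subset.2 (hBs u))) (hBcard u)
      (fun i hi a ha => ?_) (restr (U u) x)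
    · refine le_trans (le_of_eq (Finset.sum_congr rfl fun i hi => ?_)) h1
      rw [restr_restr, Finset.inter_eq_left.2 (Finset.subset_biUnion_of_mem E hi)]
    · rw [hB, Finset.mem_filter] at hi
      refine le_trans ?_ ((hrμ i hi.1).trans (hμ2 i hi.1 a ha))
      rw [← hi.2]
      exact Nat.pow_log_le_self 2 (by omega)
  have houter := h (Finset.range (f m)) U m hUd (by simp) (fun u _ a ha => by
    obtain ⟨i, hi, hai⟩ := Finset.mem_biUnion.1 ha
    exact hm i (hBs u hi) a hai) x
  calc ∑ i ∈ s, N.toFun (restr (E i) x) = ∑ i ∈ s', N.toFun (restr (E i) x) := by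
        refine (Finset.sum_subset hs's fun i hi hi' => ?_).symm
        have : E i = ∅ := by
          by_contra hne'
          exact hi' (Finset.mem_filter.2 ⟨hi, Finset.nonempty_iff_ne_empty.2 hne'⟩)
        rw [this, restr_eq_zero (Finset.disjoint_empty_left _), N.zero]
    _ = ∑ u ∈ Finset.range (f m), ∑ i ∈ B u, N.toFun (restr (E i) x) :=
        (Finset.sum_fiberwise_of_maps_to (fun i hi => Finset.mem_range.2 (htf i hi)) _).symm
    _ ≤ ∑ u ∈ Finset.range (f m), C₀ * N.toFun (restr (U u) x) :=
        Finset.sum_le_sum fun u _ => hinner u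
    _ ≤ C₀ * C * N.toFun x := by
        rw [← Finset.mul_sum, mul_assoc]
        exact mul_le_mul_of_nonneg_left houter hC₀

/-- Doubly exponentially many disjoint sets satisfy a lower `ℓ₁` estimate. -/
theorem UncNorm.LowerEllOne.at_exp_exp {N : UncNorm} {c : ℝ} (hc : 0 < c)
    (h : N.LowerEllOne c) :
    N.LowerEllOneAt (fun m => 2 ^ (2 ^ m - 1) - 1) (c⁻¹ * (c⁻¹ * c⁻¹)) :=
  have hc' : 0 ≤ c⁻¹ := (inv_pos.2 hc).le
  .exp hc' (h.at_id hc) (.exp hc' (h.at_id hc) (h.at_id hc))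

/-- The number of patterns is eventually dominated by the number of sets allowed. -/
theorem exists_pattern_count_le (D : ℕ) : ∃ k₀ : ℕ, ∀ k, k₀ ≤ k →
    (2 * (D * k * 5 ^ k) + 1) ^ k ≤ 2 ^ (2 ^ k - 1) - 1 := by
  have h9 : ∀ k, 9 ≤ k → 6 * k ^ 2 + 2 ≤ 2 ^ k := by
    intro k hk
    induction k, hk using Nat.le_induction with
    | base => norm_num
    | succ k hk ih => rw [pow_succ 2 k]; nlinarith
  refine ⟨max 9 D, fun k hk => ?_⟩
  have h1 : 9 ≤ k := (le_max_left _ _).trans hk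
  have h2 : D ≤ k := (le_max_right _ _).trans hk
  have hk2 : k ≤ 2 ^ k := Nat.lt_two_pow_self.le
  have hb : 2 * (D * k * 5 ^ k) + 1 ≤ 2 ^ (6 * k) := by
    have h5 : (5 : ℕ) ^ k ≤ 2 ^ k * 2 ^ k * 2 ^ k := by
      rw [← mul_pow, ← mul_pow]; exact Nat.pow_le_pow_left (by norm_num) k
    have h3 : D * k * 5 ^ k ≤ 2 ^ k * 2 ^ k * (2 ^ k * 2 ^ k * 2 ^ k) := by
      gcongr
      exact h2.trans hk2
    have h4 : 3 ≤ 2 ^ k := by omega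
    have e : (2 : ℕ) ^ (6 * k) = 2 ^ k * (2 ^ k * 2 ^ k * (2 ^ k * 2 ^ k * 2 ^ k)) := by ring
    have h6 : 1 ≤ 2 ^ k * 2 ^ k * (2 ^ k * 2 ^ k * 2 ^ k) := Nat.one_le_iff_ne_zero.2 (by positivity)
    rw [e]
    nlinarith
  have h3 := h9 k h1
  calc (2 * (D * k * 5 ^ k) + 1) ^ k ≤ (2 ^ (6 * k)) ^ k := Nat.pow_le_pow_left hb k
    _ = 2 ^ (6 * k ^ 2) := by rw [← pow_mul]; ring_nf
    _ ≤ 2 ^ (2 ^ k - 2) := Nat.pow_le_pow_right (by norm_num) (by omega)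
    _ ≤ 2 ^ (2 ^ k - 1) - 1 := by
        have e : 2 ^ k - 1 = (2 ^ k - 2) + 1 := by omega
        rw [e, pow_succ]
        have : 1 ≤ 2 ^ (2 ^ k - 2) := Nat.one_le_two_pow
        omega

/-! ### Weights that are equivalent to the norm on a finite dimensional subspace -/

/-- Only the finitely many coordinates in the union of the `E i` matter, so the estimate on `c₀₀`
carries over to the completion. -/
theorem sum_norm_band_le {N : UncNorm} {f : ℕ → ℕ} {C : ℝ} (hC : 0 ≤ C)
    (h : N.LowerEllOneAt f C) {ι : Type} (s : Finset ι) (E : ι → Finset ℕ+) (m : ℕ)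
    (hd : (s : Set ι).PairwiseDisjoint E) (hs : s.card ≤ f m)
    (hm : ∀ i ∈ s, ∀ a ∈ E i, m ≤ (a : ℕ)) (z : C00Completion N) :
    ∑ i ∈ s, ‖band (C00Completion.basis_oneUnconditional N) (E i : Set ℕ+) z‖ ≤ C * ‖z‖ := by
  classical
  set hb := C00Completion.basis_oneUnconditional N
  obtain ⟨x, -, hx, hxz⟩ := exists_band_finset_eq_ofSeq hb (s.biUnion E) z
  have h1 : ∀ i ∈ s, ‖band hb (E i : Set ℕ+) z‖ = N.toFun (restr (E i) x) := by
    intro i hi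
    rw [← C00Completion.norm_ofSeq]
    congr 1
    refine basis_coord_ext (C00Completion.basis N) fun j => ?_
    rw [coord_band, coord_ofSeq, restr_apply]
    simp only [Finset.mem_coe]
    split_ifs with hj
    · exact (hx j (Finset.mem_biUnion.2 ⟨i, hi, hj⟩)).symm
    · rfl
  rw [Finset.sum_congr rfl h1]
  refine (h s E m hd hs hm x).trans ?_
  rw [← C00Completion.norm_ofSeq, ← hxz]
  exact mul_le_mul_of_nonneg_left (norm_band_le hb _ _) hC

section Weights

variable {X : Type*} [NormedAddCommGroup X] [NormedSpace ℝ X] [CompleteSpace X]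
  {b : UnconditionalSchauderBasis ℕ+ ℝ X} (hb : OneUnconditional b)

/-- A norming functional yields non-negative weights. -/
theorem exists_weights (c : Finset ℕ+) (u : X) : ∃ w : ℕ+ → ℝ, (∀ i, 0 ≤ w i) ∧
    (∀ z, ∑ i ∈ c, w i * |b.coord i z| ≤ ‖band hb (c : Set ℕ+) z‖) ∧
      ‖band hb (c : Set ℕ+) u‖ ≤ ∑ i ∈ c, w i * |b.coord i u| := by
  classical
  obtain ⟨g, hg, hgu⟩ := exists_dual_vector'' ℝ (band hb (c : Set ℕ+) u)
  refine ⟨fun i => |g (b.basis i)|, fun i => abs_nonneg _, fun z => ?_, ?_⟩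
  -- Adjusting signs turns the weighted sum into a value of `g`, and the unconditional norm does not
  -- increase.
  · set a : ℕ+ → ℝ := fun i => SignType.sign (g (b.basis i)) * |b.coord i z| with ha
    have h1 : ∑ i ∈ c, |g (b.basis i)| * |b.coord i z| = g (∑ i ∈ c, a i • b.basis i) := by
      rw [map_sum]
      refine Finset.sum_congr rfl fun i _ => ?_
      rw [map_smul, smul_eq_mul, ← sign_mul_self (g (b.basis i)), ha]
      ring
    rw [h1]
    refine (le_abs_self _).trans ((g.le_opNorm _).trans ?_)
    refine (mul_le_of_le_one_left (norm_nonneg _) hg).trans (hb _ _ fun i => ?_)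
    rw [basis_coord_sum b c a, coord_band]
    simp only [Finset.mem_coe]
    split_ifs
    · rw [ha, abs_mul, abs_abs]
      refine mul_le_of_le_one_left (abs_nonneg _) ?_
      rcases SignType.sign (g (b.basis i)) with _ | _ | _ <;> simp
    · simp
  · have h1 : ‖band hb (c : Set ℕ+) u‖ = g (band hb (c : Set ℕ+) u) := by rw [hgu]; rfl
    rw [h1, band_coe_finset, map_sum]
    refine Finset.sum_le_sum fun i _ => ?_
    rw [map_smul, smul_eq_mul, ← abs_mul, mul_comm]
    exact le_abs_self _

theorem OneUnconditional.exists_abs (hb : OneUnconditional b) (z : X) : ∃ y : X, (∀ i, b.coord i y = |b.coord i z|) ∧ ‖y‖ = ‖z‖ := by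
  obtain ⟨y, hy⟩ := hb.exists_of_le z (fun i => |b.coord i z|) fun i => (abs_abs _).le
  exact ⟨y, hy, hb.norm_eq fun i => by rw [hy, abs_abs]⟩

theorem band_eq_sum_of_maps_to {κ : Type*} [DecidableEq κ] (S₀ : Finset ℕ+) (S : Finset κ)
    (p : ℕ+ → κ) (hp : ∀ i ∈ S₀, p i ∈ S) (z : X) :
    band hb (S₀ : Set ℕ+) z = ∑ c ∈ S, band hb ((S₀.filter fun i => p i = c : Finset ℕ+) : Set ℕ+) z := by
  simp_rw [band_coe_finset]
  exact (Finset.sum_fiberwise_of_maps_to hp _).symm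

/-- The same factor in both inequalities allows the norm of `x²` on a cell to be passed to `e²`,
where the weights are norming, and then back to `x²`. -/
theorem sq_le_of_abs_sub_le {x t e η : ℝ} (h : |x - t * e| ≤ η * e) :
    x ^ 2 ≤ (2 * t ^ 2 + 2 * η ^ 2) * e ^ 2 ∧
      (2 * t ^ 2 + 2 * η ^ 2) * e ^ 2 ≤ 4 * x ^ 2 + 6 * η ^ 2 * e ^ 2 := by
  have h1 : (x - t * e) ^ 2 ≤ (η * e) ^ 2 := sq_le_sq' (by linarith [neg_abs_le (x - t * e)])
    ((le_abs_self _).trans h)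
  constructor
  · nlinarith [sq_nonneg (x - 2 * (t * e))]
  · nlinarith [sq_nonneg (2 * x - t * e)]

theorem abs_sub_floor_mul_le {x e : ℝ} {Q : ℕ} (hQ : 0 < Q) (hx : |x| ≤ e) :
    |x - (⌊Q * (x / e)⌋ : ℤ) / (Q : ℝ) * e| ≤ e / Q := by
  have hQ' : (0 : ℝ) < Q := Nat.cast_pos.2 hQ
  have he : 0 ≤ e := (abs_nonneg x).trans hx
  rcases he.eq_or_lt with h0 | h0
  · rw [← h0] at hx ⊢
    have : x = 0 := abs_nonpos_iff.1 hx
    simp [this]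
  · have h1 := Int.floor_le (Q * (x / e))
    have h2 := Int.lt_floor_add_one (Q * (x / e))
    set n : ℝ := ((⌊Q * (x / e)⌋ : ℤ) : ℝ)
    have e1 : x - n / Q * e = (Q * (x / e) - n) * (e / Q) := by field_simp
    rw [e1, abs_mul, abs_of_nonneg (sub_nonneg.2 h1), abs_of_pos (by positivity : 0 < e / (Q : ℝ))]
    exact mul_le_of_le_one_left (by positivity) (by linarith)

theorem floor_mem_Icc {x e : ℝ} (Q : ℕ) (hx : |x| ≤ e) :
    ⌊Q * (x / e)⌋ ∈ Finset.Icc (-(Q : ℤ)) Q := by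
  have he : 0 ≤ e := (abs_nonneg x).trans hx
  have h1 : |x / e| ≤ 1 := by
    rw [abs_div, abs_of_nonneg he]
    exact div_le_one_of_le₀ hx he
  obtain ⟨h2, h3⟩ := abs_le.1 h1
  have hQ' : (0 : ℝ) ≤ Q := Nat.cast_nonneg _
  rw [Finset.mem_Icc]
  constructor
  · rw [Int.le_floor]
    push_cast
    nlinarith
  · have : ((⌊Q * (x / e)⌋ : ℤ) : ℝ) ≤ (Q : ℤ) := (Int.floor_le _).trans (by push_cast; nlinarith)
    exact_mod_cast this

theorem Conv2.norm_eq_of_sq {x : Conv2 b hb} {z : X} (h : ∀ i, b.coord i z = x.seq i ^ 2) :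
    ‖x‖ ^ 2 = ‖z‖ := by
  rw [Conv2.norm_sq_eq]
  exact hb.norm_eq fun i => by rw [Conv2.coord_sq, h]

-- On a cell, where all rounded ratios `x j / e` agree, each `z ∈ F` is a fixed multiple of `e` up
-- to an error `η * e`. Thus weights norming `e²` on the cell almost norm `z²` there. The triangle
-- inequality over the cells gives the lower bound. The lower `ℓ₁` estimate `hcell`, available
-- because the cells are few and lie beyond `m`, keeps the sum of all weights bounded by `C * ‖z‖`.
variable {hb} in
theorem exists_weights_of_cells {F : Submodule ℝ (Conv2 b hb)} [FiniteDimensional ℝ F]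
    {k m Q : ℕ} {C : ℝ} (hC : 0 ≤ C) (hF : Module.finrank ℝ F = k) (hQ : 0 < Q)
    (hQC : 6 * C * (k * 5 ^ k / Q : ℝ) ^ 2 ≤ 1 / 8)
    (hvan : ∀ x ∈ F, ∀ i : ℕ+, (i : ℕ) ≤ m → x.seq i = 0)
    (hcell : ∀ (s : Finset (Fin k → ℤ)) (E : (Fin k → ℤ) → Finset ℕ+),
      (s : Set (Fin k → ℤ)).PairwiseDisjoint E → s.card ≤ (2 * Q + 1) ^ k →
      (∀ i ∈ s, ∀ a ∈ E i, m < (a : ℕ)) → ∀ z, ∑ i ∈ s, ‖band hb (E i : Set ℕ+) z‖ ≤ C * ‖z‖) :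
    ∃ (S₀ : Finset ℕ+) (w : ℕ+ → ℝ), (∀ i, 0 ≤ w i) ∧
      (∀ z, ∑ i ∈ S₀, w i * |b.coord i z| ≤ C * ‖z‖) ∧
        ∀ x ∈ F, ‖x‖ ^ 2 ≤ 32 * ∑ i ∈ S₀, w i * x.seq i ^ 2 := by
  classical
  set hB := Conv2.basis_oneUnconditional hb
  have hQ' : (0 : ℝ) < Q := Nat.cast_pos.2 hQ
  obtain ⟨x, hx1, hx⟩ := exists_spanning_bounded_coeff k F hF
  obtain ⟨R, hR⟩ : ∃ R, ∀ j, ‖(x j : Conv2 b hb) - trunc hB R (x j)‖ ≤ 1 / (2 * 5 ^ k) := by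
    have h1 : ∀ j, ∀ᶠ R in atTop, ‖(x j : Conv2 b hb) - trunc hB R (x j)‖ ≤ 1 / (2 * 5 ^ k) := by
      intro j
      have h2 := ((tendsto_trunc hB (x j : Conv2 b hb)).const_sub (x j : Conv2 b hb)).norm
      rw [sub_self, norm_zero] at h2
      exact (h2.eventually_lt_const (by positivity)).mono fun _ h => h.le
    exact (eventually_all.2 h1).exists
  choose y hy hyn using fun j => hB.exists_abs (x j : Conv2 b hb)
  set e : Conv2 b hb := ∑ j, y j with he
  have hes : ∀ i, e.seq i = ∑ j, |(x j : Conv2 b hb).seq i| := fun i => by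
    rw [← Conv2.coord_apply hb, he, map_sum]
    exact Finset.sum_congr rfl fun j _ => hy j i
  have hen : ‖e‖ ≤ k := by
    refine (norm_sum_le_of_le _ fun j _ => (hyn j).trans_le (hx1 j)).trans ?_
    simp
  have hxe : ∀ j i, |(x j : Conv2 b hb).seq i| ≤ e.seq i := fun j i => by
    rw [hes]
    exact Finset.single_le_sum (f := fun j => |(x j : Conv2 b hb).seq i|)
      (fun _ _ => abs_nonneg _) (Finset.mem_univ j)
  -- Where `e` vanishes so do all `x j`, and the value 0 of the quotient gives the zero pattern.
  set p : ℕ+ → Fin k → ℤ := fun i j => ⌊Q * ((x j : Conv2 b hb).seq i / e.seq i)⌋ with hp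
  set S : Finset (Fin k → ℤ) := Fintype.piFinset fun _ => Finset.Icc (-(Q : ℤ)) Q with hS
  have hScard : S.card ≤ (2 * Q + 1) ^ k := by
    rw [hS, Fintype.card_piFinset, Finset.prod_const, Finset.card_univ, Fintype.card_fin,
      Int.card_Icc]
    refine Nat.pow_le_pow_left ?_ k
    omega
  have hpS : ∀ i, p i ∈ S := fun i => Fintype.mem_piFinset.2 fun j => floor_mem_Icc Q (hxe j i)
  set S₀ : Finset ℕ+ := firstCoords R \ firstCoords m with hS₀
  have hmS₀ : ∀ i, i ∈ S₀ ↔ (i : ℕ) ≤ R ∧ m < (i : ℕ) := fun i => by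
    rw [hS₀, Finset.mem_sdiff, mem_firstCoords, mem_firstCoords, not_le]
  set E : (Fin k → ℤ) → Finset ℕ+ := fun c => S₀.filter fun i => p i = c with hE
  choose w hw0 hw1 hw2 using fun c => exists_weights hb (E c) e.sq
  have hfib : ∀ g : ℕ+ → ℝ, ∑ i ∈ S₀, w (p i) i * g i = ∑ c ∈ S, ∑ i ∈ E c, w c i * g i := by
    intro g
    rw [← Finset.sum_fiberwise_of_maps_to (fun i _ => hpS i)]
    refine Finset.sum_congr rfl fun c _ => Finset.sum_congr rfl fun i hi => ?_
    rw [(Finset.mem_filter.1 hi).2]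
  have hup : ∀ z, ∑ i ∈ S₀, w (p i) i * |b.coord i z| ≤ C * ‖z‖ := by
    intro z
    rw [hfib]
    refine (Finset.sum_le_sum fun c _ => hw1 c z).trans (hcell S E ?_ hScard ?_ z)
    · intro c _ c' _ hcc
      refine Finset.disjoint_left.2 fun i hi hi' => hcc ?_
      rw [← (Finset.mem_filter.1 hi).2, ← (Finset.mem_filter.1 hi').2]
    · exact fun c _ a ha => ((hmS₀ a).1 (Finset.mem_filter.1 ha).1).2
  refine ⟨S₀, fun i => w (p i) i, fun i => hw0 _ _, hup, fun z hz => ?_⟩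
  obtain ⟨a, ha, hab⟩ := hx ⟨z, hz⟩
  have hza : z = ∑ j, a j • (x j : Conv2 b hb) := by
    have := congrArg Subtype.val ha
    simpa only [Submodule.coe_sum, Submodule.coe_smul] using this
  have hab' : ∑ j, |a j| ≤ 5 ^ k * ‖z‖ := hab
  have hzs : ∀ i, z.seq i = ∑ j, a j * (x j : Conv2 b hb).seq i := fun i => by
    conv_lhs => rw [hza]
    rw [← Conv2.coord_apply hb, map_sum]
    rfl
  set η : ℝ := 5 ^ k * ‖z‖ / Q with hη
  have hτ : ∀ c, ∀ i ∈ E c, |z.seq i - (∑ j, a j * ((c j : ℝ) / Q)) * e.seq i| ≤ η * e.seq i := by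
    intro c i hi
    have hc : ∀ j, |(x j : Conv2 b hb).seq i - (c j : ℝ) / Q * e.seq i| ≤ e.seq i / Q := by
      intro j
      have := abs_sub_floor_mul_le hQ (hxe j i)
      rwa [← (Finset.mem_filter.1 hi).2]
    have hei : 0 ≤ e.seq i := by rw [hes]; positivity
    rw [hzs, Finset.sum_mul, ← Finset.sum_sub_distrib]
    refine (Finset.abs_sum_le_sum_abs _ _).trans ?_
    calc _ ≤ ∑ j, |a j| * (e.seq i / Q) := Finset.sum_le_sum fun j _ => by
          rw [mul_assoc, ← mul_sub, abs_mul]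
          exact mul_le_mul_of_nonneg_left (hc j) (abs_nonneg _)
      _ ≤ 5 ^ k * ‖z‖ * (e.seq i / Q) := by
          rw [← Finset.sum_mul]
          gcongr
      _ = _ := by rw [hη]; ring
  have hcellb : ∀ c, ‖band hb (E c : Set ℕ+) z.sq‖
      ≤ ∑ i ∈ E c, w c i * (4 * z.seq i ^ 2 + 6 * η ^ 2 * e.seq i ^ 2) := by
    intro c
    set t : ℝ := ∑ j, a j * ((c j : ℝ) / Q) with ht
    calc ‖band hb (E c : Set ℕ+) z.sq‖
        ≤ ‖(2 * t ^ 2 + 2 * η ^ 2) • band hb (E c : Set ℕ+) e.sq‖ := by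
          refine hb _ _ fun i => ?_
          rw [map_smul, coord_band, coord_band, Conv2.coord_sq, Conv2.coord_sq]
          simp only [Finset.mem_coe]
          split_ifs with hi
          · rw [abs_of_nonneg (sq_nonneg _), smul_eq_mul, abs_of_nonneg (by positivity)]
            exact (sq_le_of_abs_sub_le (hτ c i hi)).1
          · simp
      _ = (2 * t ^ 2 + 2 * η ^ 2) * ‖band hb (E c : Set ℕ+) e.sq‖ := by
          rw [norm_smul, Real.norm_of_nonneg (by positivity)]
      _ ≤ (2 * t ^ 2 + 2 * η ^ 2) * ∑ i ∈ E c, w c i * |b.coord i e.sq| := by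
          gcongr
          exact hw2 c
      _ ≤ _ := by
          rw [Finset.mul_sum]
          refine Finset.sum_le_sum fun i hi => ?_
          rw [Conv2.coord_sq, abs_of_nonneg (sq_nonneg _), mul_left_comm]
          exact mul_le_mul_of_nonneg_left (sq_le_of_abs_sub_le (hτ c i hi)).2 (hw0 c i)
  have htr : ‖z‖ ≤ 2 * ‖trunc hB R z‖ := by
    have h1 : z - trunc hB R z = ∑ j, a j • ((x j : Conv2 b hb) - trunc hB R (x j)) := by
      conv_lhs => rw [hza]
      rw [map_sum, ← Finset.sum_sub_distrib]
      refine Finset.sum_congr rfl fun j _ => ?_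
      rw [map_smul, smul_sub]
    have h2 : ‖z - trunc hB R z‖ ≤ ∑ j, |a j| * (1 / (2 * 5 ^ k)) := by
      rw [h1]
      refine norm_sum_le_of_le _ fun j _ => ?_
      rw [norm_smul, Real.norm_eq_abs]
      exact mul_le_mul_of_nonneg_left (hR j) (abs_nonneg _)
    have h3 : ‖z - trunc hB R z‖ ≤ ‖z‖ / 2 := by
      rw [← Finset.sum_mul] at h2
      refine h2.trans ?_
      calc _ ≤ 5 ^ k * ‖z‖ * (1 / (2 * 5 ^ k)) := by gcongr
        _ = ‖z‖ / 2 := by field_simp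
    have h4 := norm_sub_norm_le z (trunc hB R z)
    linarith
  have htr2 : ‖trunc hB R z‖ ^ 2 = ‖band hb (S₀ : Set ℕ+) z.sq‖ := by
    refine Conv2.norm_eq_of_sq hb fun i => ?_
    have h1 : (trunc hB R z).seq i = if (i : ℕ) ≤ R then z.seq i else 0 := coord_trunc hB R z i
    rw [coord_band, Conv2.coord_sq, h1]
    simp only [Finset.mem_coe, hmS₀]
    by_cases hi : (i : ℕ) ≤ R
    · by_cases hi' : m < (i : ℕ)
      · simp [hi, hi']
      · simp [hi', hvan z hz i (not_lt.1 hi')]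
    · simp [hi]
  have hsum : ‖band hb (S₀ : Set ℕ+) z.sq‖
      ≤ 4 * ∑ i ∈ S₀, w (p i) i * z.seq i ^ 2 + 6 * η ^ 2 * (C * k ^ 2) := by
    rw [band_eq_sum_of_maps_to hb S₀ S p (fun i _ => hpS i)]
    refine (norm_sum_le _ _).trans ((Finset.sum_le_sum fun c _ => hcellb c).trans ?_)
    rw [← hfib fun i => 4 * z.seq i ^ 2 + 6 * η ^ 2 * e.seq i ^ 2]
    have h1 := hup e.sq
    rw [← Conv2.norm_sq_eq] at h1
    have h2 : C * ‖e‖ ^ 2 ≤ C * k ^ 2 := by gcongr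
    have h3 : ∑ i ∈ S₀, w (p i) i * |b.coord i e.sq| = ∑ i ∈ S₀, w (p i) i * e.seq i ^ 2 :=
      Finset.sum_congr rfl fun i _ => by rw [Conv2.coord_sq, abs_of_nonneg (sq_nonneg _)]
    rw [h3] at h1
    have h4 : ∑ i ∈ S₀, w (p i) i * (4 * z.seq i ^ 2 + 6 * η ^ 2 * e.seq i ^ 2)
        = 4 * ∑ i ∈ S₀, w (p i) i * z.seq i ^ 2 + 6 * η ^ 2 * ∑ i ∈ S₀, w (p i) i * e.seq i ^ 2 := by
      rw [Finset.mul_sum, Finset.mul_sum, ← Finset.sum_add_distrib]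
      exact Finset.sum_congr rfl fun i _ => by ring
    rw [h4]
    have h5 : 0 ≤ 6 * η ^ 2 := by positivity
    have := mul_le_mul_of_nonneg_left (h1.trans h2) h5
    linarith
  have hηC : 6 * η ^ 2 * (C * k ^ 2) ≤ ‖z‖ ^ 2 / 8 := by
    have h1 : 6 * η ^ 2 * (C * k ^ 2) = 6 * C * (k * 5 ^ k / Q : ℝ) ^ 2 * ‖z‖ ^ 2 := by
      rw [hη]; ring
    rw [h1]
    have := mul_le_mul_of_nonneg_right hQC (sq_nonneg ‖z‖)
    linarith
  have h6 : ‖z‖ ^ 2 ≤ 4 * ‖trunc hB R z‖ ^ 2 := by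
    have := pow_le_pow_left₀ (norm_nonneg z) htr 2
    linarith [mul_pow (2 : ℝ) ‖trunc hB R z‖ 2]
  -- Altogether `‖z‖² ≤ 16 * Σ + ‖z‖² / 2`, with `Σ` the weighted sum of squares; absorbing the last
  -- term gives 32.
  rw [htr2] at h6
  linarith

end Weights

/-! ### Weak Hilbert 2-convexifications -/

theorem Submodule.exists_le_finrank_eq_of_functionals {Y : Type*} [AddCommGroup Y] [Module ℝ Y]
    (E : Submodule ℝ Y) [FiniteDimensional ℝ E] {m k : ℕ} (f : Fin m → Y →ₗ[ℝ] ℝ)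
    (hk : k + m ≤ Module.finrank ℝ E) :
    ∃ F ≤ E, Module.finrank ℝ F = k ∧ ∀ x ∈ F, ∀ j, f j x = 0 := by
  set φ : E →ₗ[ℝ] (Fin m → ℝ) := (LinearMap.pi f).domRestrict E with hφ
  have h1 := LinearMap.finrank_range_add_finrank_ker φ
  have h2 : Module.finrank ℝ (LinearMap.range φ) ≤ m := by
    simpa using Submodule.finrank_le (LinearMap.range φ)
  have h3 := Submodule.finrank_map_subtype_eq E (LinearMap.ker φ)
  obtain ⟨F, hF, hFk⟩ := Submodule.exists_le_finrank_eq ((LinearMap.ker φ).map E.subtype)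
    (k := k) (by omega)
  refine ⟨F, hF.trans (Submodule.map_subtype_le _ _), hFk, fun x hx j => ?_⟩
  obtain ⟨y, hy, rfl⟩ := hF hx
  exact congrFun (LinearMap.mem_ker.1 hy) j

/-- A line is Euclidean and is complemented by a norming functional. This settles the subspaces of
small dimension. -/
theorem exists_norm_one_projection {Y : Type*} [NormedAddCommGroup Y]
    [NormedSpace ℝ Y] (E : Submodule ℝ Y) [FiniteDimensional ℝ E] :
    ∃ F ≤ E, ∃ P : Y →L[ℝ] F, (∀ x : F, P x = x) ∧
      min 1 (Module.finrank ℝ E) ≤ Module.finrank ℝ F ∧ euclideanDist F ≤ 1 ∧ ‖P‖ ≤ 1 := by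
  obtain ⟨F, hFE, hF⟩ := Submodule.exists_le_finrank_eq E
    (min_le_right 1 (Module.finrank ℝ E))
  have : FiniteDimensional ℝ F := Submodule.finiteDimensional_of_le hFE
  obtain ⟨x, hx⟩ : ∃ x : F, ∀ y : F, ∃ t : ℝ, t • x = y :=
    finrank_le_one_iff.1 (hF.trans_le (min_le_left _ _))
  obtain ⟨g, hg, hgx⟩ := exists_dual_vector'' ℝ (x : Y)
  obtain ⟨P, hP, hd, hn⟩ := exists_projection_of_hilbert_estimate g F (A := 1) (B := 1) zero_le_one
    (fun y => (g.le_opNorm y).trans (by gcongr)) (fun y hy => by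
      obtain ⟨t, ht⟩ := hx ⟨y, hy⟩
      have ht' : t • (x : Y) = y := congrArg Subtype.val ht
      rw [← ht', map_smul, norm_smul, norm_smul, hgx, one_mul]
      simp) zero_le_one
  rw [mul_one] at hd hn
  exact ⟨F, hFE, P, hP, hF.ge, hd, hn⟩

section

variable {X : Type*} [NormedAddCommGroup X] [NormedSpace ℝ X] [CompleteSpace X]
  {b : UnconditionalSchauderBasis ℕ+ ℝ X} (hb : OneUnconditional b)

/-- Scaling the coordinates by `√(w i)` turns the weighted `ℓ₁` bound on `X` into a bounded map from
`X^(2)` to a Hilbert space. -/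
theorem exists_weighted_map (S : Finset ℕ+) (w : ℕ+ → ℝ) (hw : ∀ i, 0 ≤ w i) {C : ℝ}
    (h : ∀ z, ∑ i ∈ S, w i * |b.coord i z| ≤ C * ‖z‖) :
    ∃ T : Conv2 b hb →L[ℝ] EuclideanSpace ℝ S, (∀ x, ‖T x‖ ^ 2 = ∑ i ∈ S, w i * x.seq i ^ 2) ∧
      ∀ x, ‖T x‖ ≤ √C * ‖x‖ := by
  set T : Conv2 b hb →ₗ[ℝ] EuclideanSpace ℝ S :=
    { toFun := fun x => WithLp.toLp 2 fun i : S => √(w i) * x.seq i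
      map_add' := fun x y => by
        ext i
        show √(w i) * (x + y).seq i = √(w i) * x.seq i + √(w i) * y.seq i
        rw [Conv2.seq_add, mul_add]
      map_smul' := fun c x => by
        ext i
        show √(w i) * (c • x).seq i = c * (√(w i) * x.seq i)
        rw [Conv2.seq_smul, mul_left_comm] } with hT
  have h1 : ∀ x, ‖T x‖ ^ 2 = ∑ i ∈ S, w i * x.seq i ^ 2 := by
    intro x
    rw [EuclideanSpace.real_norm_sq_eq, ← Finset.sum_coe_sort S]
    refine Finset.sum_congr rfl fun i _ => ?_
    show (√(w i) * x.seq i) ^ 2 = _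
    rw [mul_pow, Real.sq_sqrt (hw _)]
  have h2 : ∀ x, ‖T x‖ ≤ √C * ‖x‖ := by
    intro x
    have h3 : ‖T x‖ ^ 2 ≤ C * ‖x‖ ^ 2 := by
      rw [h1, Conv2.norm_sq_eq]
      refine le_trans (le_of_eq (Finset.sum_congr rfl fun i _ => ?_)) (h x.sq)
      rw [Conv2.coord_sq, abs_of_nonneg (sq_nonneg _)]
    rw [← Real.sqrt_sq (norm_nonneg (T x)), ← Real.sqrt_sq (norm_nonneg x),
      ← Real.sqrt_mul' _ (sq_nonneg _)]
    exact Real.sqrt_le_sqrt h3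
  exact ⟨T.mkContinuous _ h2, h1, h2⟩

end

/-- If the norm satisfies a lower `ℓ₁` estimate on `S_1`-allowable families, then the
2-convexification is a weak Hilbert space. -/
theorem isWeakHilbert_convexified {N : UncNorm} {c : ℝ} (hc : 0 < c) (h : N.LowerEllOne c) :
    IsWeakHilbert (Convexified N) := by
  set hb := C00Completion.basis_oneUnconditional N
  set C : ℝ := c⁻¹ * (c⁻¹ * c⁻¹) with hC
  have hC0 : 0 < C := by positivity
  -- With `Q = D * k * 5 ^ k` the rounding condition becomes `6 * C / D² ≤ 1 / 8`, that is `D² ≥ 48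
  -- * C`.
  obtain ⟨D, hD⟩ := exists_nat_ge (48 * C + 1)
  have hD1 : (1 : ℝ) ≤ D := by linarith
  obtain ⟨k₀, hk₀⟩ := exists_pattern_count_le D
  refine ⟨1 / (2 * (k₀ + 1)), by positivity, max 1 (√C * √32), le_max_left _ _,
    fun E hE => ?_⟩
  set n := Module.finrank ℝ E with hn
  rcases lt_or_ge n (2 * (k₀ + 1)) with hlt | hge
  · obtain ⟨F, hFE, P, hP, hF, hd, hPn⟩ := exists_norm_one_projection E
    refine ⟨F, hFE, P, hP, ?_, hd.trans (le_max_left _ _), hPn.trans (le_max_left _ _)⟩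
    rw [one_div, inv_mul_le_iff₀ (by positivity)]
    have h1 : (n : ℝ) ≤ 2 * (k₀ + 1) := by exact_mod_cast hlt.le
    rcases Nat.eq_zero_or_pos n with h0 | h0
    · rw [h0, Nat.cast_zero]; positivity
    · rw [← hn, min_eq_left h0] at hF
      have h2 : (1 : ℝ) ≤ Module.finrank ℝ F := by exact_mod_cast hF
      nlinarith
  -- Half of the dimension is spent on making the first `m` coordinates vanish, and `k ≤ m + 1`.
  · set m := n / 2 with hm
    set k := n - m with hk
    have hkk : k₀ ≤ k := by omega
    have hk1 : 1 ≤ k := by omega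
    obtain ⟨F, hFE, hFk, hFv⟩ := Submodule.exists_le_finrank_eq_of_functionals E (m := m) (k := k)
      (fun j => ((Conv2.coord hb (Nat.succPNat j) : Convexified N →L[ℝ] ℝ) :
        Convexified N →ₗ[ℝ] ℝ)) (by omega)
    have : FiniteDimensional ℝ F := Submodule.finiteDimensional_of_le hFE
    have hQ : 0 < D * k * 5 ^ k := by
      have : 0 < D := by exact_mod_cast (zero_lt_one.trans_le hD1)
      positivity
    obtain ⟨S, w, hw0, hw1, hw2⟩ := exists_weights_of_cells (F := F) (m := m) hC0.le hFk hQ (by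
      have hk' : (0 : ℝ) < k := by exact_mod_cast hk1
      have e : ((k : ℝ) * 5 ^ k / ((D * k * 5 ^ k : ℕ) : ℝ)) = 1 / D := by
        push_cast
        field_simp
      rw [e, one_div, inv_pow, ← div_eq_mul_inv, div_le_div_iff₀ (by positivity) (by norm_num)]
      nlinarith) (fun x hx i hi => by
        have h1 := hFv x hx ⟨i.natPred, by
          have := PNat.natPred_add_one i
          omega⟩
        have h2 : Nat.succPNat i.natPred = i := PNat.succPNat_natPred i
        simp only [h2] at h1
        exact h1) (fun s P hd hs hP z => by
        -- Elements beyond `m` are at least `m + 1 ≥ k`, so the doubly exponential estimate may be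
        -- used at `k`, where it covers all patterns.
        refine sum_norm_band_le hC0.le (h.at_exp_exp hc) s P k hd (hs.trans (hk₀ k hkk))
          (fun i hi a ha => ?_) z
        have := hP i hi a ha
        omega)
    obtain ⟨T, hT, hT'⟩ := exists_weighted_map hb S w hw0 hw1
    obtain ⟨P, hP, hd, hn'⟩ := exists_projection_of_hilbert_estimate T F (B := √32)
      (Real.sqrt_nonneg _) hT' (fun x hx => by
        have h1 := hw2 x hx
        rw [← hT] at h1
        rw [← Real.sqrt_sq (norm_nonneg x), ← Real.sqrt_sq (norm_nonneg (T x)),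
          ← Real.sqrt_mul' _ (sq_nonneg _)]
        exact Real.sqrt_le_sqrt h1) (Real.sqrt_nonneg _)
    refine ⟨F, hFE, P, hP, ?_, hd.trans (le_max_right _ _), hn'.trans (le_max_right _ _)⟩
    rw [hFk, one_div, inv_mul_le_iff₀ (by positivity)]
    have h1 : (n : ℝ) ≤ 2 * k := by
      have : n ≤ 2 * k := by omega
      exact_mod_cast this
    have h2 : (0 : ℝ) ≤ k₀ * k := by positivity
    nlinarith

/-! ### Saturation by `ℓ₂` -/

/-- Finitely many coordinate functionals cannot be jointly injective on an infinite dimensional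
subspace. -/
theorem exists_unit_mem_trunc_eq_zero {X : Type*} [NormedAddCommGroup X] [NormedSpace ℝ X]
    [CompleteSpace X] {b : UnconditionalSchauderBasis ℕ+ ℝ X} (hb : OneUnconditional b)
    {Z : Submodule ℝ X} (hZ : ¬ FiniteDimensional ℝ Z) (n : ℕ) :
    ∃ z ∈ Z, ‖z‖ = 1 ∧ trunc hb n z = 0 := by
  classical
  set φ : Z →ₗ[ℝ] (firstCoords n → ℝ) :=
    (LinearMap.pi fun i : firstCoords n => ((b.coord i : X →L[ℝ] ℝ) : X →ₗ[ℝ] ℝ)).domRestrict Z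
  obtain ⟨z, hz, hz0⟩ : ∃ z, φ z = 0 ∧ z ≠ 0 := by
    by_contra! hcon
    exact hZ (FiniteDimensional.of_injective φ
      (LinearMap.ker_eq_bot.1 (LinearMap.ker_eq_bot'.2 hcon)))
  have hzn : ‖(z : X)‖ ≠ 0 := fun h => hz0 (Subtype.ext (norm_eq_zero.1 h))
  refine ⟨‖(z : X)‖⁻¹ • (z : X), Z.smul_mem _ z.2, ?_, ?_⟩
  · rw [norm_smul, norm_inv, norm_norm, inv_mul_cancel₀ hzn]
  · rw [map_smul, trunc, band_coe_finset, Finset.sum_eq_zero, smul_zero]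
    intro i hi
    have h1 : b.coord i (z : X) = 0 := congrFun hz ⟨i, hi⟩
    rw [h1, zero_smul]

theorem sum_geometric_half_le {s : Finset ℕ} {k : ℕ} (h : ∀ j ∈ s, k ≤ j) :
    ∑ j ∈ s, (1 / 2 : ℝ) ^ j ≤ 2 * (1 / 2) ^ k := by
  have h1 : s ⊆ Finset.Ico k (k + (s.sup id + 1)) := fun j hj => by
    have := Finset.le_sup (f := id) hj
    rw [id_eq] at this
    rw [Finset.mem_Ico]
    exact ⟨h j hj, by omega⟩
  refine (Finset.sum_le_sum_of_subset_of_nonneg h1 fun _ _ _ => by positivity).trans ?_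
  rw [Finset.sum_Ico_eq_sum_range, add_tsub_cancel_left]
  simp_rw [pow_add]
  rw [← Finset.mul_sum, mul_comm]
  exact mul_le_mul_of_nonneg_right (sum_geometric_two_le _) (by positivity)

/-- The cones spanned by the tails of a sequence of non-zero squares of blocks. -/
theorem IsBlockSeq.blockCones_sqr {w : ℕ → ℕ+ →₀ ℝ} {ρ : ℕ → ℕ} (hw : IsBlockSeq w ρ)
    (h0 : ∀ k, w k ≠ 0) :
    BlockCones fun n => Finsupp.linearCombination ℝ (fun k => (w k).sqr) ''
      {a : ℕ →₀ ℝ | (∀ k, 0 ≤ a k) ∧ ∀ k, a k ≠ 0 → n ≤ k} where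
  add := by
    rintro n _ _ ⟨a, ⟨ha, ha'⟩, rfl⟩ ⟨c, ⟨hc, hc'⟩, rfl⟩
    refine ⟨a + c, ⟨fun k => add_nonneg (ha k) (hc k), fun k hk => ?_⟩, map_add _ _ _⟩
    by_contra hn
    have h1 : a k = 0 := by by_contra h; exact hn (ha' k h)
    have h2 : c k = 0 := by by_contra h; exact hn (hc' k h)
    exact hk (by simp [h1, h2])
  smul := by
    rintro n _ t ht ⟨a, ⟨ha, ha'⟩, rfl⟩
    refine ⟨t • a, ⟨fun k => mul_nonneg ht.le (ha k), fun k hk => ha' k fun h => hk ?_⟩,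
      map_smul _ _ _⟩
    simp [h]
  anti m n hmn := image_mono fun a ⟨ha, ha'⟩ => ⟨ha, fun k hk => hmn.trans (ha' k hk)⟩
  supp := by
    rintro n _ ⟨a, ⟨-, ha⟩, rfl⟩ i hi
    by_contra! hle
    refine Finsupp.mem_support_iff.1 hi ?_
    rw [Finsupp.linearCombination_apply, Finsupp.sum, Finsupp.finsetSum_apply]
    refine Finset.sum_eq_zero fun k hk => ?_
    have h1 := ha k (Finsupp.mem_support_iff.1 hk)
    have h2 : w k i = 0 := by
      by_contra hne
      have h3 := (hw.2 k i (Finsupp.mem_support_iff.2 hne)).1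
      have h4 := hw.1.le_apply (x := k)
      omega
    show a k * w k i ^ 2 = 0
    rw [h2]; simp
  nonneg := by
    rintro n _ ⟨a, ⟨ha, -⟩, rfl⟩ i
    rw [Finsupp.linearCombination_apply, Finsupp.sum, Finsupp.finsetSum_apply]
    exact Finset.sum_nonneg fun k _ => mul_nonneg (ha k) (sq_nonneg _)
  exists_ne n := by
    refine ⟨_, ⟨Finsupp.single n 1, ⟨fun k => ?_, fun k hk => ?_⟩, rfl⟩, ?_⟩
    · rw [Finsupp.single_apply]
      split_ifs <;> simp
    · by_contra hlt
      exact hk (Finsupp.single_eq_of_ne (by omega))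
    · rw [Finsupp.linearCombination_single, one_smul]
      obtain ⟨i, hi⟩ := Finsupp.ne_iff.1 (h0 n)
      exact Finsupp.ne_iff.2 ⟨i, pow_ne_zero 2 hi⟩

/-- If all block cones contain blocks equivalent to the unit vector basis of `ℓ₁`, then the
2-convexification is saturated by `ℓ₂`. -/
theorem isSaturated_convexified {N : UncNorm}
    (H : ∀ 𝒞, BlockCones 𝒞 → ∃ (y : ℕ → ℕ+ →₀ ℝ) (ρ : ℕ → ℕ), StrictMono ρ ∧
      (∀ k, y k ∈ 𝒞 (ρ k) ∧ N.toFun (y k) = 1 ∧ ∀ a ∈ (y k).support, (a : ℕ) ≤ ρ (k + 1)) ∧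
      ∀ (F : Finset ℕ) (a : ℕ → ℝ), (∀ i, 0 ≤ a i) →
        (∑ i ∈ F, a i) / 2 ≤ N.toFun (∑ i ∈ F, a i • y i)) :
    IsSaturated (Convexified N) Ell2 := by
  set hb := C00Completion.basis_oneUnconditional N
  set hB := Conv2.basis_oneUnconditional hb
  intro Z hZc hZ
  -- With the constant `1 / 32` the blocks keep norm at least `1 / 2`, which forces coefficients
  -- `√(a k j) ≤ 2` below. The total error is then at most `2 * (1 / 32) * 2 * (1 / 2) ^ k`, within
  -- the margin `δ / 4 * (1 / 2) ^ k` for `δ = √(1 / 2) ≥ 1 / 2`.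
  obtain ⟨φ, ρ, z, w, -, hρ, hzw⟩ := exists_blocks_near hB
    (P := fun _ z => z ∈ Z ∧ ‖z‖ = 1) (c := 1 / 32) (by norm_num) (by
      intro n ρ η hη
      obtain ⟨z, hz, hz1, hz0⟩ := exists_unit_mem_trunc_eq_zero hB hZ ρ
      exact ⟨n + 1, z, n.lt_succ_self, ⟨hz, hz1⟩, by rw [hz0, norm_zero]; exact hη.le⟩)
  have hwb : IsBlockSeq w ρ := ⟨hρ, fun k => (hzw k).2.2⟩
  have hwn : ∀ k, 1 / 4 ≤ N.toFun (w k).sqr := by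
    intro k
    rw [← C00Completion.norm_ofSeq, ← Conv2.norm_ofSeq_sq hb]
    have h1 := (hzw k).2.1
    have h2 := norm_sub_norm_le (z k) (ofSeq (Conv2.basis hb) (w k))
    have h3 : (1 / 2 : ℝ) ^ k ≤ 1 := pow_le_one₀ (by norm_num) (by norm_num)
    rw [(hzw k).1.2] at h2
    have h4 : 1 / 2 ≤ ‖ofSeq (Conv2.basis hb) (w k)‖ := by linarith
    nlinarith
  have hw0 : ∀ k, w k ≠ 0 := fun k h => by
    have h1 := hwn k
    have h2 : (w k).sqr = 0 := by
      rw [h]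
      exact Finsupp.mapRange_zero
    rw [h2, N.zero] at h1
    norm_num at h1
  obtain ⟨y, σ, hσ, hy, hlow⟩ := H _ (hwb.blockCones_sqr hw0)
  have hyσ := fun k => (hwb.blockCones_sqr hw0).supp _ _ (hy k).1
  choose a ha hay using fun k => (hy k).1
  -- The `w j` are disjoint, so `u k` squares to `y k`; replacing each `w j` by `z j` gives a nearby
  -- vector that lies in `Z`.
  set u : ℕ → ℕ+ →₀ ℝ := fun k => ∑ j ∈ (a k).support, √(a k j) • w j with hu
  have huy : ∀ k, (u k).sqr = y k := by
    intro k
    ext i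
    rw [hu, hwb.sqr_sum_apply, ← hay k, Finsupp.linearCombination_apply, Finsupp.sum,
      Finsupp.finsetSum_apply]
    refine Finset.sum_congr rfl fun j _ => ?_
    rw [Real.sq_sqrt ((ha k).1 j)]
    rfl
  have hub : IsBlockSeq u σ := by
    refine ⟨hσ, fun k i hi => ?_⟩
    have h1 : i ∈ (y k).support := by
      rw [Finsupp.mem_support_iff, ← huy k]
      exact pow_ne_zero 2 (Finsupp.mem_support_iff.1 hi)
    exact ⟨hyσ k i h1, (hy k).2.2 i h1⟩
  have hlp := isLpSeq_two_of_sqr hb hub (δ := 1 / 2) (C := 1) (by norm_num) (by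
    intro F c hc
    simp_rw [huy]
    rw [C00Completion.norm_ofSeq, one_mul]
    refine ⟨by linarith [hlow F c hc], (N.sum_le F _).trans (Finset.sum_le_sum fun k _ => ?_)⟩
    rw [N.smul_eq, (hy k).2.1, mul_one, abs_of_nonneg (hc k)])
  have hak : ∀ k j, √(a k j) ≤ 2 := by
    intro k j
    have h1 : a k j * N.toFun (w j).sqr ≤ 1 := by
      rw [← (hy k).2.1, ← abs_of_nonneg ((ha k).1 j), ← N.smul_eq]
      refine N.mono _ _ fun i => ?_
      rw [← hay k, Finsupp.linearCombination_apply, Finsupp.sum, Finsupp.finsetSum_apply]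
      have hnn : ∀ l, 0 ≤ (a k l • (w l).sqr) i := fun l => mul_nonneg ((ha k).1 l) (sq_nonneg _)
      rw [abs_of_nonneg (hnn j),
        abs_of_nonneg (Finset.sum_nonneg fun l _ => hnn l)]
      by_cases hj : j ∈ (a k).support
      · exact Finset.single_le_sum (f := fun l => (a k l • (w l).sqr) i) (fun l _ => hnn l) hj
      · rw [Finsupp.notMem_support_iff.1 hj, zero_smul]
        exact Finset.sum_nonneg fun l _ => hnn l
    rw [Real.sqrt_le_left (by norm_num)]
    nlinarith [hwn j, (ha k).1 j]
  set δ : ℝ := √(1 / 2) with hδ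
  have hδ1 : 1 / 2 ≤ δ := Real.le_sqrt_of_sq_le (by norm_num)
  have hpert : ∀ k, ‖ofSeq (Conv2.basis hb) (u k) - ∑ j ∈ (a k).support, √(a k j) • z j‖
      ≤ δ / 4 * (1 / 2) ^ k := by
    intro k
    rw [hu, ← sum_smul_ofSeq, ← Finset.sum_sub_distrib]
    calc _ ≤ ∑ j ∈ (a k).support, 2 * (1 / 32) * (1 / 2 : ℝ) ^ j := by
          refine norm_sum_le_of_le _ fun j _ => ?_
          rw [← smul_sub, norm_smul, Real.norm_of_nonneg (Real.sqrt_nonneg _), norm_sub_rev,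
            mul_assoc]
          exact mul_le_mul (hak k j) (hzw j).2.1 (norm_nonneg _) zero_le_two
      _ ≤ 2 * (1 / 32) * (2 * (1 / 2) ^ k) := by
          rw [← Finset.mul_sum]
          refine mul_le_mul_of_nonneg_left (sum_geometric_half_le fun j hj => ?_) (by norm_num)
          exact (hσ.le_apply).trans ((ha k).2 j (Finsupp.mem_support_iff.1 hj))
      _ ≤ _ := by
          have : (0 : ℝ) < (1 / 2) ^ k := by positivity
          nlinarith
  exact (hlp.perturb (by positivity) hpert).exists_submodule ENNReal.ofNat_ne_top (by positivity)
    hZc fun k => Z.sum_mem fun j _ => Z.smul_mem _ (hzw j).1.1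

/-! ### Spaces that are not isomorphic to `ℓ₂` -/

/-- By the parallelogram law, one of the two signs for a new vector makes the squared norm grow by
at least the square of its norm. -/
theorem exists_signs_sum_norm_sq_le {H : Type*} [NormedAddCommGroup H] [InnerProductSpace ℝ H]
    {ι : Type*} (F : Finset ι) (v : ι → H) : ∃ ε : ι → ℝ, (∀ i, |ε i| = 1) ∧
      ∑ i ∈ F, ‖v i‖ ^ 2 ≤ ‖∑ i ∈ F, ε i • v i‖ ^ 2 := by
  classical
  induction F using Finset.induction_on with
  | empty => exact ⟨fun _ => 1, by simp, by simp⟩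
  | insert i F hi ih =>
    obtain ⟨ε, hε, h⟩ := ih
    obtain ⟨t, ht, ht'⟩ : ∃ t : ℝ, |t| = 1 ∧
        ‖v i‖ ^ 2 + ‖∑ j ∈ F, ε j • v j‖ ^ 2 ≤ ‖t • v i + ∑ j ∈ F, ε j • v j‖ ^ 2 := by
      have h1 := parallelogram_law_with_norm ℝ (v i) (∑ j ∈ F, ε j • v j)
      by_cases h2 : ‖v i‖ ^ 2 + ‖∑ j ∈ F, ε j • v j‖ ^ 2 ≤ ‖v i + ∑ j ∈ F, ε j • v j‖ ^ 2
      · exact ⟨1, abs_one, by rwa [one_smul]⟩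
      · refine ⟨-1, by simp, ?_⟩
        have e : (-1 : ℝ) • v i + ∑ j ∈ F, ε j • v j = -(v i - ∑ j ∈ F, ε j • v j) := by
          rw [neg_one_smul]; abel
        rw [e, norm_neg]
        nlinarith
    refine ⟨Function.update ε i t, fun j => ?_, ?_⟩
    · by_cases hj : j = i
      · rw [hj, Function.update_self, ht]
      · rw [Function.update_of_ne hj, hε]
    · have e : ∑ j ∈ F, Function.update ε i t j • v j = ∑ j ∈ F, ε j • v j :=
        Finset.sum_congr rfl fun j hj => by
          rw [Function.update_of_ne (ne_of_mem_of_not_mem hj hi)]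
      rw [Finset.sum_insert hi, Finset.sum_insert hi, Function.update_self, e]
      linarith

/-- If the 2-convexification is isomorphic to `ℓ₂`, then the norm is equivalent to the `ℓ₁` norm. -/
theorem exists_l1Norm_le_of_equiv {N : UncNorm} (T : Convexified N ≃L[ℝ] Ell2) :
    ∃ c : ℝ, 0 < c ∧ ∀ x, c * l1Norm x ≤ N.toFun x := by
  set hb := C00Completion.basis_oneUnconditional N
  set A := ‖(T : Convexified N →L[ℝ] Ell2)‖ with hA
  set B := ‖(T.symm : Ell2 →L[ℝ] Convexified N)‖ with hB
  have hT : ∀ x, ‖T x‖ ≤ A * ‖x‖ := fun x => (T : Convexified N →L[ℝ] Ell2).le_opNorm x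
  have hT' : ∀ x, ‖x‖ ≤ B * ‖T x‖ := fun x => by
    have := (T.symm : Ell2 →L[ℝ] Convexified N).le_opNorm (T x)
    simpa using this
  have hA0 : 0 ≤ A := norm_nonneg _
  have hB0 : 0 ≤ B := norm_nonneg _
  have main : ∀ x, l1Norm x ≤ (A * B + 1) ^ 2 * N.toFun x := by
    intro x
    -- The vectors `√|x i| e_i` have squared norm `|x i|`, and any signed sum of them has squared
    -- norm `N x`, since its square is `|x|`. Comparing both in the Hilbert space bounds `∑ |x i|`
    -- by a multiple of `N x`.
    obtain ⟨ε, hε, h⟩ := exists_signs_sum_norm_sq_le x.support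
      fun i => T (ofSeq (Conv2.basis hb) (Finsupp.single i √|x i|))
    have h1 : ∀ i ∈ x.support, |x i|
        ≤ B ^ 2 * ‖T (ofSeq (Conv2.basis hb) (Finsupp.single i √|x i|))‖ ^ 2 := by
      intro i _
      have h2 := pow_le_pow_left₀ (norm_nonneg _)
        (hT' (ofSeq (Conv2.basis hb) (Finsupp.single i √|x i|))) 2
      rw [mul_pow] at h2
      refine le_trans (le_of_eq ?_) h2
      have h3 : (Finsupp.single i √|x i|).sqr = |x i| • Finsupp.single i (1 : ℝ) := by
        rw [Finsupp.sqr, Finsupp.mapRange_single, Real.sq_sqrt (abs_nonneg _)]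
        simp
      rw [Conv2.norm_ofSeq_sq, C00Completion.norm_ofSeq, h3, N.smul_eq, N.single_one, abs_abs,
        mul_one]
    set s : ℕ+ →₀ ℝ := ∑ i ∈ x.support, ε i • Finsupp.single i √|x i| with hs
    have h4 : ∑ i ∈ x.support, ε i • T (ofSeq (Conv2.basis hb) (Finsupp.single i √|x i|))
        = T (ofSeq (Conv2.basis hb) s) := by
      rw [hs, map_sum, map_sum]
      simp_rw [map_smul]
    have h5 : ‖ofSeq (Conv2.basis hb) s‖ ^ 2 = N.toFun x := by
      rw [Conv2.norm_ofSeq_sq, C00Completion.norm_ofSeq]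
      have h6 : ∀ i, s.sqr i = |x i| := by
        classical
        intro i
        show (s i) ^ 2 = _
        rw [hs, Finsupp.finsetSum_apply]
        simp only [Finsupp.smul_apply, Finsupp.single_apply, smul_eq_mul, mul_ite, mul_zero,
          Finset.sum_ite_eq', Finsupp.mem_support_iff]
        split_ifs with hi
        · rw [mul_pow, Real.sq_sqrt (abs_nonneg _), ← sq_abs, hε, one_pow, one_mul]
        · rw [not_not.1 hi]; simp
      exact le_antisymm (N.mono _ _ fun i => by rw [h6, abs_abs])
        (N.mono _ _ fun i => by rw [h6, abs_abs])
    rw [h4] at h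
    have h7 := pow_le_pow_left₀ (norm_nonneg _) (hT (ofSeq (Conv2.basis hb) s)) 2
    rw [mul_pow, h5] at h7
    have hN := N.nonneg x
    calc l1Norm x ≤ ∑ i ∈ x.support,
          B ^ 2 * ‖T (ofSeq (Conv2.basis hb) (Finsupp.single i √|x i|))‖ ^ 2 := Finset.sum_le_sum h1
      _ ≤ B ^ 2 * (A ^ 2 * N.toFun x) := by
          rw [← Finset.mul_sum]
          exact mul_le_mul_of_nonneg_left (h.trans h7) (sq_nonneg _)
      _ = (A * B) ^ 2 * N.toFun x := by ring
      _ ≤ (A * B + 1) ^ 2 * N.toFun x := by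
          have : 0 ≤ A * B := by positivity
          gcongr
          linarith
  refine ⟨((A * B + 1) ^ 2)⁻¹, by positivity, fun x => ?_⟩
  rw [inv_mul_le_iff₀ (by positivity)]
  exact main x

theorem hasEllOneBlocks_of_l1Norm_le {N : UncNorm} {c : ℝ} (hc : 0 < c)
    (h : ∀ x, c * l1Norm x ≤ N.toFun x) : HasEllOneBlocks (C00Completion.basis N) := by
  classical
  refine ⟨fun k => Finsupp.single k.succPNat 1, fun k => k, c, 1, hc,
    ⟨strictMono_id, fun k a ha => ?_⟩, fun F a => ?_⟩
  · have : a = k.succPNat := by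
      by_contra hne
      exact Finsupp.mem_support_iff.1 ha (Finsupp.single_eq_of_ne hne)
    rw [this, Nat.succPNat_coe]
    exact ⟨k.lt_succ_self, le_rfl⟩
  · rw [sum_smul_ofSeq, C00Completion.norm_ofSeq, lpSum_one]
    set x : ℕ+ →₀ ℝ := ∑ k ∈ F, a k • Finsupp.single k.succPNat 1 with hx
    have hxk : ∀ k ∈ F, x k.succPNat = a k := fun k hk => by
      rw [hx, Finsupp.finsetSum_apply, Finset.sum_eq_single_of_mem k hk]
      · simp
      · intro l _ hlk
        rw [Finsupp.smul_apply, Finsupp.single_eq_of_ne fun h =>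
          hlk (Nat.succPNat_injective h.symm), smul_zero]
    constructor
    · refine le_trans (mul_le_mul_of_nonneg_left ?_ hc.le) (h x)
      have h1 : ∑ k ∈ F, |a k| = ∑ i ∈ F.image Nat.succPNat, |x i| := by
        rw [Finset.sum_image fun _ _ _ _ h => Nat.succPNat_injective h]
        exact Finset.sum_congr rfl fun k hk => by rw [hxk k hk]
      have h2 : l1Norm x = ∑ i ∈ F.image Nat.succPNat ∪ x.support, |x i| :=
        Finset.sum_subset Finset.subset_union_right fun i _ hi => by
          rw [Finsupp.notMem_support_iff.1 hi, abs_zero]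
      rw [h1, h2]
      exact Finset.sum_le_sum_of_subset_of_nonneg Finset.subset_union_left fun _ _ _ => abs_nonneg _
    · rw [one_mul]
      refine (N.sum_le F _).trans (Finset.sum_le_sum fun k _ => ?_)
      rw [N.smul_eq, N.single_one, mul_one]

/-! ### The main results for a general rule -/

section Rule

variable {θ : ℕ+ → ℝ} (hθ : ∀ n, θ n ∈ Ioo (0 : ℝ) 1) {A : FamilyRule} (hA : A.Disj)

theorem limNorm_isWeakHilbert_and_not_containsIsomorph (hlim : Tendsto θ atTop (𝓝 0))
    (hG : A.Good) : IsWeakHilbert (Convexified (limNorm hθ hA)) ∧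
      ¬ ContainsIsomorph (Convexified (limNorm hθ hA)) Ell2 :=
  ⟨isWeakHilbert_convexified (hθ 1).1 (limNorm_lowerEllOne hθ hA hG), fun h =>
    limNorm_not_hasEllOneBlocks hθ hlim hA hG (hasEllOneBlocks_of_containsIsomorph_conv2 _ h)⟩

theorem sumNorm_isWeakHilbert_and_isSaturated {α : ℕ+ → ℝ} (hα : ∀ n, α n ∈ Ioo (0 : ℝ) 1)
    (hsum : HasSum α 1) {l : ℝ} (hl : 0 < l) (hlα : ∀ n, l ≤ α (n + 1) / α n)
    (hlim : Tendsto θ atTop (𝓝 0)) (hG : A.Good) :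
    IsWeakHilbert (Convexified (sumNorm hα hsum fun n => iterNorm hθ hA n)) ∧
      IsSaturated (Convexified (sumNorm hα hsum fun n => iterNorm hθ hA n)) Ell2 ∧
        IsEmpty (Convexified (sumNorm hα hsum fun n => iterNorm hθ hA n) ≃L[ℝ] Ell2) := by
  refine ⟨isWeakHilbert_convexified (mul_pos hl (hθ 1).1)
    (sumNorm_iterNorm_lowerEllOne hα hsum hθ hA hG hlα),
    isSaturated_convexified fun 𝒞 h𝒞 => exists_ellOne_blocks hα hsum hθ hA hlim hG hl hlα h𝒞,
    ⟨fun T => ?_⟩⟩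
  -- Each iterate is at most the limit norm and the weights sum to 1, so the `ℓ₁` lower bound passes
  -- to the limit norm, where the unit vectors would be `ℓ₁` blocks.
  obtain ⟨c, hc, h⟩ := exists_l1Norm_le_of_equiv T
  refine limNorm_not_hasEllOneBlocks hθ hlim hA hG (hasEllOneBlocks_of_l1Norm_le hc fun x =>
    (h x).trans (sumNorm_le hα hsum (fun n y => ?_) x))
  exact le_ciSup (iterNorm_bdd hθ hA y) _

end Rule

theorem mainTheorem4 (θ : ℕ+ → ℝ) (hθ : ∀ n, θ n ∈ Set.Ioo (0 : ℝ) 1)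
    (hθlim : Filter.Tendsto θ Filter.atTop (nhds 0)) (s : ℕ+)
    (α : ℕ+ → ℝ) (hα : ∀ n, α n ∈ Set.Ioo (0 : ℝ) 1) (hsum : HasSum α 1)
    (hratio : ∃ l ∈ Set.Ioo (0 : ℝ) 1, ∃ u ∈ Set.Ioo (0 : ℝ) 1,
      ∀ n, l ≤ α (n + 1) / α n ∧ α (n + 1) / α n ≤ u) :
    (∀ (X : Type*) [NormedAddCommGroup X] [NormedSpace ℝ X] [CompleteSpace X]
        (b : UnconditionalSchauderBasis ℕ+ ℝ X) (hb : OneUnconditional b),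
        ContainsIsomorph X Ell1 ↔ ContainsIsomorph (Conv2 b hb) Ell2) ∧
    (IsWeakHilbert (Convexified (normV hθ)) ∧
      ¬ ContainsIsomorph (Convexified (normV hθ)) Ell2) ∧
    (IsWeakHilbert (Convexified (normW hθ s)) ∧
      ¬ ContainsIsomorph (Convexified (normW hθ s)) Ell2) ∧
    (IsWeakHilbert (Convexified (normVPrime hθ hα hsum)) ∧
      IsSaturated (Convexified (normVPrime hθ hα hsum)) Ell2 ∧
      IsEmpty (Convexified (normVPrime hθ hα hsum) ≃L[ℝ] Ell2)) ∧
    (IsWeakHilbert (Convexified (normWPrime hθ s hα hsum)) ∧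
      IsSaturated (Convexified (normWPrime hθ s hα hsum)) Ell2 ∧
      IsEmpty (Convexified (normWPrime hθ s hα hsum) ≃L[ℝ] Ell2)) := by
  obtain ⟨l, hl, u, hu, hlu⟩ := hratio
  have hlα : ∀ n, l ≤ α (n + 1) / α n := fun n => (hlu n).1
  exact ⟨fun _ _ _ _ _ hb => containsIsomorph_ell1_iff hb,
    limNorm_isWeakHilbert_and_not_containsIsomorph hθ ruleV_disj hθlim ruleV_good,
    limNorm_isWeakHilbert_and_not_containsIsomorph hθ (ruleW_disj s) hθlim (ruleW_good s),
    sumNorm_isWeakHilbert_and_isSaturated hθ ruleV_disj hα hsum hl.1 hlα hθlim ruleV_good,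
    sumNorm_isWeakHilbert_and_isSaturated hθ (ruleW_disj s) hα hsum hl.1 hlα hθlim (ruleW_good s)⟩
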